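/- Let $p_\circ,p_\bullet\in[0,1]$, $q\in(0,1)$, $\rho\in(0,\infty)$, put $v_\circ=2p_\circ-1$, $v_\bullet=2p_\bullet-1$, and assume $v_\circ>-1$ and $v_\bullet>0$. Let $(N(z))_{z\in\mathbb Z}$ be i.i.d. Poisson($\rho$) random variables, let $(S^{z,i})_{z\in\mathbb Z,\,i\ge 1}$ be independent two-sided lazy simple random walks on $\mathbb Z$ with $S^{z,i}_0=z$ (steps $-1,0,1$ with probabilities $\frac{1-q}2,q,\frac{1-q}2$; past and future independent), and let $(U_y)_{y\in\mathbb Z^2}$ be i.i.d. uniform on $[0,1]$, the three families being independent; write $\mathbb P$ for their joint law. Let $\omega=\sum_z\sum_{1\le i\le N(z)}\delta_{S^{z,i}}$ and $\mathcal T=\{(S^{z,i}_n,n):\ z\in\mathbb Z,\ 1\le i\le N(z),\ n\in\mathbb Z\}$. For $y\in\mathbb Z^2$ let $Y^y_0=y$ and let $Y^y_{n+1}=Y^y_n+(1,1)$ if either $Y^y_n\in\mathcal T$ and $U_{Y^y_n}\le p_\bullet$, or $Y^y_n\notin\mathcal T$ and $U_{Y^y_n}\le p_\circ$, and $Y^y_{n+1}=Y^y_n+(-1,1)$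 otherwise. Let $Y=Y^0$ and let $X_n$ be the first coordinate of $Y_n$. Let $v_\star\in(0,v_\bullet)$ be such that for some $c>0$ and $\gamma>1$, $$\mathbb P\big(\exists\,n\ge1:\ X_n<nv_\star-L\big)\le c^{-1}e^{-c(\log L)^\gamma}\qquad\text{for all integers }L\ge1 .$$ Put $\bar v=v_\star/3$ and, for $y\in\mathbb Z^2$, $\angle(y)=y+\{(x,n)\in\mathbb Z^2:\ x,n\ge0,\ x\ge\bar vn\}$ and $\angle^-(y)=y+\{(x,n)\in\mathbb Z^2:\ x,n\le0,\ x<\bar vn\}$. Let $W_y$ be the set of trajectories $w:\mathbb Z\to\mathbb Z$ whose trace $\{(w(n),n):n\in\mathbb Z\}$ meets both $\angle(y)$ and $\angle^-(y)$, let $A^y=\{Y^y_n\in\angle(y)\ \forall n\ge0\}$ and $\mathbb P^\angle=\mathbb P(\,\cdot\mid\omega(W_0)=0,\,A^0)$. For $k\ge1$ let $R_k=\inf\{n\ge0:\ X_n\ge(1-\bar v)k+\bar vn\}$, let $$\mathcal I=\inf\{k\ge1:\ R_k<\infty,\ \omega(W_{Y_{R_k}})=0\text{ and }A^{Y_{R_k}}\text{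 occurs}\},$$ and let $\tau=R_{\mathcal I}$ (with $\tau=\infty$ if $\mathcal I=\infty$). Then, on an enlargement of the probability space, there is a sequence $(\tau_n)_{n\ge1}$ of random times with values in $\{0,1,2,\dots\}$ such that $\tau_1=\tau$ almost surely (in particular $\tau<\infty$ almost surely) and, under $\mathbb P$ and with $S_n=\sum_{i=1}^n\tau_i$, the sequence $$\Big(\tau_{n+1},\ (X_{S_n+s}-X_{S_n})_{0\le s\le\tau_{n+1}}\Big)_{n\ge1}$$ is i.i.d., is independent of $(\tau,(X_s)_{0\le s\le\tau})$, and each of its terms is distributed as $(\tau,(X_s)_{0\le s\le\tau})$ under $\mathbb P^\angle$. -/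

import Mathlib

open MeasureTheory ProbabilityTheory Set
open scoped NNReal ENNReal

noncomputable section

namespace RWDRE

/-! ### The dynamic random environment -/

/-- Law of one step of a lazy simple random walk on `ℤ`: the steps `-1`, `0`, `1` have
probabilities `(1 - q) / 2`, `q`, `(1 - q) / 2`. -/
def stepLaw (q : Ioo (0 : ℝ) 1) : Measure ℤ :=
  ENNReal.ofReal ((1 - (q : ℝ)) / 2) • Measure.dirac (-1) +
    ENNReal.ofReal (q : ℝ) • Measure.dirac 0 +
    ENNReal.ofReal ((1 - (q : ℝ)) / 2) • Measure.dirac 1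

instance (q : Ioo (0 : ℝ) 1) : IsProbabilityMeasure (stepLaw q) := by
  constructor
  have h0 : (0 : ℝ) < q := q.2.1
  have h1 : (q : ℝ) < 1 := q.2.2
  simp only [stepLaw, Measure.add_apply, Measure.smul_apply, measure_univ, smul_eq_mul, mul_one]
  rw [← ENNReal.ofReal_add (by linarith) h0.le, ← ENNReal.ofReal_add (by linarith) (by linarith)]
  rw [← ENNReal.ofReal_one]
  congr 1
  ring

/-- Sample points: the initial particle numbers `N(z, 0)`, the steps of the particles labelled
`(z, i)`, and the variables `U_y` attached to the space-time points `y`. -/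
abbrev Sample : Type := (ℤ → ℕ) × (ℤ × ℕ → ℤ → ℤ) × (ℤ × ℤ → unitInterval)

/-- The annealed law with particle density `ρ`: the numbers of particles are Poisson(`ρ`), the
steps are lazy simple random walk steps, the `U_y` are uniform on `[0, 1]`, and all these
variables are independent. -/
def law (q : Ioo (0 : ℝ) 1) (ρ : ℝ≥0) : Measure Sample :=
  (Measure.infinitePi fun _ : ℤ => poissonMeasure ρ).prod
    ((Measure.infinitePi fun _ : ℤ × ℕ => Measure.infinitePi fun _ : ℤ => stepLaw q).prod
      (Measure.infinitePi fun _ : ℤ × ℤ => (volume : Measure unitInterval)))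

/-- The two-sided trajectory `w` with `w 0 = z` built from the steps `e`: the steps
`e 0, e 1, …` drive the future, and `e (-1), e (-2), …` drive the past, read backwards in time. -/
def twoSidedPath (z : ℤ) (e : ℤ → ℤ) : ℤ → ℤ
  | Int.ofNat n => z + ∑ k ∈ Finset.range n, e k
  | Int.negSucc n => z + ∑ k ∈ Finset.range (n + 1), e (-((k : ℤ) + 1))

/-- Trajectory `S^{z,i}` of the environment particle `(z, i)`. -/
def particle (s : Sample) (z : ℤ) (i : ℕ) : ℤ → ℤ := twoSidedPath z (s.2.1 (z, i))

/-- The point measure `ω = ∑_z ∑_{i < N(z,0)} δ_{S^{z,i}}` on the space of trajectories.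
Almost surely, all its atoms are nearest-neighbour trajectories. -/
def omega (s : Sample) : Measure (ℤ → ℤ) :=
  Measure.sum fun z : ℤ => ∑ i ∈ Finset.range (s.1 z), Measure.dirac (particle s z i)

/-- The set `𝒯` of space-time points `(x, n)` covered by the environment particles. -/
def trace (s : Sample) : Set (ℤ × ℤ) :=
  {y | ∃ (z : ℤ) (i : ℕ), i < s.1 z ∧ particle s z i y.2 = y.1}

/-! ### The random walk -/

open Classical in
/-- The space-time process `Y^y`. -/
def walkY (pVac pOcc : ℝ) (s : Sample) (y : ℤ × ℤ) : ℕ → ℤ × ℤ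
  | 0 => y
  | n + 1 =>
    let z := walkY pVac pOcc s y n
    if (z ∈ trace s ∧ (s.2.2 z : ℝ) ≤ pOcc) ∨ (z ∉ trace s ∧ (s.2.2 z : ℝ) ≤ pVac) then
      z + (1, 1)
    else
      z + (-1, 1)

/-- The random walk `X` started at the origin at time zero. -/
def walkX (pVac pOcc : ℝ) (s : Sample) (n : ℕ) : ℤ := (walkY pVac pOcc s 0 n).1

/-- The `vStar`-ballisticity condition. -/
def Ballistic (pVac pOcc : ℝ) (q : Ioo (0 : ℝ) 1) (ρ : ℝ≥0) (vStar : ℝ) : Prop :=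
  ∃ c : ℝ, 0 < c ∧ ∃ γ : ℝ, 1 < γ ∧ ∀ L : ℕ, 1 ≤ L →
    (law q ρ).real {s | ∃ n : ℕ, 1 ≤ n ∧ (walkX pVac pOcc s n : ℝ) < n * vStar - L} ≤
      c⁻¹ * Real.exp (-c * Real.log L ^ γ)

/-! ### Cones, records and the regeneration time -/

/-- The cone `∠(y)` in the first quadrant based at `y`, with angle `vBar`. -/
def cone (vBar : ℝ) (y : ℤ × ℤ) : Set (ℤ × ℤ) :=
  {z | y.1 ≤ z.1 ∧ y.2 ≤ z.2 ∧ vBar * ((z.2 - y.2 : ℤ) : ℝ) ≤ ((z.1 - y.1 : ℤ) : ℝ)}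

/-- The cone in the third quadrant based at `y`, with angle `vBar`. -/
def backCone (vBar : ℝ) (y : ℤ × ℤ) : Set (ℤ × ℤ) :=
  {z | z.1 ≤ y.1 ∧ z.2 ≤ y.2 ∧ ((z.1 - y.1 : ℤ) : ℝ) < vBar * ((z.2 - y.2 : ℤ) : ℝ)}

/-- Trajectories that intersect both cones based at `y`. -/
def crossing (vBar : ℝ) (y : ℤ × ℤ) : Set (ℤ → ℤ) :=
  {w | (∃ n : ℤ, (w n, n) ∈ cone vBar y) ∧ ∃ n : ℤ, (w n, n) ∈ backCone vBar y}

/-- The event `A^y`: the walk started at `y` stays in the cone `∠(y)` forever. -/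
def staysInCone (pVac pOcc vBar : ℝ) (y : ℤ × ℤ) : Set Sample :=
  {s | ∀ n : ℕ, walkY pVac pOcc s y n ∈ cone vBar y}

/-- The event that no environment particle crosses from one cone based at `y` to the other one,
and that `A^y` occurs. -/
def regEvent (pVac pOcc vBar : ℝ) (y : ℤ × ℤ) : Set Sample :=
  {s | omega s (crossing vBar y) = 0} ∩ staysInCone pVac pOcc vBar y

/-- The law `P^∠`. -/
def coneLaw (pVac pOcc : ℝ) (q : Ioo (0 : ℝ) 1) (ρ : ℝ≥0) (vBar : ℝ) : Measure Sample :=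
  ProbabilityTheory.cond (law q ρ) (regEvent pVac pOcc vBar 0)

/-- The record time `R_k`, equal to `⊤` when the record is never reached. -/
def recordTime (pVac pOcc vBar : ℝ) (k : ℕ) (s : Sample) : ℕ∞ :=
  sInf ((fun n : ℕ => (n : ℕ∞)) '' {n | (1 - vBar) * k + vBar * n ≤ (walkX pVac pOcc s n : ℝ)})

/-- The indices `k ≥ 1` such that `R_k` is finite and the regeneration event occurs at the
space-time position of the walk at time `R_k`. -/
def regIndices (pVac pOcc vBar : ℝ) (s : Sample) : Set ℕ :=
  {k | 1 ≤ k ∧ ∃ n : ℕ, recordTime pVac pOcc vBar k s = n ∧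
    s ∈ regEvent pVac pOcc vBar (walkY pVac pOcc s 0 n)}

open Classical in
/-- The regeneration time `τ = R_I`, with `I` the least regeneration index (`τ = ⊤` if there is
none). -/
def regTime (pVac pOcc vBar : ℝ) (s : Sample) : ℕ∞ :=
  if (regIndices pVac pOcc vBar s).Nonempty then
    recordTime pVac pOcc vBar (sInf (regIndices pVac pOcc vBar s)) s
  else ⊤

/-! ### Blocks -/

/-- The pairs of a duration `t` and a path `(x_s)_{0 ≤ s ≤ t}` of that duration. -/
abbrev Block : Type := Σ t : ℕ, (Fin (t + 1) → ℤ)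

/-- The block `(t, (x_{a+s} - x_a)_{0 ≤ s ≤ t})` of the path `x` that starts at time `a`. -/
def block (x : ℕ → ℤ) (a t : ℕ) : Block := ⟨t, fun s => x (a + s) - x a⟩

end RWDRE

end

open RWDRE

/-! The environment is a Poisson process of trajectories together with independent uniform marks.
Its law on label-free configurations is determined by void probabilities: no trajectory in `A` and
marks in `B` has probability `exp (-intensity A) * markLaw B` (`cfgLaw_basicEvent`), and such events
form a generating π-system. Two facts follow: restrictions to disjoint sets of trajectories and
disjoint sets of sites are independent (`indepFun_restr`), and the law is invariant under space-time
shifts (`measurePreserving_shift`).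

Renewal. Let the regeneration event hold at a record point `a`. The walk before `a` lies in the back
cone of `a`, and no trajectory meets both cones. So the past of `a` is read off from the marks in
the back cone and the trajectories that miss the forward cone, while the future is read off from the
forward cone. The delicate point is that "no earlier regeneration" seems to look into the future;
but once regeneration holds at `a`, an earlier point regenerates if and only if it does so as far as
the walk up to `a` can tell (`reg_iff_locReg`). Independence and shift invariance then factorize the
probability of any finite chain of blocks (`measure_first_chain`, `measure_chain_cons`). If
regeneration occurs almost surely and has positive probability at the origin, this says that the
blocks are independent with the required laws. All the times are functions of the sample, so the
original space already serves as the enlargement.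

Positive probability (`measure_reg_ne_zero`). The trajectories that cross at the origin have finite
intensity. Enough forced steps to the right, followed by a walk that is not too slow, keep the walk
in the cone. Ballisticity enters only as `P(Slow L) → 0`.

Almost sure occurrence (`ae_exists_regAt`). After record `k`, attempt `l` forced steps followed by
regeneration. Given the past, this succeeds with probability at least a constant, provided that no
trajectory links the past of the record to the cone reached after the steps (`measure_attempt_ge`).
A link that the walk has not met is controlled by its intensity; a link met at time `m` must climb
from the walk's level at `m`, which has a cost summable over `k`. Averaging over the records in `(K,
2K]` yields far records that are free with probability close to one
(`exists_measure_compl_freeRec_le`). If regeneration failed with positive probability, that failure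
could be approximated by an event local to a box; a record far beyond the box still succeeds with
probability bounded below on the local event, a contradiction. -/

namespace RWDRE

/-! ### Void probabilities -/

/-- The function `x ↦ e^{-x}` on `[0, ∞]`. -/
noncomputable def voidExp (x : ℝ≥0∞) : ℝ≥0∞ := (EReal.exp x)⁻¹

lemma voidExp_zero : voidExp 0 = 1 := by simp [voidExp]

lemma voidExp_add (x y : ℝ≥0∞) : voidExp (x + y) = voidExp x * voidExp y := by
  have h : ∀ x : ℝ≥0∞, EReal.exp x ≠ 0 := fun x => by
    simp
  rw [voidExp, EReal.coe_ennreal_add, EReal.exp_add,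
    ENNReal.mul_inv (Or.inl (h x)) (Or.inr (h y))]
  rfl

lemma voidExp_sum {ι : Type*} (s : Finset ι) (f : ι → ℝ≥0∞) :
    voidExp (∑ i ∈ s, f i) = ∏ i ∈ s, voidExp (f i) := by
  classical
  induction s using Finset.induction_on with
  | empty => simp [voidExp_zero]
  | insert i s hi ih => rw [Finset.sum_insert hi, Finset.prod_insert hi, voidExp_add, ih]

lemma continuous_voidExp : Continuous voidExp :=
  continuous_inv.comp (ENNReal.continuous_exp.comp continuous_coe_ennreal_ereal)

lemma voidExp_ne_zero {x : ℝ≥0∞} (h : x ≠ ∞) : voidExp x ≠ 0 := by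
  rw [voidExp, ENNReal.inv_ne_zero, Ne, EReal.exp_eq_top_iff]
  simpa using h

lemma voidExp_ofReal {x : ℝ} (h : 0 ≤ x) :
    voidExp (ENNReal.ofReal x) = ENNReal.ofReal (Real.exp (-x)) := by
  rw [voidExp, EReal.coe_ennreal_ofReal, max_eq_left h, EReal.exp_coe, Real.exp_neg,
    ENNReal.ofReal_inv_of_pos (Real.exp_pos x)]

/-- This bounds the probability that some trajectory lies in a set by the intensity of the set. -/
lemma one_le_voidExp_add (x : ℝ≥0∞) : 1 ≤ voidExp x + x := by
  by_cases h : x = ∞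
  · simp [h]
  rw [← ENNReal.ofReal_toReal h, voidExp_ofReal ENNReal.toReal_nonneg,
    ← ENNReal.ofReal_add (Real.exp_pos _).le ENNReal.toReal_nonneg, ← ENNReal.ofReal_one]
  exact ENNReal.ofReal_le_ofReal (by linarith [Real.add_one_le_exp (-x.toReal)])

/-- Generating function of the Poisson law: `p` is the probability that one particle avoids a set.
The complement `r` is a separate variable, which avoids truncated subtraction. -/
lemma lintegral_pow_poissonMeasure (ρ : ℝ≥0) {p r : ℝ≥0∞} (h : p + r = 1) :
    ∫⁻ n, p ^ n ∂(poissonMeasure ρ) = voidExp (ρ * r) := by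
  have hp : p ≤ 1 := h ▸ le_self_add
  have hr : r ≤ 1 := h ▸ le_add_self
  lift p to ℝ≥0 using ne_top_of_le_ne_top ENNReal.one_ne_top hp
  lift r to ℝ≥0 using ne_top_of_le_ne_top ENNReal.one_ne_top hr
  have h' : (p : ℝ) + r = 1 := by exact_mod_cast h
  rw [← ENNReal.coe_mul, ← ENNReal.ofReal_coe_nnreal (p := ρ * r), voidExp_ofReal (by positivity),
    lintegral_countable']
  have : ∀ n : ℕ, (p : ℝ≥0∞) ^ n * poissonMeasure ρ {n} =
      ENNReal.ofReal (Real.exp (-ρ) * ((p * ρ : ℝ) ^ n / (n.factorial))) := by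
    intro n
    rw [poissonMeasure_singleton, ← ENNReal.ofReal_coe_nnreal, ← ENNReal.ofReal_pow (by positivity),
      ← ENNReal.ofReal_mul (by positivity)]
    congr 1
    rw [mul_pow]; ring
  simp_rw [this]
  have hs : HasSum (fun n : ℕ => Real.exp (-ρ) * ((p * ρ : ℝ) ^ n / (n.factorial)))
      (Real.exp (-ρ) * Real.exp (p * ρ)) := by
    rw [Real.exp_eq_exp_ℝ]
    exact (NormedSpace.expSeries_div_hasSum_exp (p * ρ : ℝ)).mul_left _
  rw [← ENNReal.ofReal_tsum_of_nonneg (fun n => by positivity) hs.summable, hs.tsum_eq,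
    ← Real.exp_add]
  congr 2
  push_cast
  linear_combination ρ * h'

/-! ### Configurations -/

/-- A configuration: a set of trajectories and a family of marks. -/
structure Cfg where
  paths : Set (ℤ → ℤ)
  mark : ℤ × ℤ → unitInterval

/-- The basic events: no trajectory in `A`, and marks in `B`. -/
def basicEvent (A : Set (ℤ → ℤ)) (B : Set (ℤ × ℤ → unitInterval)) : Set Cfg :=
  {c | c.paths ∩ A = ∅ ∧ c.mark ∈ B}

def basicEvents : Set (Set Cfg) :=
  {E | ∃ A B, MeasurableSet A ∧ MeasurableSet B ∧ E = basicEvent A B}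

instance : MeasurableSpace Cfg := MeasurableSpace.generateFrom basicEvents

lemma basicEvent_inter (A A' : Set (ℤ → ℤ)) (B B' : Set (ℤ × ℤ → unitInterval)) :
    basicEvent A B ∩ basicEvent A' B' = basicEvent (A ∪ A') (B ∩ B') := by
  ext c
  simp only [basicEvent, mem_inter_iff, mem_ofPred_eq, inter_union_distrib_left, union_empty_iff]
  tauto

lemma isPiSystem_basicEvents : IsPiSystem basicEvents := by
  rintro _ ⟨A, B, hA, hB, rfl⟩ _ ⟨A', B', hA', hB', rfl⟩ -
  exact ⟨_, _, hA.union hA', hB.inter hB', basicEvent_inter _ _ _ _⟩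

lemma measurableSet_basicEvent {A : Set (ℤ → ℤ)} {B : Set (ℤ × ℤ → unitInterval)}
    (hA : MeasurableSet A) (hB : MeasurableSet B) : MeasurableSet (basicEvent A B) :=
  MeasurableSpace.measurableSet_generateFrom ⟨A, B, hA, hB, rfl⟩

lemma measurable_cfg {α : Type*} [MeasurableSpace α] {f : α → Cfg}
    (h : ∀ A B, MeasurableSet A → MeasurableSet B → MeasurableSet (f ⁻¹' basicEvent A B)) :
    Measurable f := by
  refine measurable_generateFrom ?_
  rintro _ ⟨A, B, hA, hB, rfl⟩
  exact h A B hA hB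

lemma measurableSet_void {A : Set (ℤ → ℤ)} (hA : MeasurableSet A) :
    MeasurableSet {c : Cfg | c.paths ∩ A = ∅} := by
  simpa [basicEvent] using measurableSet_basicEvent hA MeasurableSet.univ

lemma measurable_mark : Measurable Cfg.mark := by
  intro B hB
  have : Cfg.mark ⁻¹' B = basicEvent ∅ B := by ext c; simp [basicEvent]
  rw [this]
  exact measurableSet_basicEvent MeasurableSet.empty hB

/-- The configuration of a sample. -/
def toCfg (s : Sample) : Cfg := ⟨{w | ∃ z i, i < s.1 z ∧ particle s z i = w}, s.2.2⟩

lemma measurable_twoSidedPath (z : ℤ) : Measurable (twoSidedPath z) := by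
  rw [measurable_pi_iff]
  rintro (n | n) <;> simp only [twoSidedPath] <;> fun_prop

lemma toCfg_preimage (A : Set (ℤ → ℤ)) (B : Set (ℤ × ℤ → unitInterval)) :
    toCfg ⁻¹' basicEvent A B = {s | (∀ z, ∀ i < s.1 z, particle s z i ∉ A) ∧ s.2.2 ∈ B} := by
  ext s
  simp only [toCfg, basicEvent, mem_preimage, mem_ofPred_eq, eq_empty_iff_forall_notMem,
    mem_inter_iff, not_and]
  refine and_congr_left fun _ => ⟨fun h z i hi => h _ ⟨z, i, hi, rfl⟩, ?_⟩
  rintro h _ ⟨z, i, hi, rfl⟩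
  exact h z i hi

lemma measurable_particle (z : ℤ) (i : ℕ) : Measurable fun s => particle s z i :=
  (measurable_twoSidedPath z).comp (by fun_prop)

lemma measurableSet_avoid {A : Set (ℤ → ℤ)} (hA : MeasurableSet A) (z : ℤ) :
    MeasurableSet {s : Sample | ∀ i < s.1 z, particle s z i ∉ A} := by
  have : {s : Sample | ∀ i < s.1 z, particle s z i ∉ A} =
      ⋂ i, ({s : Sample | i < s.1 z}ᶜ ∪ {s | particle s z i ∈ A}ᶜ) := by
    ext s
    simp only [mem_ofPred_eq, mem_iInter, mem_union, mem_compl_iff]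
    exact forall_congr' fun i => by tauto
  rw [this]
  refine MeasurableSet.iInter fun i => .union (.compl ?_) (.compl (measurable_particle z i hA))
  exact measurableSet_lt (by fun_prop) (by fun_prop)

lemma measurable_toCfg : Measurable toCfg := by
  refine measurable_cfg fun A B hA hB => ?_
  rw [toCfg_preimage, ofPred_and, ofPred_forall]
  refine .inter (.iInter fun z => measurableSet_avoid hA z) ?_
  exact (measurable_snd.comp measurable_snd) hB

/-- The law of the trajectory of a particle started at `z`. -/
noncomputable def pathLaw (q : Ioo (0 : ℝ) 1) (z : ℤ) : Measure (ℤ → ℤ) :=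
  (Measure.infinitePi fun _ : ℤ => stepLaw q).map (twoSidedPath z)

instance (q : Ioo (0 : ℝ) 1) (z : ℤ) : IsProbabilityMeasure (pathLaw q z) :=
  Measure.isProbabilityMeasure_map (measurable_twoSidedPath z).aemeasurable

/-- The intensity of the point process of trajectories. -/
noncomputable def intensity (q : Ioo (0 : ℝ) 1) (ρ : ℝ≥0) : Measure (ℤ → ℤ) :=
  (ρ : ℝ≥0∞) • Measure.sum (pathLaw q)

/-- The law of the marks. -/
noncomputable abbrev markLaw : Measure (ℤ × ℤ → unitInterval) :=
  Measure.infinitePi fun _ : ℤ × ℤ => (volume : Measure unitInterval)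

instance (q : Ioo (0 : ℝ) 1) (ρ : ℝ≥0) : IsProbabilityMeasure (law q ρ) := by
  unfold law; infer_instance

/-- Given the numbers `N z`, the particles are independent and avoid `A` with probability `∏
(pathLaw q z Aᶜ) ^ N z`; integrating over the independent Poisson numbers turns each factor into an
exponential. -/
lemma law_avoid_finset (q : Ioo (0 : ℝ) 1) (ρ : ℝ≥0) {A : Set (ℤ → ℤ)}
    {B : Set (ℤ × ℤ → unitInterval)} (hA : MeasurableSet A) (hB : MeasurableSet B)
    (t : Finset ℤ) :
    law q ρ {s | (∀ z ∈ t, ∀ i < s.1 z, particle s z i ∉ A) ∧ s.2.2 ∈ B} =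
      voidExp (∑ z ∈ t, ρ * pathLaw q z A) * markLaw B := by
  have hm : MeasurableSet {s : Sample | (∀ z ∈ t, ∀ i < s.1 z, particle s z i ∉ A) ∧ s.2.2 ∈ B} := by
    rw [ofPred_and]
    refine .inter ?_ ((measurable_snd.comp measurable_snd) hB)
    simp only [ofPred_forall]
    exact Finset.measurableSet_biInter _ fun z _ => by
      simpa only [ofPred_forall] using measurableSet_avoid hA z
  rw [law, Measure.prod_apply hm]
  have key : ∀ N : ℤ → ℕ,
      (((Measure.infinitePi fun _ : ℤ × ℕ => Measure.infinitePi fun _ : ℤ => stepLaw q).prod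
        markLaw) (Prod.mk N ⁻¹'
          {s : Sample | (∀ z ∈ t, ∀ i < s.1 z, particle s z i ∉ A) ∧ s.2.2 ∈ B})) =
      (∏ z ∈ t, (pathLaw q z Aᶜ) ^ N z) * markLaw B := by
    intro N
    have : Prod.mk N ⁻¹' {s : Sample | (∀ z ∈ t, ∀ i < s.1 z, particle s z i ∉ A) ∧ s.2.2 ∈ B} =
        Set.pi (((t.sigma fun z => Finset.range (N z)).map
          (Equiv.sigmaEquivProd ℤ ℕ).toEmbedding : Finset (ℤ × ℕ)) : Set (ℤ × ℕ))
          (fun j => twoSidedPath j.1 ⁻¹' Aᶜ) ×ˢ B := by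
      ext ⟨e, u⟩
      simp only [particle, mem_preimage, mem_ofPred_eq, mem_prod, Set.mem_pi, Finset.mem_coe,
        Finset.mem_map_equiv, Finset.mem_sigma, Finset.mem_range, mem_compl_iff, Prod.forall,
        Equiv.sigmaEquivProd_symm_apply]
      grind
    rw [this, Measure.prod_prod, Measure.infinitePi_pi _ (fun j _ =>
      measurable_twoSidedPath j.1 hA.compl), Finset.prod_map, Finset.prod_sigma]
    congr 1
    refine Finset.prod_congr rfl fun z _ => ?_
    simp [pathLaw, Measure.map_apply (measurable_twoSidedPath z) hA.compl]
  simp_rw [key]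
  rw [lintegral_mul_const _ (by fun_prop), voidExp_sum]
  congr 1
  have hi : iIndepFun (fun (z : ℤ) (N : ℤ → ℕ) => (pathLaw q z Aᶜ) ^ N z)
      (Measure.infinitePi fun _ : ℤ => poissonMeasure ρ) :=
    iIndepFun_infinitePi (X := fun (z : ℤ) (n : ℕ) => (pathLaw q z Aᶜ) ^ n) (by fun_prop)
  have := lintegral_prod_eq_prod_lintegral_of_indepFun t _ hi (by fun_prop)
  rw [this]
  refine Finset.prod_congr rfl fun z _ => ?_
  rw [← lintegral_pow_poissonMeasure ρ (p := pathLaw q z Aᶜ) (r := pathLaw q z A),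
    ← (measurePreserving_eval_infinitePi (fun _ : ℤ => poissonMeasure ρ) z).lintegral_comp
      (by fun_prop)]
  rw [add_comm, prob_add_prob_compl hA]

/-- The law of the configuration. -/
noncomputable def cfgLaw (q : Ioo (0 : ℝ) 1) (ρ : ℝ≥0) : Measure Cfg := (law q ρ).map toCfg

instance (q : Ioo (0 : ℝ) 1) (ρ : ℝ≥0) : IsProbabilityMeasure (cfgLaw q ρ) :=
  Measure.isProbabilityMeasure_map measurable_toCfg.aemeasurable

/-- The void formula is the decreasing limit of its version for finitely many starting points. It
holds also when the intensity of `A` is infinite, since `voidExp` is continuous on `[0, ∞]`. -/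
lemma cfgLaw_basicEvent (q : Ioo (0 : ℝ) 1) (ρ : ℝ≥0) {A : Set (ℤ → ℤ)}
    {B : Set (ℤ × ℤ → unitInterval)} (hA : MeasurableSet A) (hB : MeasurableSet B) :
    cfgLaw q ρ (basicEvent A B) = voidExp (intensity q ρ A) * markLaw B := by
  rw [cfgLaw, Measure.map_apply measurable_toCfg (measurableSet_basicEvent hA hB), toCfg_preimage]
  have h1 : {s : Sample | (∀ z, ∀ i < s.1 z, particle s z i ∉ A) ∧ s.2.2 ∈ B} =
      ⋂ t : Finset ℤ, {s | (∀ z ∈ t, ∀ i < s.1 z, particle s z i ∉ A) ∧ s.2.2 ∈ B} := by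
    ext s
    simp only [mem_iInter, mem_ofPred_eq]
    exact ⟨fun h t => ⟨fun z _ => h.1 z, h.2⟩,
      fun h => ⟨fun z => (h {z}).1 z (by simp), (h ∅).2⟩⟩
  have hm : ∀ t : Finset ℤ,
      MeasurableSet {s : Sample | (∀ z ∈ t, ∀ i < s.1 z, particle s z i ∉ A) ∧ s.2.2 ∈ B} := by
    intro t
    rw [ofPred_and]
    refine .inter ?_ ((measurable_snd.comp measurable_snd) hB)
    simp only [ofPred_forall]
    exact Finset.measurableSet_biInter _ fun z _ => by
      simpa only [ofPred_forall] using measurableSet_avoid hA z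
  rw [h1]
  have h2 := tendsto_measure_iInter_atTop (μ := law q ρ) (fun t => (hm t).nullMeasurableSet)
    (fun t t' htt' s hs => ⟨fun z hz => hs.1 z (Finset.mem_of_subset htt' hz), hs.2⟩) ⟨∅, measure_ne_top _ _⟩
  refine tendsto_nhds_unique h2 ?_
  simp only [Function.comp_def, law_avoid_finset q ρ hA hB]
  refine ENNReal.Tendsto.mul_const ?_ (Or.inr (measure_ne_top _ _))
  refine (continuous_voidExp.tendsto _).comp ?_
  rw [intensity, Measure.smul_apply, Measure.sum_apply _ hA, smul_eq_mul, ← ENNReal.tsum_mul_left]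
  exact ENNReal.summable.hasSum

end RWDRE

namespace RWDRE

/-! ### Restrictions -/

/-- The configuration that keeps only the trajectories in `B` and the marks in `D`. -/
noncomputable def Cfg.restr (B : Set (ℤ → ℤ)) (D : Set (ℤ × ℤ)) (c : Cfg) : Cfg :=
  -- Marks outside `D` are reset to `0`.
  ⟨c.paths ∩ B, D.indicator c.mark⟩

lemma restr_preimage (B : Set (ℤ → ℤ)) (D : Set (ℤ × ℤ)) (A : Set (ℤ → ℤ))
    (E : Set (ℤ × ℤ → unitInterval)) :
    Cfg.restr B D ⁻¹' basicEvent A E = basicEvent (B ∩ A) ((fun u => D.indicator u) ⁻¹' E) := by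
  ext c
  simp [Cfg.restr, basicEvent, inter_assoc]

lemma measurable_indicator_marks (D : Set (ℤ × ℤ)) :
    Measurable fun u : ℤ × ℤ → unitInterval => D.indicator u := by
  rw [measurable_pi_iff]
  intro z
  by_cases hz : z ∈ D <;> simp only [hz, indicator_of_mem, indicator_of_notMem, not_false_eq_true]
    <;> fun_prop

lemma measurable_restr {B : Set (ℤ → ℤ)} (hB : MeasurableSet B) (D : Set (ℤ × ℤ)) :
    Measurable (Cfg.restr B D) := by
  refine measurable_cfg fun A E hA hE => ?_
  rw [restr_preimage]
  exact measurableSet_basicEvent (hB.inter hA) (measurable_indicator_marks D hE)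

lemma indepFun_indicator {D D' : Set (ℤ × ℤ)} (h : Disjoint D D') :
    IndepFun (fun u : ℤ × ℤ → unitInterval => D.indicator u) (fun u => D'.indicator u)
      markLaw := by
  have hi : iIndepFun (fun (z : ℤ × ℤ) (u : ℤ × ℤ → unitInterval) => u z) markLaw :=
    iIndepFun_infinitePi (X := fun (z : ℤ × ℤ) (x : unitInterval) => x) (by fun_prop)
  have key := indep_iSup_of_disjoint (fun z => (measurable_pi_apply z).comap_le) hi h
  have hle : ∀ D : Set (ℤ × ℤ), MeasurableSpace.comap
      (fun u : ℤ × ℤ → unitInterval => D.indicator u) inferInstance ≤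
      ⨆ z ∈ D, MeasurableSpace.comap (fun u : ℤ × ℤ → unitInterval => u z) inferInstance := by
    intro D
    rw [← measurable_iff_comap_le, @measurable_pi_iff]
    intro z
    by_cases hz : z ∈ D
    · simp only [hz, indicator_of_mem]
      exact (comap_measurable _).mono (le_iSup₂_of_le z hz le_rfl) le_rfl
    · simp only [hz, not_false_eq_true, indicator_of_notMem]
      exact measurable_const
  exact indep_of_indep_of_le_left (indep_of_indep_of_le_right key (hle D')) (hle D)

/-- The intersection of two void events is the void event of the union; intensities of disjoint sets
add, so the exponentials multiply. On π-systems this is all that independence requires. -/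
lemma indepFun_restr (q : Ioo (0 : ℝ) 1) (ρ : ℝ≥0) {B B' : Set (ℤ → ℤ)} {D D' : Set (ℤ × ℤ)}
    (hB : MeasurableSet B) (hB' : MeasurableSet B') (hBB : Disjoint B B') (hDD : Disjoint D D') :
    IndepFun (Cfg.restr B D) (Cfg.restr B' D') (cfgLaw q ρ) := by
  have hgen : ∀ {B : Set (ℤ → ℤ)} {D : Set (ℤ × ℤ)},
      MeasurableSpace.comap (Cfg.restr B D) inferInstance =
        MeasurableSpace.generateFrom (preimage (Cfg.restr B D) '' basicEvents) :=
    MeasurableSpace.comap_generateFrom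
  have hpi : ∀ {B : Set (ℤ → ℤ)} {D : Set (ℤ × ℤ)},
      IsPiSystem (preimage (Cfg.restr B D) '' basicEvents) := by
    rintro B D _ ⟨E, hE, rfl⟩ _ ⟨E', hE', rfl⟩ ⟨c, hc⟩
    exact ⟨E ∩ E', isPiSystem_basicEvents _ hE _ hE' ⟨_, hc⟩, rfl⟩
  have hms : ∀ {B : Set (ℤ → ℤ)} {D : Set (ℤ × ℤ)}, MeasurableSet B →
      ∀ s ∈ preimage (Cfg.restr B D) '' basicEvents, MeasurableSet s := by
    rintro B D hB _ ⟨_, ⟨A, E, hA, hE, rfl⟩, rfl⟩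
    exact measurable_restr hB D (measurableSet_basicEvent hA hE)
  rw [IndepFun_iff_Indep, hgen, hgen]
  refine IndepSets.indep' (hms hB) (hms hB') hpi hpi ?_
  rw [IndepSets_iff]
  rintro _ _ ⟨_, ⟨A, E, hA, hE, rfl⟩, rfl⟩ ⟨_, ⟨A', E', hA', hE', rfl⟩, rfl⟩
  have hE1 := measurable_indicator_marks D hE
  have hE2 := measurable_indicator_marks D' hE'
  simp only [restr_preimage, basicEvent_inter]
  rw [cfgLaw_basicEvent q ρ ((hB.inter hA).union (hB'.inter hA')) (hE1.inter hE2),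
    cfgLaw_basicEvent q ρ (hB.inter hA) hE1, cfgLaw_basicEvent q ρ (hB'.inter hA') hE2,
    measure_union (hBB.mono inter_subset_left inter_subset_left) (hB'.inter hA'), voidExp_add,
    (indepFun_indicator hDD).measure_inter_preimage_eq_mul _ _ hE hE']
  ring

/-! ### Shifts -/

/-- The trajectory `w` seen from the space-time point `a`. -/
def translate (a : ℤ × ℤ) (w : ℤ → ℤ) : ℤ → ℤ := fun n => w (n + a.2) - a.1

/-- The configuration seen from the space-time point `a`. -/
def Cfg.shift (a : ℤ × ℤ) (c : Cfg) : Cfg :=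
  ⟨translate (-a) ⁻¹' c.paths, fun z => c.mark (z + a)⟩

lemma translate_translate (a b : ℤ × ℤ) (w : ℤ → ℤ) :
    translate a (translate b w) = translate (a + b) w := by
  funext n
  simp only [translate, Prod.fst_add, Prod.snd_add, add_assoc]
  ring

lemma translate_zero (w : ℤ → ℤ) : translate 0 w = w := by
  funext n; simp [translate]

lemma measurable_translate (a : ℤ × ℤ) : Measurable (translate a) := by
  rw [measurable_pi_iff]
  intro n
  simp only [translate]
  fun_prop

lemma mem_shift_paths {a : ℤ × ℤ} {c : Cfg} {w : ℤ → ℤ} :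
    translate a w ∈ (c.shift a).paths ↔ w ∈ c.paths := by
  simp [Cfg.shift, translate_translate, translate_zero]

lemma shift_preimage (a : ℤ × ℤ) (A : Set (ℤ → ℤ)) (B : Set (ℤ × ℤ → unitInterval)) :
    Cfg.shift a ⁻¹' basicEvent A B =
      basicEvent (translate a ⁻¹' A) ((fun u z => u (z + a)) ⁻¹' B) := by
  ext c
  simp only [Cfg.shift, basicEvent, mem_preimage, mem_ofPred_eq, eq_empty_iff_forall_notMem,
    mem_inter_iff, not_and]
  refine and_congr_left fun _ => ⟨fun h w hw => h _ ?_, fun h w hw hA => h _ hw ?_⟩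
  · simpa [translate_translate, translate_zero] using hw
  · simpa [translate_translate, translate_zero] using hA

lemma measurable_shift (a : ℤ × ℤ) : Measurable (Cfg.shift a) := by
  refine measurable_cfg fun A E hA hE => ?_
  rw [shift_preimage]
  refine measurableSet_basicEvent (measurable_translate a hA) ?_
  exact (measurable_pi_lambda _ fun z => measurable_pi_apply _) hE

lemma twoSidedPath_sub (z x : ℤ) (e : ℤ → ℤ) (n : ℤ) :
    twoSidedPath z e n - x = twoSidedPath (z - x) e n := by
  rcases n with n | n <;> simp only [twoSidedPath] <;> ring

lemma tsum_pathLaw_translate_space (q : Ioo (0 : ℝ) 1) (x : ℤ) {A : Set (ℤ → ℤ)}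
    (hA : MeasurableSet A) :
    ∑' z, pathLaw q z (translate (x, 0) ⁻¹' A) = ∑' z, pathLaw q z A := by
  rw [← (Equiv.subRight x).tsum_eq (fun z => pathLaw q z A)]
  refine tsum_congr fun z => ?_
  rw [pathLaw, pathLaw, Measure.map_apply (measurable_twoSidedPath _) (measurable_translate _ hA),
    Measure.map_apply (measurable_twoSidedPath _) hA]
  congr 1
  ext e
  simp only [mem_preimage, Equiv.subRight_apply]
  have : translate (x, 0) (twoSidedPath z e) = twoSidedPath (z - x) e := by
    funext n
    simp [translate, twoSidedPath_sub]
  rw [this]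

/-- The steps of the trajectory seen one time unit later. -/
def stepShift (e : ℤ → ℤ) : ℤ → ℤ := fun k => if k = -1 then - e 0 else e (k + 1)

lemma stepLaw_map_neg (q : Ioo (0 : ℝ) 1) : (stepLaw q).map Neg.neg = stepLaw q := by
  have h : Measurable (Neg.neg : ℤ → ℤ) := measurable_neg
  rw [stepLaw, Measure.map_add _ _ h, Measure.map_add _ _ h, Measure.map_smul, Measure.map_smul,
    Measure.map_smul, Measure.map_dirac' h, Measure.map_dirac' h, Measure.map_dirac' h]
  simp only [neg_neg, neg_zero]
  abel

/-- A relabelling of i.i.d. steps followed by a change of sign of one of them; the symmetry of the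
step law is what makes it preserve the law. -/
lemma measurePreserving_stepShift (q : Ioo (0 : ℝ) 1) :
    MeasurePreserving stepShift (Measure.infinitePi fun _ : ℤ => stepLaw q)
      (Measure.infinitePi fun _ : ℤ => stepLaw q) := by
  have hm : Measurable stepShift := by
    rw [measurable_pi_iff]
    intro k
    unfold stepShift
    by_cases hk : k = -1 <;> simp only [hk, if_true, if_false] <;> fun_prop
  refine ⟨hm, ?_⟩
  have h1 := Measure.map_infinitePi_infinitePi_of_inj (P := fun _ : ℤ => stepLaw q)
    (f := fun k : ℤ => k + 1) (add_left_injective 1)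
  have hf : ∀ k : ℤ, Measurable (if k = -1 then (Neg.neg : ℤ → ℤ) else id) := fun k => by
    fun_prop
  have h2 := Measure.infinitePi_map_pi (fun _ : ℤ => stepLaw q) hf
  have h3 : stepShift = (fun (x : ℤ → ℤ) k => (if k = -1 then (Neg.neg : ℤ → ℤ) else id) (x k)) ∘
      (fun (e : ℤ → ℤ) k => e (k + 1)) := by
    funext e k
    by_cases hk : k = -1 <;> simp [stepShift, hk]
  have hF : Measurable
      (fun (x : ℤ → ℤ) k => (if k = -1 then (Neg.neg : ℤ → ℤ) else id) (x k)) :=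
    measurable_pi_lambda _ fun k => (hf k).comp (measurable_pi_apply k)
  have hG : Measurable (fun (e : ℤ → ℤ) (k : ℤ) => e (k + 1)) :=
    measurable_pi_lambda _ fun k => measurable_pi_apply _
  rw [h3, ← Measure.map_map hF hG, h1, h2]
  congr 1
  funext k
  by_cases hk : k = -1 <;> simp [hk, stepLaw_map_neg]

lemma translate_time_twoSidedPath (z : ℤ) (e : ℤ → ℤ) :
    translate (0, 1) (twoSidedPath z e) =
      twoSidedPath (z - stepShift e (-1)) (stepShift e) := by
  funext n
  rcases n with n | n
  · have h1 : (Int.ofNat n + 1 : ℤ) = Int.ofNat (n + 1) := rfl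
    simp only [translate, h1, twoSidedPath, Finset.sum_range_succ', stepShift]
    have h2 : ∀ k : ℕ, (k : ℤ) ≠ -1 := fun k => by omega
    simp [h2]
    ring
  · rcases n with _ | n
    · have h1 : (Int.negSucc 0 + 1 : ℤ) = Int.ofNat 0 := rfl
      simp only [translate, h1, twoSidedPath]
      simp
    · have h1 : (Int.negSucc (n + 1) + 1 : ℤ) = Int.negSucc n := rfl
      simp only [translate, h1, twoSidedPath]
      rw [Finset.sum_range_succ' _ (n + 1)]
      have h2 : ∀ k : ℕ, stepShift e (-(((k + 1 : ℕ) : ℤ) + 1)) = e (-((k : ℤ) + 1)) := by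
        intro k
        unfold stepShift
        rw [if_neg (by push_cast; omega)]
        congr 1
      simp only [h2]
      simp

/-- Counting measure is stationary for the walk: moving the time origin displaces the starting point
by a step, and for fixed steps the sum over all starting points absorbs this displacement. -/
lemma tsum_pathLaw_translate_time (q : Ioo (0 : ℝ) 1) {A : Set (ℤ → ℤ)}
    (hA : MeasurableSet A) :
    ∑' z, pathLaw q z (translate (0, 1) ⁻¹' A) = ∑' z, pathLaw q z A := by
  have hm : ∀ z : ℤ, Measurable fun e : ℤ → ℤ => twoSidedPath (z - e (-1)) e := by
    intro z
    have : (fun e : ℤ → ℤ => twoSidedPath (z - e (-1)) e) =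
        fun e n => twoSidedPath z e n - e (-1) := by
      funext e n
      rw [twoSidedPath_sub]
    rw [this, measurable_pi_iff]
    intro n
    exact ((measurable_pi_apply n).comp (measurable_twoSidedPath z)).sub (measurable_pi_apply _)
  have h1 : ∀ z, pathLaw q z (translate (0, 1) ⁻¹' A) =
      ∫⁻ e, A.indicator 1 (twoSidedPath (z - e (-1)) e)
        ∂(Measure.infinitePi fun _ : ℤ => stepLaw q) := by
    intro z
    rw [pathLaw, Measure.map_apply (measurable_twoSidedPath _) (measurable_translate _ hA),
      ← preimage_comp]
    have : (translate (0, 1) ∘ twoSidedPath z) =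
        (fun e : ℤ → ℤ => twoSidedPath (z - e (-1)) e) ∘ stepShift := by
      funext e
      exact translate_time_twoSidedPath z e
    rw [this, preimage_comp, (measurePreserving_stepShift q).measure_preimage
      (hm z hA).nullMeasurableSet, ← lintegral_indicator_one (hm z hA)]
    rfl
  have h2 : ∀ z, pathLaw q z A =
      ∫⁻ e, A.indicator 1 (twoSidedPath z e) ∂(Measure.infinitePi fun _ : ℤ => stepLaw q) := by
    intro z
    rw [pathLaw, Measure.map_apply (measurable_twoSidedPath _) hA,
      ← lintegral_indicator_one (measurable_twoSidedPath _ hA)]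
    rfl
  have hi : Measurable (A.indicator (1 : (ℤ → ℤ) → ℝ≥0∞)) := measurable_one.indicator hA
  simp_rw [h1, h2]
  have h3 : ∀ z : ℤ, Measurable fun e : ℤ → ℤ =>
      A.indicator (1 : (ℤ → ℤ) → ℝ≥0∞) (twoSidedPath (z - e (-1)) e) := fun z => hi.comp (hm z)
  have h4 : ∀ z : ℤ, Measurable fun e : ℤ → ℤ =>
      A.indicator (1 : (ℤ → ℤ) → ℝ≥0∞) (twoSidedPath z e) :=
    fun z => hi.comp (measurable_twoSidedPath z)
  rw [← lintegral_tsum (fun z => (h3 z).aemeasurable),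
    ← lintegral_tsum (fun z => (h4 z).aemeasurable)]
  refine lintegral_congr fun e => ?_
  exact (Equiv.subRight (e (-1))).tsum_eq (fun z => A.indicator 1 (twoSidedPath z e))

lemma measurePreserving_translate_space (q : Ioo (0 : ℝ) 1) (ρ : ℝ≥0) (x : ℤ) :
    MeasurePreserving (translate (x, 0)) (intensity q ρ) (intensity q ρ) := by
  refine ⟨measurable_translate _, ?_⟩
  ext A hA
  rw [Measure.map_apply (measurable_translate _) hA, intensity, Measure.smul_apply,
    Measure.smul_apply, Measure.sum_apply _ hA, Measure.sum_apply _ (measurable_translate _ hA),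
    tsum_pathLaw_translate_space q x hA]

lemma measurePreserving_translate_time (q : Ioo (0 : ℝ) 1) (ρ : ℝ≥0) :
    MeasurePreserving (translate (0, 1)) (intensity q ρ) (intensity q ρ) := by
  refine ⟨measurable_translate _, ?_⟩
  ext A hA
  rw [Measure.map_apply (measurable_translate _) hA, intensity, Measure.smul_apply,
    Measure.smul_apply, Measure.sum_apply _ hA, Measure.sum_apply _ (measurable_translate _ hA),
    tsum_pathLaw_translate_time q hA]

lemma measurePreserving_translate_neg {q : Ioo (0 : ℝ) 1} {ρ : ℝ≥0} {a : ℤ × ℤ}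
    (h : MeasurePreserving (translate a) (intensity q ρ) (intensity q ρ)) :
    MeasurePreserving (translate (-a)) (intensity q ρ) (intensity q ρ) := by
  refine ⟨measurable_translate _, ?_⟩
  conv_lhs => rw [← h.map_eq]
  rw [Measure.map_map (measurable_translate _) (measurable_translate _)]
  have : translate (-a) ∘ translate a = id := by
    funext w
    simp [translate_translate, translate_zero]
  rw [this, Measure.map_id]

lemma measurePreserving_translate_add {q : Ioo (0 : ℝ) 1} {ρ : ℝ≥0} {a b : ℤ × ℤ}
    (h : MeasurePreserving (translate a) (intensity q ρ) (intensity q ρ))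
    (h' : MeasurePreserving (translate b) (intensity q ρ) (intensity q ρ)) :
    MeasurePreserving (translate (a + b)) (intensity q ρ) (intensity q ρ) := by
  have : translate (a + b) = translate a ∘ translate b := by
    funext w
    simp [translate_translate]
  rw [this]
  exact h.comp h'

lemma measurePreserving_translate (q : Ioo (0 : ℝ) 1) (ρ : ℝ≥0) (a : ℤ × ℤ) :
    MeasurePreserving (translate a) (intensity q ρ) (intensity q ρ) := by
  have ht : ∀ n : ℤ, MeasurePreserving (translate (0, n)) (intensity q ρ) (intensity q ρ) := by
    intro n
    induction n using Int.induction_on with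
    | zero => exact measurePreserving_translate_space q ρ 0
    | succ n ih =>
      have := measurePreserving_translate_add ih (measurePreserving_translate_time q ρ)
      simpa using this
    | pred n ih =>
      have := measurePreserving_translate_add ih
        (measurePreserving_translate_neg (measurePreserving_translate_time q ρ))
      simpa [sub_eq_add_neg] using this
  have := measurePreserving_translate_add (measurePreserving_translate_space q ρ a.1) (ht a.2)
  simpa using this

lemma measurePreserving_shift (q : Ioo (0 : ℝ) 1) (ρ : ℝ≥0) (a : ℤ × ℤ) :
    MeasurePreserving (Cfg.shift a) (cfgLaw q ρ) (cfgLaw q ρ) := by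
  refine ⟨measurable_shift a, ?_⟩
  have := Measure.isProbabilityMeasure_map (μ := cfgLaw q ρ) (measurable_shift a).aemeasurable
  refine ext_of_generate_finite _ rfl isPiSystem_basicEvents ?_ (by simp)
  rintro _ ⟨A, B, hA, hB, rfl⟩
  have hu : Measurable fun (u : ℤ × ℤ → unitInterval) z => u (z + a) :=
    measurable_pi_lambda _ fun z => measurable_pi_apply _
  rw [Measure.map_apply (measurable_shift a) (measurableSet_basicEvent hA hB), shift_preimage,
    cfgLaw_basicEvent q ρ (measurable_translate a hA) (hu hB), cfgLaw_basicEvent q ρ hA hB,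
    (measurePreserving_translate q ρ a).measure_preimage hA.nullMeasurableSet]
  congr 1
  rw [← Measure.map_apply hu hB, markLaw, Measure.map_infinitePi_infinitePi_of_inj
    (P := fun _ : ℤ × ℤ => (volume : Measure unitInterval)) (f := fun z : ℤ × ℤ => z + a)
    (add_left_injective a)]

end RWDRE

namespace RWDRE

/-! ### The walk in a configuration -/

/-- The jump probabilities and the angle of the cones. -/
structure Params where
  pVac : ℝ
  pOcc : ℝ
  v : ℝ

variable (P : Params)

/-- The occupied space-time points. -/
def Cfg.occ (c : Cfg) : Set (ℤ × ℤ) := {y | ∃ w ∈ c.paths, w y.2 = y.1}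

open Classical in
/-- The point visited after `z`. -/
noncomputable def Cfg.next (c : Cfg) (z : ℤ × ℤ) : ℤ × ℤ :=
  if (z ∈ c.occ ∧ (c.mark z : ℝ) ≤ P.pOcc) ∨ (z ∉ c.occ ∧ (c.mark z : ℝ) ≤ P.pVac) then
    z + (1, 1)
  else
    z + (-1, 1)

/-- The space-time walk started at `y`. -/
noncomputable def Cfg.walk (c : Cfg) (y : ℤ × ℤ) (n : ℕ) : ℤ × ℤ := (c.next P)^[n] y

variable {P}

lemma walk_zero (c : Cfg) (y : ℤ × ℤ) : c.walk P y 0 = y := rfl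

lemma walk_succ (c : Cfg) (y : ℤ × ℤ) (n : ℕ) :
    c.walk P y (n + 1) = c.next P (c.walk P y n) := Function.iterate_succ_apply' _ _ _

lemma walk_add (c : Cfg) (y : ℤ × ℤ) (m n : ℕ) :
    c.walk P y (m + n) = c.walk P (c.walk P y m) n := by
  rw [Cfg.walk, Cfg.walk, Cfg.walk, add_comm, Function.iterate_add_apply]

lemma trace_eq_occ (s : Sample) : trace s = (toCfg s).occ := by
  ext y
  simp only [trace, Cfg.occ, toCfg, mem_ofPred_eq]
  constructor
  · rintro ⟨z, i, hi, h⟩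
    exact ⟨_, ⟨z, i, hi, rfl⟩, h⟩
  · rintro ⟨_, ⟨z, i, hi, rfl⟩, h⟩
    exact ⟨z, i, hi, h⟩

lemma walkY_eq (s : Sample) (y : ℤ × ℤ) (n : ℕ) :
    walkY P.pVac P.pOcc s y n = (toCfg s).walk P y n := by
  induction n with
  | zero => rfl
  | succ n ih =>
    have h : ∀ m, walkY P.pVac P.pOcc s y (m + 1) =
        (toCfg s).next P (walkY P.pVac P.pOcc s y m) := by
      intro m
      rw [Cfg.next, ← trace_eq_occ]
      rfl
    rw [walk_succ, ← ih, h]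

lemma next_eq_or (c : Cfg) (z : ℤ × ℤ) :
    c.next P z = z + (1, 1) ∨ c.next P z = z + (-1, 1) := by
  unfold Cfg.next
  split_ifs <;> simp

lemma next_snd (c : Cfg) (z : ℤ × ℤ) : (c.next P z).2 = z.2 + 1 := by
  rcases next_eq_or (P := P) c z with h | h <;> simp [h]

lemma next_fst_le (c : Cfg) (z : ℤ × ℤ) : (c.next P z).1 ≤ z.1 + 1 := by
  rcases next_eq_or (P := P) c z with h | h <;> simp [h]

lemma walk_snd (c : Cfg) (y : ℤ × ℤ) (n : ℕ) : (c.walk P y n).2 = y.2 + n := by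
  induction n with
  | zero => simp [walk_zero]
  | succ n ih => rw [walk_succ, next_snd, ih]; push_cast; ring

lemma walk_congr {c c' : Cfg} {y : ℤ × ℤ} {n : ℕ}
    (h : ∀ m < n, c.next P (c.walk P y m) = c'.next P (c.walk P y m)) :
    ∀ m ≤ n, c.walk P y m = c'.walk P y m := by
  intro m
  induction m with
  | zero => intro _; rfl
  | succ m ih =>
    intro hm
    rw [walk_succ, walk_succ, ← ih (by omega), h m (by omega)]

lemma occ_shift {a z : ℤ × ℤ} {c : Cfg} : z ∈ (c.shift a).occ ↔ z + a ∈ c.occ := by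
  simp only [Cfg.occ, mem_ofPred_eq]
  constructor
  · rintro ⟨w, hw, h⟩
    refine ⟨translate (-a) w, hw, ?_⟩
    simp [translate, h]
  · rintro ⟨w, hw, h⟩
    refine ⟨translate a w, mem_shift_paths.2 hw, ?_⟩
    simp only [Prod.snd_add, Prod.fst_add] at h
    simp [translate, h]

lemma next_shift (a z : ℤ × ℤ) (c : Cfg) : (c.shift a).next P z + a = c.next P (z + a) := by
  have hm : (c.shift a).mark z = c.mark (z + a) := rfl
  classical
  simp only [Cfg.next, occ_shift, hm]
  split_ifs <;> abel

lemma walk_shift (a y : ℤ × ℤ) (c : Cfg) (n : ℕ) :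
    (c.shift a).walk P y n + a = c.walk P (y + a) n := by
  induction n with
  | zero => rfl
  | succ n ih => rw [walk_succ, walk_succ, next_shift, ih]

/-- A step from `z` reads only the mark at `z` and the trajectories through `z`. All locality
statements about the walk rest on this. -/
lemma next_restr {B : Set (ℤ → ℤ)} {D : Set (ℤ × ℤ)} {c : Cfg} {z : ℤ × ℤ} (hz : z ∈ D)
    (h : ∀ w ∈ c.paths, w z.2 = z.1 → w ∈ B) : (c.restr B D).next P z = c.next P z := by
  have h1 : z ∈ (c.restr B D).occ ↔ z ∈ c.occ := by
    simp only [Cfg.occ, Cfg.restr, mem_ofPred_eq, mem_inter_iff]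
    exact ⟨fun ⟨w, hw, h'⟩ => ⟨w, hw.1, h'⟩, fun ⟨w, hw, h'⟩ => ⟨w, ⟨hw, h w hw h'⟩, h'⟩⟩
  have h2 : (c.restr B D).mark z = c.mark z := by simp [Cfg.restr, hz]
  classical
  simp only [Cfg.next, h1, h2]

lemma restr_restr (B B' : Set (ℤ → ℤ)) (D D' : Set (ℤ × ℤ)) (c : Cfg) :
    (c.restr B D).restr B' D' = c.restr (B ∩ B') (D' ∩ D) := by
  simp [Cfg.restr, inter_assoc, indicator_indicator]

lemma measurableSet_occ (z : ℤ × ℤ) : MeasurableSet {c : Cfg | z ∈ c.occ} := by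
  have : {c : Cfg | z ∈ c.occ} = {c : Cfg | c.paths ∩ {w | w z.2 = z.1} = ∅}ᶜ := by
    ext c
    simp only [Cfg.occ, mem_ofPred_eq, mem_compl_iff, ← ne_eq, ← nonempty_iff_ne_empty]
    rfl
  rw [this]
  exact (measurableSet_void (measurable_pi_apply z.2 (measurableSet_singleton z.1))).compl

lemma measurable_next (z : ℤ × ℤ) : Measurable fun c : Cfg => c.next P z := by
  have hm : Measurable fun c : Cfg => (c.mark z : ℝ) :=
    measurable_subtype_coe.comp ((measurable_pi_apply z).comp measurable_mark)
  unfold Cfg.next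
  refine Measurable.ite ?_ measurable_const measurable_const
  exact ((measurableSet_occ z).inter (measurableSet_le hm measurable_const)).union
    ((measurableSet_occ z).compl.inter (measurableSet_le hm measurable_const))

lemma measurable_walk (y : ℤ × ℤ) (n : ℕ) : Measurable fun c : Cfg => c.walk P y n := by
  induction n with
  | zero => exact measurable_const
  | succ n ih =>
    simp only [walk_succ]
    have : Measurable fun p : Cfg × (ℤ × ℤ) => p.1.next P p.2 :=
      measurable_from_prod_countable_left fun z => measurable_next z
    exact this.comp (measurable_id.prodMk ih)

/-! ### Geometry of the cones -/

/-- The trajectories whose trace meets `S`. -/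
def hits (S : Set (ℤ × ℤ)) : Set (ℤ → ℤ) := {w | ∃ n : ℤ, (w n, n) ∈ S}

lemma hits_mono {S S' : Set (ℤ × ℤ)} (h : S ⊆ S') : hits S ⊆ hits S' :=
  fun _ ⟨n, hn⟩ => ⟨n, h hn⟩

lemma measurableSet_hits (S : Set (ℤ × ℤ)) : MeasurableSet (hits S) := by
  have : hits S = ⋃ n : ℤ, (fun w : ℤ → ℤ => (w n, n)) ⁻¹' S := by
    ext w; simp [hits]
  rw [this]
  refine .iUnion fun n => ?_
  exact (by fun_prop : Measurable fun w : ℤ → ℤ => (w n, n)) (.of_discrete)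

lemma crossing_eq (v : ℝ) (y : ℤ × ℤ) : crossing v y = hits (cone v y) ∩ hits (backCone v y) :=
  rfl

lemma measurableSet_crossing (v : ℝ) (y : ℤ × ℤ) : MeasurableSet (crossing v y) :=
  (measurableSet_hits _).inter (measurableSet_hits _)

lemma mem_hits_of_eq {S : Set (ℤ × ℤ)} {z : ℤ × ℤ} (hz : z ∈ S) {w : ℤ → ℤ}
    (h : w z.2 = z.1) : w ∈ hits S :=
  ⟨z.2, by rwa [h]⟩

lemma self_mem_cone (v : ℝ) (y : ℤ × ℤ) : y ∈ cone v y := by simp [cone]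

lemma cone_subset {v : ℝ} {x y : ℤ × ℤ} (h : y ∈ cone v x) : cone v y ⊆ cone v x := by
  rintro z ⟨h1, h2, h3⟩
  obtain ⟨g1, g2, g3⟩ := h
  refine ⟨g1.trans h1, g2.trans h2, ?_⟩
  push_cast at *
  linarith

lemma backCone_subset {v : ℝ} {x y : ℤ × ℤ} (h : y ∈ cone v x) :
    backCone v x ⊆ backCone v y := by
  rintro z ⟨h1, h2, h3⟩
  obtain ⟨g1, g2, g3⟩ := h
  refine ⟨h1.trans g1, h2.trans g2, ?_⟩
  push_cast at *
  linarith

lemma disjoint_cone_backCone (v : ℝ) (y : ℤ × ℤ) : Disjoint (cone v y) (backCone v y) := by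
  rw [Set.disjoint_left]
  rintro z ⟨h1, h2, h3⟩ ⟨g1, g2, g3⟩
  linarith

lemma mem_cone_add {v : ℝ} {y z a : ℤ × ℤ} : z + a ∈ cone v (y + a) ↔ z ∈ cone v y := by
  simp [cone]

lemma mem_backCone_add {v : ℝ} {y z a : ℤ × ℤ} :
    z + a ∈ backCone v (y + a) ↔ z ∈ backCone v y := by
  simp [backCone]

lemma translate_mem_hits_cone {v : ℝ} {y a : ℤ × ℤ} {w : ℤ → ℤ} :
    translate a w ∈ hits (cone v y) ↔ w ∈ hits (cone v (y + a)) := by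
  have : ∀ n : ℤ, (translate a w n, n) ∈ cone v y ↔ (w (n + a.2), n + a.2) ∈ cone v (y + a) := by
    intro n
    rw [← mem_cone_add (a := a)]
    simp [translate, Prod.add_def]
  simp only [hits, mem_ofPred_eq, this]
  exact ⟨fun ⟨n, hn⟩ => ⟨_, hn⟩, fun ⟨n, hn⟩ => ⟨n - a.2, by simpa using hn⟩⟩

lemma translate_mem_hits_backCone {v : ℝ} {y a : ℤ × ℤ} {w : ℤ → ℤ} :
    translate a w ∈ hits (backCone v y) ↔ w ∈ hits (backCone v (y + a)) := by
  have : ∀ n : ℤ,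
      (translate a w n, n) ∈ backCone v y ↔ (w (n + a.2), n + a.2) ∈ backCone v (y + a) := by
    intro n
    rw [← mem_backCone_add (a := a)]
    simp [translate, Prod.add_def]
  simp only [hits, mem_ofPred_eq, this]
  exact ⟨fun ⟨n, hn⟩ => ⟨_, hn⟩, fun ⟨n, hn⟩ => ⟨n - a.2, by simpa using hn⟩⟩

/-- The distance, along the space axis, from the line of slope `v` through the origin. -/
def lev (v : ℝ) (z : ℤ × ℤ) : ℝ := z.1 - v * z.2

/-! ### Regeneration events in a configuration -/

variable (P) in
/-- The regeneration event at `y`. -/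
def Cfg.Reg (c : Cfg) (y : ℤ × ℤ) : Prop :=
  c.paths ∩ crossing P.v y = ∅ ∧ ∀ n, c.walk P y n ∈ cone P.v y

variable (P) in
/-- The record at level `k` is reached at time `n`. -/
def Cfg.Rec (c : Cfg) (k n : ℕ) : Prop :=
  (1 - P.v) * k ≤ lev P.v (c.walk P 0 n) ∧ ∀ m < n, lev P.v (c.walk P 0 m) < (1 - P.v) * k

variable (P) in
/-- The time `n` is a record time at which the regeneration event occurs. -/
def Cfg.RegAt (c : Cfg) (n : ℕ) : Prop :=
  (∃ k, 1 ≤ k ∧ c.Rec P k n) ∧ c.Reg P (c.walk P 0 n)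

variable (P) in
/-- The regeneration time, equal to `0` if there is none. -/
noncomputable def Cfg.tau (c : Cfg) : ℕ := sInf {n | c.RegAt P n}

lemma omega_apply_eq_zero (s : Sample) {A : Set (ℤ → ℤ)} (hA : MeasurableSet A) :
    omega s A = 0 ↔ (toCfg s).paths ∩ A = ∅ := by
  rw [omega, Measure.sum_apply _ hA, ENNReal.tsum_eq_zero]
  simp only [Measure.coe_finsetSum, Finset.sum_apply, Finset.sum_eq_zero_iff, Finset.mem_range,
    Measure.dirac_apply' _ hA, indicator_apply_eq_zero, Pi.one_apply, one_ne_zero, imp_false]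
  simp only [eq_empty_iff_forall_notMem, toCfg, mem_inter_iff, mem_ofPred_eq, not_and]
  constructor
  · rintro h _ ⟨z, i, hi, rfl⟩
    exact h z i hi
  · exact fun h z i hi => h _ ⟨z, i, hi, rfl⟩

lemma mem_regEvent (s : Sample) (y : ℤ × ℤ) :
    s ∈ regEvent P.pVac P.pOcc P.v y ↔ (toCfg s).Reg P y := by
  simp only [regEvent, staysInCone, mem_inter_iff, mem_ofPred_eq, Cfg.Reg, walkY_eq,
    omega_apply_eq_zero s (measurableSet_crossing _ _)]

lemma sInf_coe_eq {S : Set ℕ} {n : ℕ} :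
    sInf ((fun n : ℕ => (n : ℕ∞)) '' S) = n ↔ n ∈ S ∧ ∀ m < n, m ∉ S := by
  constructor
  · intro h
    have hne : S.Nonempty := by
      by_contra hS
      rw [not_nonempty_iff_eq_empty] at hS
      simp [hS] at h
    obtain ⟨m, hm, hmn⟩ := csInf_mem (hne.image (fun n : ℕ => (n : ℕ∞)))
    rw [h] at hmn
    have hmn : m = n := Nat.cast_injective (R := ℕ∞) hmn
    subst hmn
    refine ⟨hm, fun j hj hjS => ?_⟩
    have := sInf_le (mem_image_of_mem (fun n : ℕ => (n : ℕ∞)) hjS)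
    rw [h] at this
    exact absurd (by exact_mod_cast this : m ≤ j) (by omega)
  · rintro ⟨hn, h⟩
    refine le_antisymm (sInf_le (mem_image_of_mem _ hn)) (le_sInf ?_)
    rintro _ ⟨m, hm, rfl⟩
    have : n ≤ m := by
      by_contra hlt
      exact h m (by omega) hm
    exact Nat.cast_le.2 this

lemma recordTime_eq (s : Sample) (k n : ℕ) :
    recordTime P.pVac P.pOcc P.v k s = n ↔ (toCfg s).Rec P k n := by
  have h : ∀ m : ℕ, (1 - P.v) * k + P.v * m ≤ (walkX P.pVac P.pOcc s m : ℝ) ↔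
      (1 - P.v) * k ≤ lev P.v ((toCfg s).walk P 0 m) := by
    intro m
    rw [lev, walk_snd, walkX, walkY_eq]
    simp only [Prod.snd_zero, zero_add, Int.cast_natCast]
    constructor <;> intro h <;> linarith
  rw [recordTime, sInf_coe_eq]
  simp only [mem_ofPred_eq, h, not_le, Cfg.Rec]

lemma mem_regIndices (s : Sample) (k : ℕ) :
    k ∈ regIndices P.pVac P.pOcc P.v s ↔
      1 ≤ k ∧ ∃ n, (toCfg s).Rec P k n ∧ (toCfg s).Reg P ((toCfg s).walk P 0 n) := by
  simp only [regIndices, mem_ofPred_eq, recordTime_eq, mem_regEvent, walkY_eq]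

lemma rec_le_of_le {c : Cfg} (hv : P.v < 1) {j k m n : ℕ} (h : c.Rec P j m) (h' : c.Rec P k n)
    (hjk : j ≤ k) : m ≤ n := by
  by_contra hlt
  have h1 := h.2 n (by omega)
  have h2 := h'.1
  have h3 : (1 - P.v) * j ≤ (1 - P.v) * k :=
    mul_le_mul_of_nonneg_left (by exact_mod_cast hjk) (by linarith)
  linarith

-- Record times are monotone in the index, so the least regeneration index gives the least
-- regeneration time.
open Classical in
lemma regTime_eq (hv : P.v < 1) (s : Sample) :
    regTime P.pVac P.pOcc P.v s =
      if ∃ n, (toCfg s).RegAt P n then (((toCfg s).tau P : ℕ) : ℕ∞) else ⊤ := by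
  have hiff : (regIndices P.pVac P.pOcc P.v s).Nonempty ↔ ∃ n, (toCfg s).RegAt P n := by
    constructor
    · rintro ⟨k, hk⟩
      obtain ⟨hk1, n, hn, hr⟩ := (mem_regIndices s k).1 hk
      exact ⟨n, ⟨k, hk1, hn⟩, hr⟩
    · rintro ⟨n, ⟨k, hk1, hn⟩, hr⟩
      exact ⟨k, (mem_regIndices s k).2 ⟨hk1, n, hn, hr⟩⟩
  rw [regTime]
  by_cases h : (regIndices P.pVac P.pOcc P.v s).Nonempty
  · rw [if_pos h, if_pos (hiff.1 h)]
    obtain ⟨hk1, n, hn, hr⟩ := (mem_regIndices s _).1 (Nat.sInf_mem h)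
    rw [(recordTime_eq s _ n).2 hn]
    congr 1
    refine le_antisymm (le_csInf (hiff.1 h) ?_) (Nat.sInf_le ⟨⟨_, hk1, hn⟩, hr⟩) |>.symm ▸ rfl
    rintro m ⟨⟨k, hk, hm⟩, hrm⟩
    exact rec_le_of_le hv hn hm (Nat.sInf_le ((mem_regIndices s k).2 ⟨hk, m, hm, hrm⟩))
  · rw [if_neg h, if_neg (fun h' => h (hiff.2 h'))]

lemma regTime_toNat (hv : P.v < 1) (s : Sample) :
    (regTime P.pVac P.pOcc P.v s).toNat = (toCfg s).tau P := by
  classical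
  rw [regTime_eq hv]
  split_ifs with h
  · simp
  · have : {n | (toCfg s).RegAt P n} = ∅ := by
      simpa [eq_empty_iff_forall_notMem] using h
    simp [Cfg.tau, this]

lemma measurableSet_reg (y : ℤ × ℤ) : MeasurableSet {c : Cfg | c.Reg P y} := by
  simp only [Cfg.Reg, ofPred_and, ofPred_forall]
  exact (measurableSet_void (measurableSet_crossing _ _)).inter
    (.iInter fun n => measurable_walk y n .of_discrete)

/-- Events that depend on the walk up to a fixed point. -/
lemma measurableSet_of_walk {p : Cfg → ℤ × ℤ → Prop} (hp : ∀ z, MeasurableSet {c | p c z})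
    (y : ℤ × ℤ) (n : ℕ) : MeasurableSet {c : Cfg | p c (c.walk P y n)} := by
  have : {c : Cfg | p c (c.walk P y n)} = ⋃ z, {c | c.walk P y n = z} ∩ {c | p c z} := by
    ext c; simp
  rw [this]
  exact .iUnion fun z => (measurable_walk y n (measurableSet_singleton z)).inter (hp z)

lemma measurableSet_rec (k n : ℕ) : MeasurableSet {c : Cfg | c.Rec P k n} := by
  simp only [Cfg.Rec, ofPred_and, ofPred_forall]
  refine .inter ?_ (.iInter fun m => .iInter fun _ => ?_)
  · exact measurable_walk (P := P) 0 n (.of_discrete (s := {z | (1 - P.v) * k ≤ lev P.v z}))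
  · exact measurable_walk (P := P) 0 m (.of_discrete (s := {z | lev P.v z < (1 - P.v) * k}))

lemma measurableSet_regAt (n : ℕ) : MeasurableSet {c : Cfg | c.RegAt P n} := by
  simp only [Cfg.RegAt, ofPred_and, ofPred_exists]
  refine .inter (.iUnion fun k => ?_) ?_
  · exact (MeasurableSet.const _).inter (measurableSet_rec k n)
  · exact measurableSet_of_walk (p := fun c z => c.Reg P z) measurableSet_reg 0 n

lemma measurable_tau : Measurable fun c : Cfg => c.tau P := by
  classical
  refine measurable_to_countable' fun n => ?_
  have : (fun c : Cfg => c.tau P) ⁻¹' {n} =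
      ({c : Cfg | c.RegAt P n} ∩ ⋂ m ∈ Finset.range n, {c : Cfg | c.RegAt P m}ᶜ) ∪
        -- Accounts for the default value `0` in the absence of regeneration.
        ({c : Cfg | n = 0} ∩ ⋂ m, {c : Cfg | c.RegAt P m}ᶜ) := by
    ext c
    simp only [mem_preimage, mem_singleton_iff, mem_union, mem_inter_iff, mem_iInter,
      mem_compl_iff, mem_ofPred_eq, Finset.mem_range]
    by_cases h : ∃ n, c.RegAt P n
    · have h1 : c.RegAt P (c.tau P) := Nat.sInf_mem h
      have h2 : ∀ m, c.RegAt P m → c.tau P ≤ m := fun m hm => Nat.sInf_le hm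
      constructor
      · rintro rfl
        exact Or.inl ⟨h1, fun m hm hr => absurd (h2 m hr) (by omega)⟩
      · rintro (⟨hn, hm⟩ | ⟨-, hm⟩)
        · refine le_antisymm (h2 n hn) ?_
          by_contra hlt
          exact hm _ (by omega) h1
        · exact absurd h1 (hm _)
    · have h0 : {n | c.RegAt P n} = ∅ := by simpa [eq_empty_iff_forall_notMem] using h
      rw [not_exists] at h
      have ht : c.tau P = 0 := by rw [Cfg.tau, h0, Nat.sInf_empty]
      simp [ht, h, eq_comm]
  rw [this]
  refine .union ?_ ?_
  · exact (measurableSet_regAt n).inter (Finset.measurableSet_biInter _ fun m _ =>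
      (measurableSet_regAt m).compl)
  · exact (MeasurableSet.const _).inter (.iInter fun m => (measurableSet_regAt m).compl)

end RWDRE

namespace RWDRE

variable {P : Params}

/-! ### Renewal structure -/

/-- The space-time displacement of a block. -/
def endPt (b : Block) : ℤ × ℤ := (b.2 (Fin.last _), b.1)

variable (P) in
/-- The regeneration time exists and the first block is `b`. -/
def Cfg.First (c : Cfg) (b : Block) : Prop :=
  c.RegAt P b.1 ∧ (∀ m < b.1, ¬ c.RegAt P m) ∧ ∀ i : Fin (b.1 + 1), (c.walk P 0 i).1 = b.2 i

variable (P) in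
/-- The part of the regeneration event at time `m` that concerns the walk up to time `t`. -/
def Cfg.LocReg (c : Cfg) (t m : ℕ) : Prop :=
  c.paths ∩ crossing P.v (c.walk P 0 m) = ∅ ∧
    ∀ i, m ≤ i → i ≤ t → c.walk P 0 i ∈ cone P.v (c.walk P 0 m)

variable (P) in
/-- The event that the first block is `b`, and that the regeneration event occurs at `0` if `r`
holds, as far as the walk before the end of the block is concerned. -/
def Cfg.Past (c : Cfg) (b : Block) (r : Prop) : Prop :=
  (∀ i : Fin (b.1 + 1), (c.walk P 0 i).1 = b.2 i) ∧ (∃ k, 1 ≤ k ∧ c.Rec P k b.1) ∧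
    (∀ m < b.1, ¬ ((∃ k, 1 ≤ k ∧ c.Rec P k m) ∧ c.LocReg P b.1 m)) ∧ (r → c.LocReg P b.1 0)

/-- Before a record the level is strictly lower; as the time is earlier and `0 ≤ v`, the space
coordinate cannot be larger either. -/
lemma rec_mem_backCone (hv : 0 ≤ P.v) {c : Cfg} {k m n : ℕ} (h : c.Rec P k n) (hm : m < n) :
    c.walk P 0 m ∈ backCone P.v (c.walk P 0 n) := by
  have h1 := (h.2 m hm).trans_le h.1
  have hmn : (m : ℝ) ≤ n := by exact_mod_cast hm.le
  simp only [lev, walk_snd, Prod.snd_zero, zero_add, Int.cast_natCast] at h1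
  have h2 : ((c.walk P 0 m).1 : ℝ) - (c.walk P 0 n).1 < P.v * (m - n) := by linarith
  have h3 : P.v * ((m : ℝ) - n) ≤ 0 := mul_nonpos_of_nonneg_of_nonpos hv (by linarith)
  have h4 : ((c.walk P 0 m).1 : ℝ) ≤ (c.walk P 0 n).1 := by linarith
  refine ⟨by exact_mod_cast h4, by simp [walk_snd, hm.le], ?_⟩
  simp only [walk_snd, Prod.snd_zero, zero_add]
  push_cast
  exact h2

lemma walk_of_eq {c : Cfg} {b : Block} (h : ∀ i : Fin (b.1 + 1), (c.walk P 0 i).1 = b.2 i) :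
    c.walk P 0 b.1 = endPt b := by
  refine Prod.ext ?_ ?_
  · exact h (Fin.last _)
  · simp [walk_snd, endPt]

lemma First.reg {c : Cfg} {b : Block} (h : c.First P b) : c.Reg P (endPt b) := by
  rw [← walk_of_eq h.2.2]
  exact h.1.2

/-- After time `t` the walk stays in the cone of its position at `t`, which is contained in the cone
at time `m` once that position is. Hence regeneration at `m` is decided by the walk up to `t`. -/
lemma reg_iff_locReg {c : Cfg} {m t : ℕ} (hmt : m ≤ t) (h : c.Reg P (c.walk P 0 t)) :
    c.Reg P (c.walk P 0 m) ↔ c.LocReg P t m := by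
  refine and_congr_right fun _ => ⟨fun h' i hi _ => ?_, fun h' n => ?_⟩
  · have := h' (i - m)
    rwa [← walk_add, Nat.add_sub_cancel' hi] at this
  · rw [← walk_add]
    by_cases hn : m + n ≤ t
    · exact h' _ (by omega) hn
    · obtain ⟨j, hj⟩ := Nat.exists_eq_add_of_lt (not_le.1 hn)
      rw [show m + n = t + (j + 1) by omega, walk_add]
      exact cone_subset (h' t hmt le_rfl) (h.2 _)

/-- Removes the dependence on the future from the absence of earlier regenerations. The proposition
`r` treats at once the first block (`False`) and a block conditioned on regeneration at its start
(`True`). -/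
lemma first_iff_past {c : Cfg} {b : Block} {r : Prop} (h : c.Reg P (endPt b)) :
    ((r → c.Reg P 0) ∧ c.First P b) ↔ c.Past P b r := by
  constructor
  · rintro ⟨hr, hf⟩
    have hreg := hf.1.2
    refine ⟨hf.2.2, hf.1.1, fun m hm hl => hf.2.1 m hm ⟨hl.1, ?_⟩, fun hr' => ?_⟩
    · exact (reg_iff_locReg hm.le hreg).2 hl.2
    · exact (reg_iff_locReg (Nat.zero_le _) hreg).1 (hr hr')
  · rintro ⟨hw, hk, hm, hr⟩
    have hreg : c.Reg P (c.walk P 0 b.1) := by rwa [walk_of_eq hw]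
    refine ⟨fun hr' => (reg_iff_locReg (Nat.zero_le _) hreg).2 (hr hr'), ⟨hk, hreg⟩,
      fun m hmt hl => hm m hmt ⟨hl.1, (reg_iff_locReg hmt.le hreg).1 hl.2⟩, hw⟩

lemma rec_congr {c c' : Cfg} {n : ℕ} (h : ∀ m ≤ n, c.walk P 0 m = c'.walk P 0 m) (k : ℕ) :
    c.Rec P k n ↔ c'.Rec P k n := by
  rw [Cfg.Rec, Cfg.Rec, h n le_rfl]
  refine and_congr_right fun _ => forall₂_congr fun m hm => ?_
  rw [h m hm.le]

/-- Steps before the record start in the back cone of the end point, and crossings matter only at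
points whose cone contains that end point. -/
lemma past_congr (hv : 0 ≤ P.v) {c c' : Cfg} {b : Block} {r : Prop}
    (hn : ∀ z ∈ backCone P.v (endPt b), c.next P z = c'.next P z)
    (hp : ∀ y, endPt b ∈ cone P.v y →
      (c.paths ∩ crossing P.v y = ∅ ↔ c'.paths ∩ crossing P.v y = ∅))
    (h : c.Past P b r) : c'.Past P b r := by
  obtain ⟨hw, ⟨k, hk1, hk⟩, hm, hr⟩ := h
  have hwalk : ∀ m ≤ b.1, c.walk P 0 m = c'.walk P 0 m := walk_congr fun m hm => by
    refine hn _ ?_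
    rw [← walk_of_eq hw]
    exact rec_mem_backCone hv hk hm
  have hrec : ∀ m ≤ b.1, ∀ k, c.Rec P k m ↔ c'.Rec P k m := fun m hm =>
    rec_congr fun j hj => hwalk j (hj.trans hm)
  have hloc : ∀ m ≤ b.1, c.LocReg P b.1 m ↔ c'.LocReg P b.1 m := by
    intro m hm
    have h2 : (∀ i, m ≤ i → i ≤ b.1 → c.walk P 0 i ∈ cone P.v (c.walk P 0 m)) ↔
        ∀ i, m ≤ i → i ≤ b.1 → c'.walk P 0 i ∈ cone P.v (c'.walk P 0 m) :=
      forall₃_congr fun i _ hi => by rw [hwalk i hi, hwalk m hm]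
    rw [Cfg.LocReg, Cfg.LocReg, ← h2]
    -- The cone condition at time `b.1` says that the end of the block lies in the cone at time `m`,
    -- which is what `hp` needs.
    refine and_congr_left fun hc => ?_
    rw [← hwalk m hm]
    refine hp _ ?_
    rw [← walk_of_eq hw]
    exact hc _ hm le_rfl
  refine ⟨fun i => ?_, ⟨k, hk1, (hrec _ le_rfl k).1 hk⟩, fun m hmt => ?_, fun hr' => ?_⟩
  · rw [← hwalk i (by omega), hw]
  · rw [← hloc m hmt.le]
    simp only [← hrec m hmt.le]
    exact hm m hmt
  · exact (hloc 0 (Nat.zero_le _)).1 (hr hr')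

variable (P) in
/-- The part of the configuration that concerns the cone based at `a`. -/
noncomputable def Cfg.fut (a : ℤ × ℤ) (c : Cfg) : Cfg :=
  c.restr (hits (cone P.v a)) (cone P.v a)

variable (P) in
/-- The part of the configuration that concerns the past of `a`. -/
noncomputable def Cfg.past (a : ℤ × ℤ) (c : Cfg) : Cfg :=
  c.restr (hits (cone P.v a))ᶜ (backCone P.v a)

/-- Without crossings at the end point, trajectories through its back cone miss its forward cone. A
trajectory that crosses at an earlier `y` meets the back cone of `y`, hence that of the end point.
So deleting the trajectories that meet the forward cone changes nothing. -/
lemma past_iff_past (hv : 0 ≤ P.v) {c : Cfg} {b : Block} {r : Prop}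
    (h : c.paths ∩ crossing P.v (endPt b) = ∅) :
    c.Past P b r ↔ (c.past P (endPt b)).Past P b r := by
  have hn : ∀ z ∈ backCone P.v (endPt b), c.next P z = (c.past P (endPt b)).next P z := by
    intro z hz
    refine (next_restr hz fun w hw hwz => ?_).symm
    rw [mem_compl_iff]
    intro hwc
    exact eq_empty_iff_forall_notMem.1 h w ⟨hw, hwc, mem_hits_of_eq hz hwz⟩
  have hp : ∀ y, endPt b ∈ cone P.v y → (c.paths ∩ crossing P.v y = ∅ ↔
      (c.past P (endPt b)).paths ∩ crossing P.v y = ∅) := by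
    intro y hy
    suffices hs : (c.past P (endPt b)).paths ∩ crossing P.v y = c.paths ∩ crossing P.v y by
      rw [hs]
    refine subset_antisymm (inter_subset_inter_left _ inter_subset_left) ?_
    rintro w ⟨hw, hwy⟩
    refine ⟨⟨hw, fun hwc => ?_⟩, hwy⟩
    exact eq_empty_iff_forall_notMem.1 h w ⟨hw, hwc, hits_mono (backCone_subset hy) hwy.2⟩
  exact ⟨past_congr hv hn hp,
    past_congr hv (fun z hz => (hn z hz).symm) (fun y hy => (hp y hy).symm)⟩

lemma next_fut {a z : ℤ × ℤ} (hz : z ∈ cone P.v a) (c : Cfg) :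
    (c.fut P a).next P z = c.next P z :=
  next_restr hz fun _ _ hwz => mem_hits_of_eq hz hwz

lemma walk_eq_of_mem {c c' : Cfg} {S : Set (ℤ × ℤ)} (h : ∀ z ∈ S, c.next P z = c'.next P z)
    {y : ℤ × ℤ} (hy : ∀ n, c.walk P y n ∈ S) (n : ℕ) : c.walk P y n = c'.walk P y n :=
  walk_congr (n := n) (fun m _ => h _ (hy m)) n le_rfl

lemma crossing_subset_hits {v : ℝ} {a y : ℤ × ℤ} (h : y ∈ cone v a) :
    crossing v y ⊆ hits (cone v a) :=
  fun _ hw => hits_mono (cone_subset h) hw.1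

lemma reg_of_next {c c' : Cfg} {y : ℤ × ℤ}
    (h : ∀ z ∈ cone P.v y, c.next P z = c'.next P z)
    (hp : c.paths ∩ crossing P.v y = ∅ → c'.paths ∩ crossing P.v y = ∅) (hr : c.Reg P y) :
    c'.Reg P y :=
  ⟨hp hr.1, fun n => by rw [← walk_eq_of_mem h hr.2]; exact hr.2 n⟩

lemma reg_fut {a y : ℤ × ℤ} (h : y ∈ cone P.v a) (c : Cfg) :
    (c.fut P a).Reg P y ↔ c.Reg P y := by
  have hp : (c.fut P a).paths ∩ crossing P.v y = c.paths ∩ crossing P.v y := by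
    rw [Cfg.fut, Cfg.restr, inter_assoc, inter_eq_self_of_subset_right (crossing_subset_hits h)]
  exact ⟨reg_of_next (fun _ hz => next_fut (cone_subset h hz) c) (by rw [hp]; exact id),
    reg_of_next (fun z hz => (next_fut (cone_subset h hz) c).symm) (by rw [hp]; exact id)⟩

lemma fut_fut {a a' : ℤ × ℤ} (h : a' ∈ cone P.v a) (c : Cfg) :
    (c.fut P a).fut P a' = c.fut P a' := by
  rw [Cfg.fut, Cfg.fut, restr_restr, inter_eq_self_of_subset_right (hits_mono (cone_subset h)),
    inter_eq_self_of_subset_left (cone_subset h)]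
  rfl

lemma walk_fut {c : Cfg} (h : c.Reg P 0) (n : ℕ) : (c.fut P 0).walk P 0 n = c.walk P 0 n :=
  (walk_eq_of_mem (fun _ hz => (next_fut hz c).symm) h.2 n).symm

lemma regAt_fut {c : Cfg} (h : c.Reg P 0) (n : ℕ) : (c.fut P 0).RegAt P n ↔ c.RegAt P n := by
  rw [Cfg.RegAt, Cfg.RegAt, walk_fut h, reg_fut (h.2 n)]
  simp only [rec_congr fun m _ => walk_fut h m]

lemma first_fut {c : Cfg} (h : c.Reg P 0) (b : Block) :
    (c.fut P 0).First P b ↔ c.First P b := by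
  simp only [Cfg.First, regAt_fut h, walk_fut h]

lemma reg_shift {a y : ℤ × ℤ} {c : Cfg} : (c.shift a).Reg P y ↔ c.Reg P (y + a) := by
  rw [Cfg.Reg, Cfg.Reg]
  refine and_congr ?_ (forall_congr' fun n => ?_)
  · simp only [eq_empty_iff_forall_notMem, mem_inter_iff, not_and, crossing_eq,
      ← translate_mem_hits_cone, ← translate_mem_hits_backCone]
    constructor
    · exact fun h w hw => h _ (mem_shift_paths.2 hw)
    · intro h w hw
      simpa [translate_translate, translate_zero] using h _ hw
  · rw [← walk_shift, mem_cone_add]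

lemma fut_shift (a : ℤ × ℤ) (c : Cfg) : (c.shift a).fut P 0 = (c.fut P a).shift a := by
  have h1 : ((c.shift a).fut P 0).paths = ((c.fut P a).shift a).paths := by
    ext w
    change translate (-a) w ∈ c.paths ∧ _ ↔ translate (-a) w ∈ c.paths ∧ _
    rw [translate_mem_hits_cone]
    simp
  have h2 : ((c.shift a).fut P 0).mark = ((c.fut P a).shift a).mark := by
    funext z
    change (cone P.v 0).indicator (fun z => c.mark (z + a)) z =
      (cone P.v a).indicator c.mark (z + a)
    have : z + a ∈ cone P.v a ↔ z ∈ cone P.v 0 := by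
      rw [← mem_cone_add (a := a) (y := 0), zero_add]
    by_cases hz : z ∈ cone P.v 0 <;> simp [hz, this]
  cases h : (c.shift a).fut P 0
  cases h' : (c.fut P a).shift a
  simp_all

variable (P) in
/-- The successive blocks are the members of the list. -/
def Cfg.Chain : List Block → Cfg → Prop
  | [], _ => True
  | b :: bs, c => c.First P b ∧ Cfg.Chain bs (c.shift (endPt b))

/-- After a regeneration every later block is read inside the cone: each new regeneration point lies
in the previous cone, so the restrictions are nested. -/
lemma chain_fut (bs : List Block) {c : Cfg} (h : c.Reg P 0) :
    (c.fut P 0).Chain P bs ↔ c.Chain P bs := by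
  induction bs generalizing c with
  | nil => simp [Cfg.Chain]
  | cons b bs ih =>
    rw [Cfg.Chain, Cfg.Chain, first_fut h]
    refine and_congr_right fun hf => ?_
    have hreg : c.Reg P (endPt b) := First.reg hf
    have hmem : endPt b ∈ cone P.v 0 := by
      rw [← walk_of_eq hf.2.2]
      exact h.2 _
    have h1 : (c.shift (endPt b)).Reg P 0 := by rwa [reg_shift, zero_add]
    have h2 : ((c.fut P 0).shift (endPt b)).Reg P 0 := by
      rwa [reg_shift, zero_add, reg_fut hmem]
    rw [← ih h1, ← ih h2, fut_shift, fut_shift, fut_fut hmem]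

lemma measurableSet_first (b : Block) : MeasurableSet {c : Cfg | c.First P b} := by
  simp only [Cfg.First, ofPred_and, ofPred_forall]
  refine (measurableSet_regAt _).inter (.inter (.iInter fun m => .iInter fun _ => ?_)
    (.iInter fun i => ?_))
  · exact (measurableSet_regAt m).compl
  · exact measurable_walk (P := P) 0 i (.of_discrete (s := {z | z.1 = b.2 i}))

lemma measurableSet_chain (bs : List Block) : MeasurableSet {c : Cfg | c.Chain P bs} := by
  induction bs with
  | nil => simp [Cfg.Chain]
  | cons b bs ih =>
    simp only [Cfg.Chain, ofPred_and]
    exact (measurableSet_first b).inter (measurable_shift (endPt b) ih)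

lemma measurableSet_locReg (t m : ℕ) : MeasurableSet {c : Cfg | c.LocReg P t m} := by
  simp only [Cfg.LocReg]
  have h : ∀ z : ℤ × ℤ, MeasurableSet {c : Cfg | c.paths ∩ crossing P.v z = ∅ ∧
      ∀ i, m ≤ i → i ≤ t → c.walk P 0 i ∈ cone P.v z} := by
    intro z
    simp only [ofPred_and, ofPred_forall]
    exact (measurableSet_void (measurableSet_crossing _ _)).inter
      (.iInter fun i => .iInter fun _ => .iInter fun _ => measurable_walk 0 i .of_discrete)
  exact measurableSet_of_walk (p := fun c z => c.paths ∩ crossing P.v z = ∅ ∧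
      ∀ i, m ≤ i → i ≤ t → c.walk P 0 i ∈ cone P.v z) h 0 m

lemma measurableSet_past (b : Block) (r : Prop) : MeasurableSet {c : Cfg | c.Past P b r} := by
  have hrec : ∀ m, MeasurableSet {c : Cfg | ∃ k, 1 ≤ k ∧ c.Rec P k m} := by
    intro m
    simp only [ofPred_exists, ofPred_and]
    exact .iUnion fun k => (MeasurableSet.const _).inter (measurableSet_rec k m)
  simp only [Cfg.Past, ofPred_and, ofPred_forall]
  refine .inter (.iInter fun i => ?_) (.inter (hrec _) (.inter
    (.iInter fun m => .iInter fun _ => ?_) (.iInter fun _ => measurableSet_locReg _ _)))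
  · exact measurable_walk (P := P) 0 i (.of_discrete (s := {z | z.1 = b.2 i}))
  · exact ((hrec m).inter (measurableSet_locReg _ _)).compl

/-! ### Factorization of the block probabilities -/

variable (q : Ioo (0 : ℝ) 1) (ρ : ℝ≥0)

variable (P) in
/-- The probability of the part of a block that concerns the past of its end point. -/
noncomputable def pastProb (b : Block) (r : Prop) : ℝ≥0∞ :=
  cfgLaw q ρ {c | (c.past P (endPt b)).Past P b r}

/-- The event is the intersection of an event of `past` and an event of `fut` at the end point `a`
of the block. These restrictions use disjoint trajectories and disjoint sites, hence are
independent; shifting by `a` brings the future factor to the origin. -/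
lemma measure_first_chain (hv : 0 ≤ P.v) (b : Block) (bs : List Block) (r : Prop) :
    cfgLaw q ρ {c | (r → c.Reg P 0) ∧ c.Chain P (b :: bs)} =
      pastProb P q ρ b r * cfgLaw q ρ {c | c.Reg P 0 ∧ c.Chain P bs} := by
  set a := endPt b with ha
  set F : Set Cfg := {c | c.Reg P a ∧ (c.shift a).Chain P bs} with hF
  have hFm : MeasurableSet F :=
    (measurableSet_reg a).inter (measurable_shift a (measurableSet_chain bs))
  -- The future event is measurable with respect to the restriction to the cone.
  have hFf : ∀ c, c.fut P a ∈ F ↔ c ∈ F := by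
    intro c
    simp only [hF, mem_ofPred_eq, reg_fut (self_mem_cone _ a)]
    refine and_congr_right fun h => ?_
    rw [← fut_shift, chain_fut]
    rwa [reg_shift, zero_add]
  have hFs : F = Cfg.shift a ⁻¹' {c | c.Reg P 0 ∧ c.Chain P bs} := by
    ext c
    simp [hF, reg_shift]
  have hset : {c | (r → c.Reg P 0) ∧ c.Chain P (b :: bs)} =
      Cfg.past P a ⁻¹' {c | c.Past P b r} ∩ Cfg.fut P a ⁻¹' F := by
    ext c
    rw [mem_inter_iff, mem_preimage, mem_preimage, hFf, hF]
    simp only [mem_ofPred_eq, Cfg.Chain, ← and_assoc, ← ha]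
    refine and_congr_left fun _ => ?_
    constructor
    · intro h
      have hr : c.Reg P a := First.reg h.2
      exact ⟨(past_iff_past hv hr.1).1 ((first_iff_past hr).1 h), hr⟩
    · rintro ⟨h, hr⟩
      exact (first_iff_past hr).2 ((past_iff_past hv hr.1).2 h)
  have hind : IndepFun (Cfg.past P a) (Cfg.fut P a) (cfgLaw q ρ) :=
    indepFun_restr q ρ (measurableSet_hits _).compl (measurableSet_hits _) disjoint_compl_left
      (disjoint_cone_backCone _ _).symm
  have hfutm : Measurable (Cfg.fut P a) := measurable_restr (measurableSet_hits _) _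
  rw [hset, hind.measure_inter_preimage_eq_mul _ _ (measurableSet_past b r) hFm]
  congr 1
  have : Cfg.fut P a ⁻¹' F = F := by ext c; exact hFf c
  have hm : MeasurableSet {c : Cfg | c.Reg P 0 ∧ c.Chain P bs} :=
    (measurableSet_reg 0).inter (measurableSet_chain bs)
  rw [this, hFs, (measurePreserving_shift q ρ a).measure_preimage hm.nullMeasurableSet]

lemma measure_reg_chain (hv : 0 ≤ P.v) (bs : List Block) :
    cfgLaw q ρ {c | c.Reg P 0 ∧ c.Chain P bs} =
      (bs.map fun b => pastProb P q ρ b True).prod * cfgLaw q ρ {c | c.Reg P 0} := by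
  induction bs with
  | nil => simp [Cfg.Chain]
  | cons b bs ih =>
    have := measure_first_chain q ρ hv b bs True
    simp only [true_imp_iff] at this
    rw [this, ih, List.map_cons, List.prod_cons, mul_assoc]

lemma measure_first (hv : 0 ≤ P.v) (b : Block) :
    cfgLaw q ρ {c | c.First P b} = pastProb P q ρ b False * cfgLaw q ρ {c | c.Reg P 0} := by
  have := measure_first_chain q ρ hv b [] False
  simpa [Cfg.Chain] using this

lemma measure_reg_first (hv : 0 ≤ P.v) (b : Block) :
    cfgLaw q ρ {c | c.Reg P 0 ∧ c.First P b} =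
      pastProb P q ρ b True * cfgLaw q ρ {c | c.Reg P 0} := by
  have := measure_first_chain q ρ hv b [] True
  simpa [Cfg.Chain] using this

/-- The leftover factor, the probability of regeneration at `0`, is absorbed into the probability of
the first block. -/
lemma measure_chain_cons (hv : 0 ≤ P.v) (b : Block) (bs : List Block) :
    cfgLaw q ρ {c | c.Chain P (b :: bs)} =
      cfgLaw q ρ {c | c.First P b} * (bs.map fun b => pastProb P q ρ b True).prod := by
  have := measure_first_chain q ρ hv b bs False
  simp only [false_imp_iff, true_and] at this
  rw [this, measure_reg_chain q ρ hv, measure_first q ρ hv]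
  ring

end RWDRE

namespace RWDRE

/-! ### Deviation estimates for the trajectories -/

/-- The moment generating function is a convex combination of `1` and `cosh v`, and `cosh v ≤ exp (v
^ 2 / 2)`. The sign `s` covers deviations to both sides. -/
lemma lintegral_exp_stepLaw_le (q : Ioo (0 : ℝ) 1) {s : ℝ} (hs : s = 1 ∨ s = -1) (v : ℝ) :
    ∫⁻ x, ENNReal.ofReal (Real.exp (v * (s * x))) ∂(stepLaw q) ≤
      ENNReal.ofReal (Real.exp (v ^ 2 / 2)) := by
  have h0 : (0 : ℝ) < q := q.2.1
  have h1 : (q : ℝ) < 1 := q.2.2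
  have h2 : (0 : ℝ) ≤ (1 - q) / 2 := by linarith
  rw [stepLaw, lintegral_add_measure, lintegral_add_measure, lintegral_smul_measure,
    lintegral_smul_measure, lintegral_smul_measure, lintegral_dirac, lintegral_dirac,
    lintegral_dirac]
  simp only [smul_eq_mul]
  rw [← ENNReal.ofReal_mul h2, ← ENNReal.ofReal_mul h0.le, ← ENNReal.ofReal_mul h2,
    ← ENNReal.ofReal_add (by positivity) (by positivity),
    ← ENNReal.ofReal_add (by positivity) (by positivity)]
  refine ENNReal.ofReal_le_ofReal ?_
  have h3 : (1 : ℝ) ≤ Real.exp (v ^ 2 / 2) := Real.one_le_exp (by positivity)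
  have h4 := Real.cosh_le_exp_half_sq v
  rw [Real.cosh_eq] at h4
  rcases hs with rfl | rfl
  · push_cast
    simp only [mul_neg, mul_one, mul_zero, Real.exp_zero]
    nlinarith
  · push_cast
    simp only [mul_neg, mul_one, mul_zero, Real.exp_zero, neg_neg]
    nlinarith

/-- Chernoff bound with the speed `v` itself as exponential parameter: `-v (v n + u) + n v² / 2 = -v
u - n v² / 2`. The injection `f` covers future and past steps. -/
lemma measure_sum_ge_le (q : Ioo (0 : ℝ) 1) {s : ℝ} (hs : s = 1 ∨ s = -1) {v : ℝ} (hv : 0 ≤ v)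
    (u : ℝ) {f : ℕ → ℤ} (hf : Function.Injective f) (n : ℕ) :
    Measure.infinitePi (fun _ : ℤ => stepLaw q)
        {e | v * n + u ≤ s * ((∑ k ∈ Finset.range n, e (f k) : ℤ) : ℝ)} ≤
      ENNReal.ofReal (Real.exp (-(v * u)) * Real.exp (-(v ^ 2 / 2)) ^ n) := by
  set μ := Measure.infinitePi (fun _ : ℤ => stepLaw q)
  set g : ℤ → ℝ≥0∞ := fun x => ENNReal.ofReal (Real.exp (v * (s * x))) with hg
  have hi : iIndepFun (fun (k : ℕ) (e : ℤ → ℤ) => g (e (f k))) μ :=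
    (iIndepFun_infinitePi (P := fun _ : ℤ => stepLaw q) (X := fun (_ : ℤ) (x : ℤ) => g x)
      (fun _ => .of_discrete)).precomp hf
  have hm : ∀ k : ℕ, Measurable fun e : ℤ → ℤ => g (e (f k)) := fun k =>
    (Measurable.of_discrete (f := g)).comp (measurable_pi_apply _)
  have h1 : ∫⁻ e, ∏ k ∈ Finset.range n, g (e (f k)) ∂μ ≤
      ENNReal.ofReal (Real.exp (v ^ 2 / 2)) ^ n := by
    rw [lintegral_prod_eq_prod_lintegral_of_indepFun _ _ hi hm]
    refine (Finset.prod_le_pow_card _ _ (ENNReal.ofReal (Real.exp (v ^ 2 / 2))) fun k _ => ?_).trans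
      (by simp)
    have := (measurePreserving_eval_infinitePi (fun _ : ℤ => stepLaw q) (f k)).lintegral_comp
      (Measurable.of_discrete (f := g))
    exact this.le.trans (lintegral_exp_stepLaw_le q hs v)
  have h2 : ∀ e : ℤ → ℤ, ∏ k ∈ Finset.range n, g (e (f k)) = ENNReal.ofReal
      (Real.exp (v * (s * ((∑ k ∈ Finset.range n, e (f k) : ℤ) : ℝ)))) := by
    intro e
    rw [← ENNReal.ofReal_prod_of_nonneg (fun k _ => (Real.exp_pos _).le), ← Real.exp_sum]
    push_cast
    rw [Finset.mul_sum, Finset.mul_sum]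
  have h3 := mul_meas_ge_le_lintegral₀ (μ := μ)
    (f := fun e => ∏ k ∈ Finset.range n, g (e (f k)))
    (Finset.aemeasurable_fun_prod _ fun k _ => (hm k).aemeasurable)
    (ENNReal.ofReal (Real.exp (v * (v * n + u))))
  have h4 : {e : ℤ → ℤ | v * n + u ≤ s * ((∑ k ∈ Finset.range n, e (f k) : ℤ) : ℝ)} ⊆
      {e | ENNReal.ofReal (Real.exp (v * (v * n + u))) ≤
        ∏ k ∈ Finset.range n, g (e (f k))} := by
    intro e he
    rw [mem_ofPred_eq, h2]
    exact ENNReal.ofReal_le_ofReal (Real.exp_le_exp.2 (mul_le_mul_of_nonneg_left he hv))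
  refine (measure_mono h4).trans ?_
  have h5 : ENNReal.ofReal (Real.exp (v * (v * n + u))) ≠ 0 := by simp [Real.exp_pos]
  have h6 := h3.trans h1
  rw [mul_comm] at h6
  refine ((ENNReal.le_div_iff_mul_le (Or.inl h5) (Or.inl ENNReal.ofReal_ne_top)).2 h6).trans_eq ?_
  rw [← ENNReal.ofReal_pow (Real.exp_pos _).le, ← ENNReal.ofReal_div_of_pos (Real.exp_pos _)]
  congr 1
  rw [← Real.exp_nat_mul, ← Real.exp_nat_mul, ← Real.exp_sub, ← Real.exp_add]
  congr 1
  ring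

lemma twoSidedPath_eq_sum (z : ℤ) (n : ℤ) : ∃ f : ℕ → ℤ, Function.Injective f ∧
    ∀ e : ℤ → ℤ, twoSidedPath z e n = z + ∑ k ∈ Finset.range n.natAbs, e (f k) := by
  rcases n with n | n
  · exact ⟨fun k => k, Nat.cast_injective, fun e => rfl⟩
  · exact ⟨fun k => -((k : ℤ) + 1), fun a b h => by simpa using h, fun e => rfl⟩

lemma pathLaw_dev_le (q : Ioo (0 : ℝ) 1) {s : ℝ} (hs : s = 1 ∨ s = -1) {v : ℝ} (hv : 0 ≤ v)
    (u : ℝ) (z n : ℤ) :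
    pathLaw q z {w | v * n.natAbs + u ≤ s * ((w n : ℝ) - z)} ≤
      ENNReal.ofReal (Real.exp (-(v * u)) * Real.exp (-(v ^ 2 / 2)) ^ n.natAbs) := by
  obtain ⟨f, hf, h⟩ := twoSidedPath_eq_sum z n
  have hm : MeasurableSet {w : ℤ → ℤ | v * n.natAbs + u ≤ s * ((w n : ℝ) - z)} :=
    show MeasurableSet ((fun w : ℤ → ℤ => w n) ⁻¹' {x : ℤ | v * n.natAbs + u ≤ s * ((x : ℝ) - z)})
      from measurable_pi_apply n .of_discrete
  rw [pathLaw, Measure.map_apply (measurable_twoSidedPath z) hm]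
  refine le_trans (le_of_eq ?_) (measure_sum_ge_le q hs hv u hf n.natAbs)
  congr 1
  ext e
  simp only [mem_preimage, mem_ofPred_eq, h]
  push_cast
  rw [add_sub_cancel_left]

/-- The constant in the maximal deviation estimates. -/
noncomputable def devConst (v : ℝ) : ℝ := (1 - Real.exp (-(v ^ 2 / 2)))⁻¹

lemma devConst_nonneg (v : ℝ) : 0 ≤ devConst v :=
  inv_nonneg.2 (sub_nonneg.2 (Real.exp_le_one_iff.2 (by have := sq_nonneg v; linarith)))

lemma tsum_dev {v : ℝ} (hv : 0 < v) (u : ℝ) :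
    ∑' n : ℕ, ENNReal.ofReal (Real.exp (-(v * u)) * Real.exp (-(v ^ 2 / 2)) ^ n) =
      ENNReal.ofReal (devConst v * Real.exp (-(v * u))) := by
  have h1 : Real.exp (-(v ^ 2 / 2)) < 1 := Real.exp_lt_one_iff.mpr (by have := pow_pos hv 2; linarith)
  have h := (hasSum_geometric_of_lt_one (Real.exp_pos _).le h1).mul_left (Real.exp (-(v * u)))
  rw [← ENNReal.ofReal_tsum_of_nonneg (fun n => by positivity) h.summable, h.tsum_eq, mul_comm]
  rfl

lemma pathLaw_future_le (q : Ioo (0 : ℝ) 1) {v : ℝ} (hv : 0 < v) (u : ℝ) (z : ℤ) :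
    pathLaw q z {w | ∃ n : ℕ, v * n + u ≤ (w n : ℝ) - z} ≤
      ENNReal.ofReal (devConst v * Real.exp (-(v * u))) := by
  rw [← tsum_dev hv, ofPred_exists]
  refine (measure_iUnion_le _).trans (ENNReal.tsum_le_tsum fun n => ?_)
  simpa using pathLaw_dev_le q (Or.inl rfl) hv.le u z n

lemma pathLaw_past_le (q : Ioo (0 : ℝ) 1) {v : ℝ} (hv : 0 < v) (u : ℝ) (z : ℤ) :
    pathLaw q z {w | ∃ n : ℕ, v * n + u ≤ -((w (-n) : ℝ) - z)} ≤
      ENNReal.ofReal (devConst v * Real.exp (-(v * u))) := by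
  rw [← tsum_dev hv, ofPred_exists]
  refine (measure_iUnion_le _).trans (ENNReal.tsum_le_tsum fun n => ?_)
  simpa using pathLaw_dev_le q (Or.inr rfl) hv.le u z (-n)

/-! ### Intensity of trajectories that link two cones or climb from a point -/

lemma pathLaw_cross_le (q : Ioo (0 : ℝ) 1) {v : ℝ} (hv : 0 < v) (hv1 : v ≤ 1) (l : ℕ) (z : ℤ) :
    pathLaw q z (hits (backCone v 0) ∩ hits (cone v (l, l))) ≤
      ENNReal.ofReal (devConst v * Real.exp (-(v / 3 * (1 - v) * l)) *
        Real.exp (-(v / 3 * |(z : ℝ)|))) := by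
  have hC := devConst_nonneg v
  have h1 : pathLaw q z (hits (backCone v 0) ∩ hits (cone v (l, l))) ≤
      ENNReal.ofReal (devConst v * Real.exp (-(v * ((1 - v) * l - z)))) := by
    refine (measure_mono ?_).trans (pathLaw_future_le q hv _ z)
    rintro w ⟨-, n, h1, h2, h3⟩
    lift n to ℕ using le_trans (by positivity) h2
    refine ⟨n, ?_⟩
    push_cast at h3
    linarith
  have h2 : pathLaw q z (hits (backCone v 0) ∩ hits (cone v (l, l))) ≤
      ENNReal.ofReal (devConst v * Real.exp (-(v * z))) := by
    refine (measure_mono ?_).trans (pathLaw_past_le q hv _ z)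
    rintro w ⟨⟨n, h1, h2, h3⟩, -⟩
    obtain ⟨m, rfl⟩ : ∃ m : ℕ, n = -m := ⟨n.natAbs, by
      have : n ≤ 0 := h2
      omega⟩
    refine ⟨m, ?_⟩
    push_cast at h3
    simp only [Prod.fst_zero, Prod.snd_zero, Int.cast_zero, sub_zero] at h3
    linarith
  have hM : 0 ≤ (1 - v) * l := mul_nonneg (by linarith) (by positivity)
  -- To the left of `(1 - v) l / 2` the climb to the cone is costly, to the right of it the descent
  -- to the back cone is. At the threshold both exponents equal `v / 3 * ((1 - v) l + z)`, hence the
  -- factor `1 / 3`.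
  rcases le_or_gt 0 ((1 - v) * (l : ℝ) - 2 * z) with h | h
  · refine h1.trans (ENNReal.ofReal_le_ofReal ?_)
    rw [mul_assoc, ← Real.exp_add]
    refine mul_le_mul_of_nonneg_left (Real.exp_le_exp.2 ?_) hC
    rcases abs_cases (z : ℝ) with ⟨hz, _⟩ | ⟨hz, _⟩ <;> rw [hz] <;> nlinarith
  · refine h2.trans (ENNReal.ofReal_le_ofReal ?_)
    rw [mul_assoc, ← Real.exp_add]
    refine mul_le_mul_of_nonneg_left (Real.exp_le_exp.2 ?_) hC
    rw [abs_of_nonneg (by linarith)]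
    nlinarith

lemma summable_exp_abs {a : ℝ} (ha : 0 < a) : Summable fun z : ℤ => Real.exp (-(a * |(z : ℝ)|)) := by
  have h1 : Real.exp (-a) < 1 := Real.exp_lt_one_iff.mpr (by linarith)
  have h := summable_geometric_of_lt_one (Real.exp_pos _).le h1
  have h2 : ∀ n : ℕ, Real.exp (-a) ^ n = Real.exp (-(a * n)) := fun n => by
    rw [← Real.exp_nat_mul]; congr 1; ring
  simp only [h2] at h
  refine Summable.of_nat_of_neg ?_ ?_ <;> simpa using h

/-- The constant in the bound on the intensity of the crossing trajectories. -/
noncomputable def crossConst (v : ℝ) (ρ : ℝ≥0) : ℝ :=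
  ρ * (devConst v * ∑' z : ℤ, Real.exp (-(v / 3 * |(z : ℝ)|)))

lemma intensity_cross_le (q : Ioo (0 : ℝ) 1) (ρ : ℝ≥0) {v : ℝ} (hv : 0 < v) (hv1 : v ≤ 1)
    (l : ℕ) :
    intensity q ρ (hits (backCone v 0) ∩ hits (cone v (l, l))) ≤
      ENNReal.ofReal (crossConst v ρ * Real.exp (-(v / 3 * (1 - v) * l))) := by
  rw [intensity, Measure.smul_apply, Measure.sum_apply _
    ((measurableSet_hits _).inter (measurableSet_hits _)), smul_eq_mul]
  have hs := (summable_exp_abs (by positivity : 0 < v / 3)).mul_left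
    (devConst v * Real.exp (-(v / 3 * (1 - v) * l)))
  have hC := devConst_nonneg v
  have := ENNReal.tsum_le_tsum fun z => pathLaw_cross_le q hv hv1 l z
  rw [← ENNReal.ofReal_tsum_of_nonneg (fun n => by positivity) hs, tsum_mul_left] at this
  refine (mul_le_mul_right this _).trans_eq ?_
  rw [← ENNReal.ofReal_coe_nnreal, ← ENNReal.ofReal_mul (by positivity), crossConst]
  congr 1
  ring

lemma intensity_crossing_ne_top (q : Ioo (0 : ℝ) 1) (ρ : ℝ≥0) {v : ℝ} (hv : 0 < v) (hv1 : v ≤ 1) :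
    intensity q ρ (crossing v 0) ≠ ∞ := by
  have h := intensity_cross_le q ρ hv hv1 0
  rw [inter_comm] at h
  exact ne_top_of_le_ne_top ENNReal.ofReal_ne_top h

/-- The trajectories through `y` that exceed later the level of `y` by at least `u`. -/
def exceeds (v : ℝ) (y : ℤ × ℤ) (u : ℝ) : Set (ℤ → ℤ) :=
  {w | w y.2 = y.1 ∧ ∃ n : ℕ, u + lev v y ≤ lev v (w (y.2 + n), y.2 + n)}

lemma measurableSet_exceeds (v : ℝ) (y : ℤ × ℤ) (u : ℝ) : MeasurableSet (exceeds v y u) := by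
  simp only [exceeds, ofPred_and, ofPred_exists]
  refine MeasurableSet.inter ?_ (.iUnion fun n => ?_)
  · exact measurableSet_eq_fun (measurable_pi_apply _) measurable_const
  · exact show MeasurableSet ((fun w : ℤ → ℤ => w (y.2 + n)) ⁻¹'
      {x : ℤ | u + lev v y ≤ lev v (x, y.2 + n)}) from measurable_pi_apply _ .of_discrete

/-- By translation invariance `y` may be taken to be the origin; only particles started at `0` then
contribute, and the deviation bound for one walk applies. -/
lemma intensity_exceeds_le (q : Ioo (0 : ℝ) 1) (ρ : ℝ≥0) {v : ℝ} (hv : 0 < v) (y : ℤ × ℤ)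
    (u : ℝ) :
    intensity q ρ (exceeds v y u) ≤ ENNReal.ofReal (ρ * devConst v * Real.exp (-(v * u))) := by
  have h1 : exceeds v y u = translate y ⁻¹' exceeds v 0 u := by
    ext w
    simp only [exceeds, translate, mem_preimage, mem_ofPred_eq, Prod.fst_zero, Prod.snd_zero,
      zero_add, sub_eq_zero, lev]
    refine and_congr_right fun _ => exists_congr fun n => ?_
    rw [add_comm (n : ℤ) y.2]
    push_cast
    constructor <;> intro h <;> linarith
  rw [h1, (measurePreserving_translate q ρ y).measure_preimage
    (measurableSet_exceeds _ _ _).nullMeasurableSet, intensity, Measure.smul_apply,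
    Measure.sum_apply _ (measurableSet_exceeds _ _ _), smul_eq_mul, tsum_eq_single 0,
    mul_assoc, ENNReal.ofReal_mul (by positivity), ENNReal.ofReal_coe_nnreal]
  · refine mul_le_mul_right ((measure_mono ?_).trans (pathLaw_future_le q hv u 0)) _
    rintro w ⟨-, n, h⟩
    refine ⟨n, ?_⟩
    simp only [lev, Prod.fst_zero, Prod.snd_zero, zero_add] at h
    push_cast at h ⊢
    linarith
  · intro z hz
    rw [pathLaw, Measure.map_apply (measurable_twoSidedPath z) (measurableSet_exceeds _ _ _)]
    convert measure_empty (μ := Measure.infinitePi fun _ : ℤ => stepLaw q)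
    rw [eq_empty_iff_forall_notMem]
    rintro e ⟨h, -⟩
    refine hz ?_
    simpa [twoSidedPath] using h

end RWDRE

namespace RWDRE

open Filter Topology

variable {P : Params}

/-! ### Positivity of the probability of regeneration -/

variable (P) in
/-- The walk falls behind the line of slope `3 v` by more than `L`. -/
def Cfg.Slow (c : Cfg) (L : ℕ) : Prop := ∃ n : ℕ, ((c.walk P 0 n).1 : ℝ) < 3 * P.v * n - L

lemma measurableSet_slow (L : ℕ) : MeasurableSet {c : Cfg | c.Slow P L} := by
  simp only [Cfg.Slow, ofPred_exists]
  exact .iUnion fun n => measurable_walk (P := P) 0 n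
    (.of_discrete (s := {z : ℤ × ℤ | (z.1 : ℝ) < 3 * P.v * n - L}))

/-- The only consequence of ballisticity that is used; the rate of decay plays no role. -/
lemma tendsto_slow {q : Ioo (0 : ℝ) 1} {ρ : ℝ≥0}
    (h : Ballistic P.pVac P.pOcc q ρ (3 * P.v)) :
    Tendsto (fun L : ℕ => cfgLaw q ρ {c | c.Slow P L}) atTop (𝓝 0) := by
  obtain ⟨c, hc, γ, hγ, hb⟩ := h
  have h1 : Tendsto (fun L : ℕ => Real.log L ^ γ) atTop atTop :=
    (tendsto_rpow_atTop (by linarith)).comp (Real.tendsto_log_atTop.comp tendsto_natCast_atTop_atTop)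
  have h2 : Tendsto (fun L : ℕ => Real.exp (-c * Real.log L ^ γ)) atTop (𝓝 0) :=
    Real.tendsto_exp_atBot.comp (h1.const_mul_atTop_of_neg (by linarith))
  have h3 : Tendsto (fun L : ℕ => ENNReal.ofReal (c⁻¹ * Real.exp (-c * Real.log L ^ γ))) atTop
      (𝓝 0) := by
    simpa using ENNReal.tendsto_ofReal (h2.const_mul c⁻¹)
  refine tendsto_of_tendsto_of_tendsto_of_le_of_le' tendsto_const_nhds h3
    (Eventually.of_forall fun _ => zero_le) ?_
  filter_upwards [eventually_ge_atTop 1] with L hL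
  rw [cfgLaw, Measure.map_apply measurable_toCfg (measurableSet_slow L)]
  have h4 : toCfg ⁻¹' {c : Cfg | c.Slow P L} ⊆
      {s | ∃ n : ℕ, 1 ≤ n ∧ (walkX P.pVac P.pOcc s n : ℝ) < n * (3 * P.v) - L} := by
    rintro s ⟨n, hn⟩
    refine ⟨n, ?_, ?_⟩
    -- `Slow` also allows `n = 0`, but the walk starts at `0 ≥ -L`, so that case is void.
    · rcases Nat.eq_zero_or_pos n with rfl | h
      · simp only [walk_zero, Prod.fst_zero, Int.cast_zero, Nat.cast_zero, mul_zero, zero_sub] at hn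
        have : (0 : ℝ) ≤ L := by positivity
        linarith
      · exact h
    · rw [walkX, walkY_eq]
      linarith
  refine (measure_mono h4).trans ?_
  rw [← ENNReal.ofReal_toReal (measure_ne_top (law q ρ) _)]
  exact ENNReal.ofReal_le_ofReal (hb L hL)

variable (P) in
/-- The marks force `l` successive steps to the right from `y`. -/
def Cfg.Diag (c : Cfg) (y : ℤ × ℤ) (l : ℕ) : Prop :=
  ∀ i < l, (c.mark (y + ((i : ℤ), (i : ℤ))) : ℝ) ≤ min P.pVac P.pOcc

/-- The points whose marks force successive steps to the right from `y`. -/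
def diagSites (y : ℤ × ℤ) (l : ℕ) : Set (ℤ × ℤ) :=
  {z | ∃ i < l, z = y + ((i : ℤ), (i : ℤ))}

lemma next_of_le {c : Cfg} {z : ℤ × ℤ} (h : (c.mark z : ℝ) ≤ min P.pVac P.pOcc) :
    c.next P z = z + (1, 1) := by
  rw [Cfg.next, if_pos]
  have := le_min_iff.1 h
  tauto

lemma walk_of_diag {c : Cfg} {y : ℤ × ℤ} {l : ℕ} (h : c.Diag P y l) :
    ∀ i ≤ l, c.walk P y i = y + ((i : ℤ), (i : ℤ)) := by
  intro i
  induction i with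
  | zero =>
    intro _
    rw [walk_zero]
    exact (add_zero y).symm
  | succ i ih =>
    intro hi
    rw [walk_succ, ih (by omega), next_of_le (h i (by omega)), add_assoc]
    simp

lemma measurableSet_diag (y : ℤ × ℤ) (l : ℕ) : MeasurableSet {c : Cfg | c.Diag P y l} := by
  simp only [Cfg.Diag, ofPred_forall]
  refine .iInter fun i => .iInter fun _ => measurableSet_le ?_ measurable_const
  exact measurable_subtype_coe.comp ((measurable_pi_apply _).comp measurable_mark)

variable (P) in
/-- The probability that `l` given marks force steps to the right. -/
noncomputable def diagProb (l : ℕ) : ℝ≥0∞ :=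
  (volume {u : unitInterval | (u : ℝ) ≤ min P.pVac P.pOcc}) ^ l

lemma diagProb_ne_zero (h0 : 0 < P.pVac) (h1 : 0 < P.pOcc) (l : ℕ) : diagProb P l ≠ 0 := by
  refine pow_ne_zero _ (ne_of_gt ?_)
  have h2 : 0 < min P.pVac P.pOcc := lt_min h0 h1
  set p : unitInterval := ⟨min (min P.pVac P.pOcc) 1, by positivity, min_le_right _ _⟩ with hp
  have h : Set.Iic p ⊆ {u : unitInterval | (u : ℝ) ≤ min P.pVac P.pOcc} :=
    fun u (hu : (u : ℝ) ≤ min (min P.pVac P.pOcc) 1) => hu.trans (min_le_left _ _)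
  refine lt_of_lt_of_le ?_ (measure_mono h)
  rw [unitInterval.volume_Iic, ENNReal.ofReal_pos]
  exact lt_min h2 one_pos

lemma measure_diag (q : Ioo (0 : ℝ) 1) (ρ : ℝ≥0) (y : ℤ × ℤ) (l : ℕ) :
    cfgLaw q ρ {c | c.Diag P y l} = diagProb P l := by
  classical
  set J : Finset (ℤ × ℤ) := (Finset.range l).image fun i : ℕ => y + ((i : ℤ), (i : ℤ)) with hJ
  set B : Set unitInterval := {u | (u : ℝ) ≤ min P.pVac P.pOcc} with hB
  have hBm : MeasurableSet B := measurableSet_le measurable_subtype_coe measurable_const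
  have h1 : {c : Cfg | c.Diag P y l} = basicEvent ∅ ((J : Set (ℤ × ℤ)).pi fun _ => B) := by
    ext c
    simp only [basicEvent, Cfg.Diag, inter_empty, true_and, Set.mem_pi, hJ, mem_ofPred_eq,
      Finset.coe_image, mem_image, Finset.mem_coe, Finset.mem_range, hB, forall_exists_index,
      and_imp, forall_apply_eq_imp_iff₂]
  rw [h1, cfgLaw_basicEvent q ρ .empty (.pi J.countable_toSet fun _ _ => hBm), measure_empty,
    voidExp_zero, one_mul, markLaw, Measure.infinitePi_pi _ (fun _ _ => hBm), Finset.prod_const,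
    diagProb, Finset.card_image_of_injective, Finset.card_range]
  intro i j hij
  simpa using hij

lemma measure_diag_inter (q : Ioo (0 : ℝ) 1) (ρ : ℝ≥0) (y : ℤ × ℤ) (l : ℕ) {E : Set Cfg}
    (hE : MeasurableSet E) (h : ∀ c, c.restr univ (diagSites y l)ᶜ ∈ E ↔ c ∈ E) :
    cfgLaw q ρ ({c | c.Diag P y l} ∩ E) = diagProb P l * cfgLaw q ρ E := by
  -- Forced steps read marks only, so all the trajectories can be left to `E`.
  have hind := indepFun_restr q ρ .empty .univ (disjoint_bot_left : Disjoint ∅ (univ : Set (ℤ → ℤ)))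
    (disjoint_compl_right : Disjoint (diagSites y l) (diagSites y l)ᶜ)
  have h1 : Cfg.restr ∅ (diagSites y l) ⁻¹' {c | c.Diag P y l} = {c | c.Diag P y l} := by
    ext c
    refine forall₂_congr fun i hi => ?_
    have : y + ((i : ℤ), (i : ℤ)) ∈ diagSites y l := ⟨i, hi, rfl⟩
    simp [Cfg.restr, this]
  have h2 : Cfg.restr univ (diagSites y l)ᶜ ⁻¹' E = E := by
    ext c; exact h c
  have := hind.measure_inter_preimage_eq_mul _ _ (measurableSet_diag (P := P) y l) hE
  rw [h1, h2, measure_diag] at this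
  exact this

lemma next_restr_univ {D : Set (ℤ × ℤ)} {z : ℤ × ℤ} (hz : z ∈ D) (c : Cfg) :
    (c.restr univ D).next P z = c.next P z :=
  next_restr hz fun _ _ _ => mem_univ _

/-- Combine three events: no crossing trajectory, `2 L` forced steps to the right, and a walk that
is not slow afterwards. The first and third are made compatible by the choice of `L`, without any
correlation estimate; the second uses marks that the others do not read. -/
lemma measure_reg_ne_zero {q : Ioo (0 : ℝ) 1} {ρ : ℝ≥0} (hv0 : 0 < P.v) (hv1 : P.v ≤ 1 / 2)
    (h0 : 0 < P.pVac) (h1 : 0 < P.pOcc)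
    (hs : Tendsto (fun L : ℕ => cfgLaw q ρ {c | c.Slow P L}) atTop (𝓝 0)) :
    cfgLaw q ρ {c | c.Reg P 0} ≠ 0 := by
  have hcr := intensity_crossing_ne_top q ρ hv0 (by linarith)
  -- `L` makes slowness less likely than the absence of crossing trajectories, so some of the latter
  -- event survives.
  obtain ⟨L, hL⟩ := (hs.eventually (gt_mem_nhds
    (pos_iff_ne_zero.2 (voidExp_ne_zero hcr)))).exists
  set a : ℤ × ℤ := (((2 * L : ℕ) : ℤ), ((2 * L : ℕ) : ℤ)) with ha
  set V : Set Cfg := {c | c.paths ∩ crossing P.v 0 = ∅} with hV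
  have hVm : MeasurableSet V := measurableSet_void (measurableSet_crossing _ _)
  have hVp : cfgLaw q ρ V = voidExp (intensity q ρ (crossing P.v 0)) := by
    have := cfgLaw_basicEvent q ρ (measurableSet_crossing P.v 0) MeasurableSet.univ
    simpa [basicEvent] using this
  set E : Set Cfg := V ∩ (Cfg.shift a ⁻¹' {c | c.Slow P L})ᶜ with hE
  have hsm : MeasurableSet (Cfg.shift a ⁻¹' {c | c.Slow P L}) :=
    measurable_shift a (measurableSet_slow L)
  have hEm : MeasurableSet E := hVm.inter hsm.compl
  have hEp : cfgLaw q ρ E ≠ 0 := by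
    intro h
    have h2 : cfgLaw q ρ V ≤ cfgLaw q ρ E + cfgLaw q ρ (Cfg.shift a ⁻¹' {c | c.Slow P L}) := by
      refine (measure_mono ?_).trans (measure_union_le _ _)
      intro c hc
      by_cases hcs : c ∈ Cfg.shift a ⁻¹' {c | c.Slow P L}
      · exact Or.inr hcs
      · exact Or.inl ⟨hc, hcs⟩
    rw [h, zero_add, (measurePreserving_shift q ρ a).measure_preimage
      (measurableSet_slow L).nullMeasurableSet, hVp] at h2
    exact absurd hL (not_lt.2 h2)
  have hEslow : ∀ c, c ∈ Cfg.shift a ⁻¹' {c : Cfg | c.Slow P L} ↔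
      ∃ n : ℕ, ((c.walk P a n).1 : ℝ) - (2 * L : ℕ) < 3 * P.v * n - L := by
    intro c
    refine exists_congr fun n => ?_
    have := walk_shift (P := P) a 0 c n
    rw [zero_add] at this
    rw [← this]
    simp [ha]
  have hloc : ∀ c, c.restr univ (diagSites 0 (2 * L))ᶜ ∈ E ↔ c ∈ E := by
    intro c
    -- The walk from `a` lives at times at least `2 L`, after all the forced sites.
    have hD : ∀ n, c.walk P a n ∈ (diagSites 0 (2 * L))ᶜ := by
      rintro n ⟨i, hi, h⟩
      have h2 := congrArg Prod.snd h
      rw [walk_snd] at h2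
      simp only [ha, Prod.snd_add, Prod.snd_zero] at h2
      omega
    refine and_congr ?_ (not_congr ?_)
    · simp [hV, Cfg.restr]
    · rw [hEslow, hEslow]
      refine exists_congr fun n => ?_
      rw [← walk_eq_of_mem (fun z hz => (next_restr_univ hz c).symm) hD n]
  have hsub : {c | c.Diag P 0 (2 * L)} ∩ E ⊆ {c | c.Reg P 0} := by
    rintro c ⟨hd, hcV, hcs⟩
    refine ⟨hcV, fun n => ?_⟩
    rw [mem_compl_iff, hEslow] at hcs
    push Not at hcs
    rcases le_total n (2 * L) with hn | hn
    · rw [walk_of_diag hd n hn]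
      refine ⟨by simp, by simp, ?_⟩
      simp only [zero_add, Prod.fst_zero, Prod.snd_zero, sub_zero, Int.cast_natCast]
      have : (0 : ℝ) ≤ n := by positivity
      nlinarith
    · obtain ⟨m, rfl⟩ := Nat.exists_eq_add_of_le hn
      have h2 : c.walk P 0 (2 * L + m) = c.walk P a m := by
        rw [walk_add, walk_of_diag hd _ le_rfl, zero_add]
      have h3 := hcs m
      have hm : (0 : ℝ) ≤ m := by positivity
      have hL0 : (0 : ℝ) ≤ L := by positivity
      -- The walk is at least at `L + 3 v m`, and `2 v L ≤ L` as `v ≤ 1 / 2`: this is why the forced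
      -- stretch has length `2 L`.
      have h4 : P.v * (2 * L + m) ≤ ((c.walk P a m).1 : ℝ) := by
        push_cast at h3
        nlinarith
      have h5 : (0 : ℝ) ≤ ((c.walk P a m).1 : ℝ) := le_trans (by positivity) h4
      rw [h2]
      refine ⟨by simpa using (by exact_mod_cast h5 : (0 : ℤ) ≤ (c.walk P a m).1), ?_, ?_⟩
      · rw [walk_snd]; simp only [ha, Prod.snd_zero]; positivity
      · rw [walk_snd]
        simp only [ha, Prod.fst_zero, Prod.snd_zero, sub_zero]
        push_cast
        exact h4
  intro hzero
  have := measure_diag_inter (P := P) q ρ 0 (2 * L) hEm hloc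
  rw [measure_mono_null hsub hzero] at this
  rcases mul_eq_zero.1 this.symm with h | h
  · exact diagProb_ne_zero h0 h1 _ h
  · exact hEp h

lemma measure_reg (q : Ioo (0 : ℝ) 1) (ρ : ℝ≥0) (a : ℤ × ℤ) :
    cfgLaw q ρ {c | c.Reg P a} = cfgLaw q ρ {c | c.Reg P 0} := by
  have : {c : Cfg | c.Reg P a} = Cfg.shift a ⁻¹' {c | c.Reg P 0} := by
    ext c
    simp [reg_shift]
  rw [this, (measurePreserving_shift q ρ a).measure_preimage
    (measurableSet_reg 0).nullMeasurableSet]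

end RWDRE

namespace RWDRE

open Filter Topology

variable {P : Params} {q : Ioo (0 : ℝ) 1} {ρ : ℝ≥0}

/-! ### Records -/

lemma lev_next_le (c : Cfg) (z : ℤ × ℤ) : lev P.v (c.next P z) ≤ lev P.v z + (1 - P.v) := by
  have h : ((c.next P z).1 : ℝ) ≤ z.1 + 1 := by exact_mod_cast next_fst_le (P := P) c z
  rw [lev, lev, next_snd]
  push_cast
  linarith

lemma lev_walk_le (c : Cfg) (n : ℕ) : lev P.v (c.walk P 0 n) ≤ (1 - P.v) * n := by
  induction n with
  | zero => simp [walk_zero, lev]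
  | succ n ih =>
    rw [walk_succ]
    have := lev_next_le (P := P) c (c.walk P 0 n)
    push_cast
    linarith

lemma rec_unique {c : Cfg} {k m n : ℕ} (h : c.Rec P k m) (h' : c.Rec P k n) : m = n := by
  by_contra hne
  rcases lt_or_gt_of_ne hne with hlt | hlt
  · exact absurd (h'.2 m hlt) (not_lt.2 h.1)
  · exact absurd (h.2 n hlt) (not_lt.2 h'.1)

lemma exists_rec {c : Cfg} {k n : ℕ} (h : (1 - P.v) * k ≤ lev P.v (c.walk P 0 n)) :
    ∃ t ≤ n, c.Rec P k t := by
  classical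
  have hex : ∃ t, (1 - P.v) * k ≤ lev P.v (c.walk P 0 t) := ⟨n, h⟩
  exact ⟨Nat.find hex, Nat.find_min' hex h, Nat.find_spec hex,
    fun m hm => not_le.1 (Nat.find_min hex hm)⟩

lemma le_of_rec (hv1 : P.v < 1) {c : Cfg} {k n : ℕ} (h : c.Rec P k n) : k ≤ n := by
  have h1 := h.1.trans (lev_walk_le c n)
  exact_mod_cast le_of_mul_le_mul_left h1 (by linarith)

/-- A step to the right raises the level by exactly `1 - v`, the spacing of the records, and a
record is overshot by less than one spacing. Hence each forced step reaches exactly the next record.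
-/
lemma rec_add_of_diag (hv1 : P.v < 1) {c : Cfg} {k n l : ℕ} (hk : 1 ≤ k)
    (h : c.Rec P k n) (hd : c.Diag P (c.walk P 0 n) l) : c.Rec P (k + l) (n + l) := by
  have hlev : ∀ i ≤ l, lev P.v (c.walk P 0 (n + i)) =
      lev P.v (c.walk P 0 n) + (1 - P.v) * i := by
    intro i hi
    rw [walk_add, walk_of_diag hd i hi]
    simp only [lev, Prod.fst_add, Prod.snd_add]
    push_cast
    ring
  have hn : 1 ≤ n := hk.trans (le_of_rec hv1 h)
  -- The overshoot bound compares with the preceding point, which exists because `k ≥ 1` forces `n ≥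
  -- 1`.
  have htop : lev P.v (c.walk P 0 n) < (1 - P.v) * (k + 1) := by
    obtain ⟨m, rfl⟩ := Nat.exists_eq_add_of_le' hn
    have h1 := h.2 m (by omega)
    have h2 := lev_next_le (P := P) c (c.walk P 0 m)
    rw [walk_succ]
    linarith
  refine ⟨?_, fun m hm => ?_⟩
  · rw [hlev l le_rfl]
    have := h.1
    push_cast
    linarith
  · rcases lt_or_ge m n with hmn | hmn
    · refine (h.2 m hmn).trans_le (mul_le_mul_of_nonneg_left ?_ (by linarith))
      push_cast
      have : (0 : ℝ) ≤ l := by positivity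
      linarith
    · obtain ⟨i, rfl⟩ := Nat.exists_eq_add_of_le hmn
      rw [hlev i (by omega)]
      have hi : (i : ℝ) + 1 ≤ l := by exact_mod_cast (by omega : i + 1 ≤ l)
      have : (1 - P.v) * (i + 1) ≤ (1 - P.v) * l := mul_le_mul_of_nonneg_left hi (by linarith)
      push_cast
      linarith

/-! ### Decomposition according to the path of the walk -/

/-- Replaces conditioning on the path of the walk by a sum over its countably many values. -/
lemma measure_le_of_disjoint {μ : Measure Cfg} {ι : Type*} [Countable ι] {S : ι → Set Cfg}
    (hS : ∀ i, MeasurableSet (S i)) (hd : Pairwise (Function.onFun Disjoint S)) {E E' : Set Cfg}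
    (hE : E ⊆ ⋃ i, S i) (hE' : MeasurableSet E') (κ : ℝ≥0∞)
    (h : ∀ i, μ (E ∩ S i) ≤ κ * μ (E' ∩ S i)) : μ E ≤ κ * μ E' := by
  calc μ E ≤ μ (⋃ i, E ∩ S i) := by
        rw [← inter_iUnion]
        exact measure_mono fun c hc => ⟨hc, hE hc⟩
    _ ≤ ∑' i, μ (E ∩ S i) := measure_iUnion_le _
    _ ≤ ∑' i, κ * μ (E' ∩ S i) := ENNReal.tsum_le_tsum h
    _ = κ * ∑' i, μ (E' ∩ S i) := ENNReal.tsum_mul_left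
    _ ≤ κ * μ (⋃ i, E' ∩ S i) := by
        gcongr
        exact tsum_meas_le_meas_iUnion_of_disjoint μ (fun i => hE'.inter (hS i))
          fun i j hij => (hd hij).mono inter_subset_right inter_subset_right
    _ ≤ κ * μ E' := by
        gcongr
        exact iUnion_subset fun i => inter_subset_left

variable (P) in
/-- The walk follows the path `p`. -/
def pathEvent {n : ℕ} (p : Fin (n + 1) → ℤ × ℤ) : Set Cfg :=
  {c | ∀ i : Fin (n + 1), c.walk P 0 i = p i}

lemma measurableSet_pathEvent {n : ℕ} (p : Fin (n + 1) → ℤ × ℤ) :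
    MeasurableSet (pathEvent P p) := by
  simp only [pathEvent, ofPred_forall]
  exact .iInter fun i => measurable_walk (P := P) 0 i (measurableSet_singleton (p i))

lemma disjoint_pathEvent {n : ℕ} :
    Pairwise (Function.onFun Disjoint fun p : Fin (n + 1) → ℤ × ℤ => pathEvent P p) := by
  intro p p' hne
  rw [Function.onFun, Set.disjoint_left]
  intro c h h'
  exact hne (funext fun i => (h i).symm.trans (h' i))

lemma iUnion_pathEvent (n : ℕ) : ⋃ p : Fin (n + 1) → ℤ × ℤ, pathEvent P p = univ := by
  rw [eq_univ_iff_forall]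
  exact fun c => mem_iUnion.2 ⟨fun i => c.walk P 0 i, fun i => rfl⟩

variable (P) in
/-- The walk follows the path `p` up to its end, at which it reaches the record `k`. -/
def recPath (k : ℕ) (x : Σ n : ℕ, Fin (n + 1) → ℤ × ℤ) : Set Cfg :=
  pathEvent P x.2 ∩ {c | c.Rec P k x.1}

lemma measurableSet_recPath (k : ℕ) (x : Σ n : ℕ, Fin (n + 1) → ℤ × ℤ) :
    MeasurableSet (recPath P k x) :=
  (measurableSet_pathEvent _).inter (measurableSet_rec _ _)

lemma disjoint_recPath (k : ℕ) : Pairwise (Function.onFun Disjoint (recPath P k)) := by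
  rintro ⟨n, p⟩ ⟨n', p'⟩ hne
  rw [Function.onFun, Set.disjoint_left]
  rintro c ⟨h1, h2⟩ ⟨h3, h4⟩
  obtain rfl : n = n' := rec_unique h2 h4
  exact hne (congrArg _ (funext fun i => (h1 i).symm.trans (h3 i)))

lemma mem_recPath {c : Cfg} {k n : ℕ} (h : c.Rec P k n) :
    c ∈ recPath P k ⟨n, fun i => c.walk P 0 i⟩ :=
  ⟨fun _ => rfl, h⟩

lemma pathEvent_of_next {c c' : Cfg} {n : ℕ} {p : Fin (n + 1) → ℤ × ℤ}
    (h : ∀ i : Fin n, c.next P (p i.castSucc) = c'.next P (p i.castSucc))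
    (hc : c ∈ pathEvent P p) : c' ∈ pathEvent P p := by
  have hw : ∀ m ≤ n, c.walk P 0 m = c'.walk P 0 m := walk_congr fun m hm => by
    have h1 := h ⟨m, hm⟩
    have h2 := hc (Fin.castSucc ⟨m, hm⟩)
    rw [← h2] at h1
    exact h1
  intro i
  rw [← hw i (by omega)]
  exact hc i

lemma pathEvent_restr_iff {n : ℕ} {p : Fin (n + 1) → ℤ × ℤ} {B : Set (ℤ → ℤ)} {D : Set (ℤ × ℤ)}
    (hD : ∀ i : Fin n, p i.castSucc ∈ D)
    (hB : ∀ (i : Fin n) (w : ℤ → ℤ), w (p i.castSucc).2 = (p i.castSucc).1 → w ∈ B) (c : Cfg) :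
    c.restr B D ∈ pathEvent P p ↔ c ∈ pathEvent P p := by
  have h : ∀ i : Fin n, (c.restr B D).next P (p i.castSucc) = c.next P (p i.castSucc) :=
    fun i => next_restr (hD i) fun w _ hw => hB i w hw
  exact ⟨pathEvent_of_next h, pathEvent_of_next fun i => (h i).symm⟩

/-- On a given path the record condition is deterministic, so the locality of `recPath` reduces to
that of `pathEvent`. -/
lemma recPath_eq (k : ℕ) (x : Σ n : ℕ, Fin (n + 1) → ℤ × ℤ) :
    recPath P k x = pathEvent P x.2 ∩ {_c | (1 - P.v) * k ≤ lev P.v (x.2 (Fin.last _)) ∧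
      ∀ i : Fin x.1, lev P.v (x.2 i.castSucc) < (1 - P.v) * k} := by
  ext c
  refine and_congr_right fun h => ?_
  have h1 := h (Fin.last _)
  rw [Fin.val_last] at h1
  refine and_congr (by rw [h1]) ⟨fun h' i => ?_, fun h' m hm => ?_⟩
  · rw [← h i.castSucc]
    exact h' i i.2
  · have := h' ⟨m, hm⟩
    rwa [← h (Fin.castSucc ⟨m, hm⟩)] at this

lemma mem_backCone_of_recPath (hv0 : 0 ≤ P.v) {k : ℕ} {x : Σ n : ℕ, Fin (n + 1) → ℤ × ℤ} {c : Cfg}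
    (h : c ∈ recPath P k x) (i : Fin x.1) :
    x.2 i.castSucc ∈ backCone P.v (x.2 (Fin.last _)) := by
  have h1 := h.1 (Fin.last _)
  rw [Fin.val_last] at h1
  rw [← h.1 i.castSucc, ← h1]
  exact rec_mem_backCone hv0 h.2 i.2

lemma recPath_restr_iff {k : ℕ} {x : Σ n : ℕ, Fin (n + 1) → ℤ × ℤ} {B : Set (ℤ → ℤ)}
    {D : Set (ℤ × ℤ)} (hD : ∀ i : Fin x.1, x.2 i.castSucc ∈ D)
    (hB : ∀ (i : Fin x.1) (w : ℤ → ℤ), w (x.2 i.castSucc).2 = (x.2 i.castSucc).1 → w ∈ B)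
    (c : Cfg) : c.restr B D ∈ recPath P k x ↔ c ∈ recPath P k x := by
  rw [recPath_eq]
  exact and_congr_left fun _ => pathEvent_restr_iff hD hB c

/-! ### Attempts at regeneration -/

/-- The trajectories that prevent the point `a + (l, l)` from being separated from the past of
`a`. -/
def linking (v : ℝ) (a : ℤ × ℤ) (l : ℕ) : Set (ℤ → ℤ) :=
  hits (backCone v a) ∩ hits (cone v (a + ((l : ℤ), (l : ℤ))))

lemma measurableSet_linking (v : ℝ) (a : ℤ × ℤ) (l : ℕ) : MeasurableSet (linking v a l) :=
  (measurableSet_hits _).inter (measurableSet_hits _)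

variable (P) in
/-- The record `k` is reached, and no trajectory links the past of its position with the cone
that is reached after `l` further steps to the right. -/
def freeRec (k l : ℕ) : Set Cfg :=
  {c | ∃ n, c.Rec P k n ∧ c.paths ∩ linking P.v (c.walk P 0 n) l = ∅}

lemma measurableSet_freeRec (k l : ℕ) : MeasurableSet (freeRec P k l) := by
  simp only [freeRec, ofPred_exists, ofPred_and]
  exact .iUnion fun n => (measurableSet_rec k n).inter (measurableSet_of_walk
    (p := fun c z => c.paths ∩ linking P.v z l = ∅)
    (fun z => measurableSet_void (measurableSet_linking _ _ _)) 0 n)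

lemma add_diag_mem_cone {v : ℝ} (hv : v ≤ 1) (a : ℤ × ℤ) (l : ℕ) :
    a + ((l : ℤ), (l : ℤ)) ∈ cone v a := by
  refine ⟨by simp, by simp, ?_⟩
  simp only [Prod.fst_add, Prod.snd_add, add_sub_cancel_left, Int.cast_natCast]
  have : (0 : ℝ) ≤ l := by positivity
  nlinarith

/-- Without links, every trajectory that meets the cone at `a + (l, l)` misses the back cone of `a`,
so discarding those that meet this back cone does not affect regeneration there. -/
lemma reg_of_fresh (hv1 : P.v ≤ 1) {c : Cfg} {a : ℤ × ℤ} {l : ℕ}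
    (h : c.paths ∩ linking P.v a l = ∅) {B : Set (ℤ → ℤ)} (hB : (hits (backCone P.v a))ᶜ = B) :
    (c.restr B (cone P.v a)).Reg P (a + ((l : ℤ), (l : ℤ))) ↔
      c.Reg P (a + ((l : ℤ), (l : ℤ))) := by
  subst hB
  set a' := a + ((l : ℤ), (l : ℤ)) with ha'
  rw [← reg_fut (self_mem_cone P.v a') (c.restr _ _), ← reg_fut (self_mem_cone P.v a') c]
  have : (c.restr (hits (backCone P.v a))ᶜ (cone P.v a)).fut P a' = c.fut P a' := by
    rw [Cfg.fut, restr_restr, Cfg.fut,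
      inter_eq_self_of_subset_left (cone_subset (add_diag_mem_cone hv1 a l)), Cfg.restr, Cfg.restr,
      ← inter_assoc]
    congr 1
    refine subset_antisymm (inter_subset_inter_left _ inter_subset_left) ?_
    rintro w ⟨hw, hwc⟩
    exact ⟨⟨hw, fun hwb => eq_empty_iff_forall_notMem.1 h w ⟨hw, hwb, hwc⟩⟩, hwc⟩
  rw [this]

/-- The forced marks lie strictly before time `a.2 + l`, hence are independent of the cone at `a +
(l, l)`. Discarding trajectories only helps there, because a link would itself be a crossing at that
point. -/
lemma measure_fresh_ge (hv1 : P.v ≤ 1) (a : ℤ × ℤ) (l : ℕ) :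
    diagProb P l * cfgLaw q ρ {c | c.Reg P 0} ≤
      cfgLaw q ρ (Cfg.restr (hits (backCone P.v a))ᶜ (cone P.v a) ⁻¹'
        ({c | c.Diag P a l} ∩ {c | c.Reg P (a + ((l : ℤ), (l : ℤ)))})) := by
  set a' := a + ((l : ℤ), (l : ℤ)) with ha'
  set fresh := Cfg.restr (hits (backCone P.v a))ᶜ (cone P.v a) with hfresh
  have hmem : a' ∈ cone P.v a := add_diag_mem_cone hv1 a l
  have hfm : Measurable fresh := measurable_restr (measurableSet_hits _).compl _
  have h1 : fresh ⁻¹' {c | c.Diag P a l} = {c | c.Diag P a l} := by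
    ext c
    refine forall₂_congr fun i _ => ?_
    have := add_diag_mem_cone hv1 a i
    simp [hfresh, Cfg.restr, this]
  have h2 : ∀ c : Cfg, c.restr univ (diagSites a l)ᶜ ∈ fresh ⁻¹' {c | c.Reg P a'} ↔
      c ∈ fresh ⁻¹' {c | c.Reg P a'} := by
    intro c
    simp only [mem_preimage, mem_ofPred_eq]
    rw [← reg_fut (self_mem_cone P.v a') (fresh _), ← reg_fut (self_mem_cone P.v a') (fresh c),
      hfresh, restr_restr, Cfg.fut, Cfg.fut, restr_restr, restr_restr, univ_inter]
    have h3 : cone P.v a' ∩ (cone P.v a ∩ (diagSites a l)ᶜ) = cone P.v a' ∩ cone P.v a := by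
      rw [← inter_assoc, inter_eq_left]
      rintro z ⟨⟨-, hz, -⟩, -⟩ ⟨i, hi, rfl⟩
      simp only [ha', Prod.snd_add] at hz
      omega
    rw [h3]
  have h4 : {c | c.Reg P a'} ⊆ fresh ⁻¹' {c | c.Reg P a'} := by
    intro c hc
    refine (reg_of_fresh hv1 ?_ rfl).2 hc
    rw [eq_empty_iff_forall_notMem]
    rintro w ⟨hw, hwb, hwc⟩
    exact eq_empty_iff_forall_notMem.1 hc.1 w ⟨hw, hwc, hits_mono (backCone_subset hmem) hwb⟩
  rw [preimage_inter, h1, measure_diag_inter q ρ a l (hfm (measurableSet_reg a')) h2,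
    ← measure_reg q ρ a']
  gcongr

lemma regAt_of_attempt (hv1 : P.v < 1) {c : Cfg} {k l n : ℕ} (hk : 1 ≤ k)
    (hrec : c.Rec P k n) (hl : c.paths ∩ linking P.v (c.walk P 0 n) l = ∅)
    (hf : c.restr (hits (backCone P.v (c.walk P 0 n)))ᶜ (cone P.v (c.walk P 0 n)) ∈
      {c' | c'.Diag P (c.walk P 0 n) l} ∩
        {c' | c'.Reg P (c.walk P 0 n + ((l : ℤ), (l : ℤ)))}) : c.RegAt P (n + l) := by
  have hd : c.Diag P (c.walk P 0 n) l := by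
    intro i hi
    have h1 := hf.1 i hi
    have h2 := add_diag_mem_cone hv1.le (c.walk P 0 n) i
    simpa [Cfg.restr, h2] using h1
  refine ⟨⟨k + l, by omega, rec_add_of_diag hv1 hk hrec hd⟩, ?_⟩
  rw [walk_add, walk_of_diag hd l le_rfl]
  exact (reg_of_fresh hv1.le hl rfl).1 hf.2

/-- After a record that is free of linking trajectories, the regeneration event occurs with a
probability bounded from below, whatever happened before. -/
lemma measure_attempt_ge (hv0 : 0 ≤ P.v) (hv1 : P.v < 1) {k l : ℕ} (hk : 1 ≤ k) {G : Set Cfg}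
    (hGm : MeasurableSet G)
    (hG : ∀ (c : Cfg) (n : ℕ), c.Rec P k n →
      (c.restr (hits (backCone P.v (c.walk P 0 n))) (backCone P.v (c.walk P 0 n)) ∈ G ↔ c ∈ G)) :
    diagProb P l * cfgLaw q ρ {c | c.Reg P 0} * cfgLaw q ρ (G ∩ freeRec P k l) ≤
      cfgLaw q ρ (G ∩ {c | ∃ n, c.RegAt P n}) := by
  have hex : MeasurableSet {c : Cfg | ∃ n, c.RegAt P n} := by
    rw [ofPred_exists]
    exact .iUnion measurableSet_regAt
  set κ := diagProb P l * cfgLaw q ρ {c | c.Reg P 0} with hκ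
  have hcover : ∀ c ∈ freeRec P k l, c ∈ ⋃ x, recPath P k x := fun c ⟨n, hn, _⟩ =>
    mem_iUnion.2 ⟨_, mem_recPath hn⟩
  have hsum : cfgLaw q ρ (G ∩ freeRec P k l) =
      ∑' x, cfgLaw q ρ (G ∩ freeRec P k l ∩ recPath P k x) := by
    have hm := hGm.inter (measurableSet_freeRec (P := P) k l)
    rw [← measure_iUnion (fun i j hij => ((disjoint_recPath k) hij).mono inter_subset_right
      inter_subset_right) fun x => hm.inter (measurableSet_recPath k x), ← inter_iUnion]
    congr 1
    exact (inter_eq_self_of_subset_left fun c hc => hcover c hc.2).symm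
  have hle : ∑' x, cfgLaw q ρ (G ∩ {c | ∃ n, c.RegAt P n} ∩ recPath P k x) ≤
      cfgLaw q ρ (G ∩ {c | ∃ n, c.RegAt P n}) := by
    refine (tsum_meas_le_meas_iUnion_of_disjoint _
      (fun x => (hGm.inter hex).inter (measurableSet_recPath k x)) fun i j hij =>
        ((disjoint_recPath k) hij).mono inter_subset_right inter_subset_right).trans
      (measure_mono (iUnion_subset fun x => inter_subset_left))
  rw [hsum, ← ENNReal.tsum_mul_left]
  refine (ENNReal.tsum_le_tsum fun x => ?_).trans hle
  set a := x.2 (Fin.last _) with ha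
  set S : Set Cfg := G ∩ freeRec P k l ∩ recPath P k x with hS
  have hSm : MeasurableSet S :=
    (hGm.inter (measurableSet_freeRec k l)).inter (measurableSet_recPath k x)
  rcases S.eq_empty_or_nonempty with hemp | ⟨c₀, hc₀⟩
  · simp [hemp]
  -- One configuration suffices: that the path lies in the back cone of its end is a property of the
  -- path alone.
  have hback := mem_backCone_of_recPath hv0 hc₀.2
  have hwalk : ∀ c ∈ recPath P k x, c.walk P 0 x.1 = a := fun c hc => by
    simpa using hc.1 (Fin.last _)
  have hfree : ∀ c ∈ recPath P k x, c ∈ freeRec P k l ↔ c.paths ∩ linking P.v a l = ∅ := by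
    intro c hc
    constructor
    · rintro ⟨n, hn, h⟩
      obtain rfl := rec_unique hn hc.2
      rwa [hwalk c hc] at h
    · intro h
      exact ⟨x.1, hc.2, by rwa [hwalk c hc]⟩
  set pst := Cfg.restr (hits (backCone P.v a)) (backCone P.v a) with hpst
  set fresh := Cfg.restr (hits (backCone P.v a))ᶜ (cone P.v a) with hfresh
  -- The history `S`, absence of links included, is read in the back cone of `a` and the
  -- trajectories that meet it; `fresh` uses the complementary trajectories and the sites of the
  -- forward cone.
  have hpS : pst ⁻¹' S = S := by
    ext c
    change (pst c ∈ G ∩ freeRec P k l ∧ pst c ∈ recPath P k x) ↔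
      (c ∈ G ∩ freeRec P k l ∧ c ∈ recPath P k x)
    rw [recPath_restr_iff hback fun i w hw => mem_hits_of_eq (hback i) hw]
    refine and_congr_left fun hc => ?_
    have hc' : pst c ∈ recPath P k x :=
      (recPath_restr_iff hback (fun i w hw => mem_hits_of_eq (hback i) hw) c).2 hc
    refine and_congr ?_ ?_
    · have := hG c x.1 hc.2
      rwa [hwalk c hc] at this
    · rw [hfree _ hc', hfree _ hc]
      have : (pst c).paths ∩ linking P.v a l = c.paths ∩ linking P.v a l := by
        rw [hpst, Cfg.restr, inter_assoc, linking, ← inter_assoc (hits _), inter_self]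
      rw [this]
  have hind : IndepFun pst fresh (cfgLaw q ρ) :=
    indepFun_restr q ρ (measurableSet_hits _) (measurableSet_hits _).compl disjoint_compl_right
      (disjoint_cone_backCone _ _).symm
  have hprod := hind.measure_inter_preimage_eq_mul S
    ({c | c.Diag P a l} ∩ {c | c.Reg P (a + ((l : ℤ), (l : ℤ)))}) hSm
    ((measurableSet_diag a l).inter (measurableSet_reg _))
  rw [hpS] at hprod
  have hsub : S ∩ fresh ⁻¹' ({c | c.Diag P a l} ∩ {c | c.Reg P (a + ((l : ℤ), (l : ℤ)))}) ⊆
      G ∩ {c | ∃ n, c.RegAt P n} ∩ recPath P k x := by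
    rintro c ⟨⟨⟨hcG, hcf⟩, hcr⟩, hcfr⟩
    refine ⟨⟨hcG, x.1 + l, regAt_of_attempt hv1 hk hcr.2 ?_ ?_⟩, hcr⟩
    · rw [hwalk c hcr]
      exact (hfree c hcr).1 hcf
    · rw [hwalk c hcr]
      exact hcfr
  calc κ * cfgLaw q ρ S = cfgLaw q ρ S * κ := mul_comm _ _
    _ ≤ cfgLaw q ρ S * _ := by gcongr; exact measure_fresh_ge hv1.le a l
    _ = _ := hprod.symm
    _ ≤ _ := measure_mono hsub

end RWDRE

namespace RWDRE

open Filter Topology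

variable {P : Params} {q : Ioo (0 : ℝ) 1} {ρ : ℝ≥0}

/-! ### Many records are free of linking trajectories -/

/-- If `S` reads only trajectories in `T`, those in `A` are independent of it, and `A` is occupied
with probability at most its intensity. -/
lemma measure_inter_occupied_le {T A : Set (ℤ → ℤ)} (hT : MeasurableSet T) (hA : MeasurableSet A)
    (hAT : Disjoint A T) {S : Set Cfg} (hSm : MeasurableSet S)
    (hS : ∀ c : Cfg, c.restr T univ ∈ S ↔ c ∈ S) :
    cfgLaw q ρ (S ∩ {c | (c.paths ∩ A).Nonempty}) ≤ intensity q ρ A * cfgLaw q ρ S := by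
  have hvoid : MeasurableSet {c : Cfg | c.paths ∩ A = ∅} := measurableSet_void hA
  have hocc : {c : Cfg | (c.paths ∩ A).Nonempty} = {c : Cfg | c.paths ∩ A = ∅}ᶜ := by
    ext c
    simp [nonempty_iff_ne_empty]
  have hind : IndepFun (Cfg.restr T univ) (Cfg.restr Tᶜ ∅) (cfgLaw q ρ) :=
    indepFun_restr q ρ hT hT.compl disjoint_compl_right (disjoint_empty _)
  have h1 := hind.measure_inter_preimage_eq_mul S {c : Cfg | c.paths ∩ A = ∅}ᶜ hSm hvoid.compl
  have h2 : Cfg.restr T univ ⁻¹' S = S := by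
    ext c
    exact hS c
  have h3 : Cfg.restr Tᶜ ∅ ⁻¹' {c : Cfg | c.paths ∩ A = ∅}ᶜ = {c : Cfg | c.paths ∩ A = ∅}ᶜ := by
    ext c
    simp only [preimage_compl, mem_compl_iff, mem_preimage, mem_ofPred_eq, Cfg.restr, inter_assoc,
      inter_eq_self_of_subset_right hAT.subset_compl_right]
  rw [h2, h3] at h1
  have h4 : cfgLaw q ρ {c : Cfg | c.paths ∩ A = ∅}ᶜ ≤ intensity q ρ A := by
    have h5 : cfgLaw q ρ {c : Cfg | c.paths ∩ A = ∅} = voidExp (intensity q ρ A) := by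
      have := cfgLaw_basicEvent q ρ hA MeasurableSet.univ
      simpa [basicEvent] using this
    rw [prob_compl_eq_one_sub hvoid, h5, tsub_le_iff_left]
    exact one_le_voidExp_add _
  rw [hocc, h1, mul_comm]
  gcongr

/-- The points of the path `p` before its end. -/
def before {n : ℕ} (p : Fin (n + 1) → ℤ × ℤ) : Set (ℤ × ℤ) := range fun i : Fin n => p i.castSucc

lemma mem_before {n : ℕ} (p : Fin (n + 1) → ℤ × ℤ) (i : Fin n) : p i.castSucc ∈ before p := ⟨i, rfl⟩

variable (P) in
/-- The points visited by the walk before time `n`. -/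
def Cfg.visited (c : Cfg) (n : ℕ) : Set (ℤ × ℤ) := {z | ∃ i < n, z = c.walk P 0 i}

lemma visited_eq {c : Cfg} {n : ℕ} {p : Fin (n + 1) → ℤ × ℤ} (h : c ∈ pathEvent P p) :
    c.visited P n = before p := by
  ext z
  constructor
  · rintro ⟨i, hi, rfl⟩
    exact ⟨⟨i, hi⟩, (h (Fin.castSucc ⟨i, hi⟩)).symm⟩
  · rintro ⟨i, rfl⟩
    exact ⟨i, i.2, (h i.castSucc).symm⟩

variable (P) in
/-- The record `k` is linked to the future by a trajectory that the walk has not met. -/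
def unmetLink (k l : ℕ) : Set Cfg :=
  {c | ∃ t, c.Rec P k t ∧
    (c.paths ∩ (linking P.v (c.walk P 0 t) l \ hits (c.visited P t))).Nonempty}

lemma intensity_linking (a : ℤ × ℤ) (l : ℕ) :
    intensity q ρ (linking P.v a l) = intensity q ρ (linking P.v 0 l) := by
  have h : linking P.v a l = translate a ⁻¹' linking P.v 0 l := by
    ext w
    simp only [linking, mem_inter_iff, mem_preimage, translate_mem_hits_cone,
      translate_mem_hits_backCone, zero_add, add_comm a]
  rw [h, (measurePreserving_translate q ρ a).measure_preimage
    (measurableSet_linking _ _ _).nullMeasurableSet]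

/-- Given the path up to the record, the trajectories that it has not met are still Poisson and
independent of it. -/
lemma measure_unmetLink_le (k l : ℕ) :
    cfgLaw q ρ (unmetLink P k l) ≤ intensity q ρ (linking P.v 0 l) := by
  have := measure_le_of_disjoint (μ := cfgLaw q ρ) (measurableSet_recPath (P := P) k)
    (disjoint_recPath k) (E := unmetLink P k l) (E' := univ)
    (fun c ⟨t, ht, _⟩ => mem_iUnion.2 ⟨_, mem_recPath ht⟩) MeasurableSet.univ
    (intensity q ρ (linking P.v 0 l)) fun x => ?_
  · simpa using this
  have hmeas := measurableSet_linking P.v (x.2 (Fin.last _)) l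
  rw [univ_inter]
  calc cfgLaw q ρ (unmetLink P k l ∩ recPath P k x)
      ≤ cfgLaw q ρ (recPath P k x ∩
          {c | (c.paths ∩ (linking P.v (x.2 (Fin.last _)) l \ hits (before x.2))).Nonempty}) := by
        refine measure_mono ?_
        rintro c ⟨⟨t, ht, hne⟩, hc⟩
        obtain rfl := rec_unique ht hc.2
        have hw : c.walk P 0 x.1 = x.2 (Fin.last _) := hc.1 (Fin.last _)
        rw [visited_eq hc.1, hw] at hne
        exact ⟨hc, hne⟩
    _ ≤ intensity q ρ (linking P.v (x.2 (Fin.last _)) l \ hits (before x.2)) *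
          cfgLaw q ρ (recPath P k x) :=
        measure_inter_occupied_le (measurableSet_hits _) (hmeas.diff (measurableSet_hits _))
          disjoint_sdiff_left (measurableSet_recPath k x)
          (recPath_restr_iff (fun _ => mem_univ _) fun i w hw =>
            mem_hits_of_eq (mem_before x.2 i) hw)
    _ ≤ _ := by
        rw [← intensity_linking (x.2 (Fin.last _)) l]
        gcongr
        exact sdiff_subset

variable (P) in
/-- At time `m`, below the record `k`, the walk meets a new trajectory that exceeds later the
level `(1 - v) (k + l)`. -/
def metLink (k l m : ℕ) : Set Cfg :=
  {c | lev P.v (c.walk P 0 m) < (1 - P.v) * k ∧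
    (c.paths ∩ (exceeds P.v (c.walk P 0 m) ((1 - P.v) * (k + l) - lev P.v (c.walk P 0 m)) \
      hits (c.visited P m))).Nonempty}

lemma measure_metLink_inter_le (hv : 0 < P.v) (k l m : ℕ) (p : Fin (m + 1) → ℤ × ℤ) :
    cfgLaw q ρ (metLink P k l m ∩ pathEvent P p) ≤
      (if lev P.v (p (Fin.last _)) < (1 - P.v) * k then
        ENNReal.ofReal (ρ * devConst P.v *
          Real.exp (-(P.v * ((1 - P.v) * (k + l) - lev P.v (p (Fin.last _)))))) else 0) *
        cfgLaw q ρ (pathEvent P p) := by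
  have hw : ∀ c ∈ pathEvent P p, c.walk P 0 m = p (Fin.last _) := fun c hc => hc (Fin.last _)
  split_ifs with h
  · set A := exceeds P.v (p (Fin.last _)) ((1 - P.v) * (k + l) - lev P.v (p (Fin.last _)))
    have hA : MeasurableSet A := measurableSet_exceeds _ _ _
    calc cfgLaw q ρ (metLink P k l m ∩ pathEvent P p)
        ≤ cfgLaw q ρ (pathEvent P p ∩ {c | (c.paths ∩ (A \ hits (before p))).Nonempty}) := by
          refine measure_mono ?_
          rintro c ⟨⟨-, hne⟩, hc⟩
          rw [visited_eq hc, hw c hc] at hne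
          exact ⟨hc, hne⟩
      _ ≤ intensity q ρ (A \ hits (before p)) * cfgLaw q ρ (pathEvent P p) :=
          measure_inter_occupied_le (measurableSet_hits _) (hA.diff (measurableSet_hits _))
            disjoint_sdiff_left (measurableSet_pathEvent p)
            (pathEvent_restr_iff (fun _ => mem_univ _) fun i w hw =>
              mem_hits_of_eq (mem_before p i) hw)
      _ ≤ _ := by
          gcongr
          exact (measure_mono sdiff_subset).trans (intensity_exceeds_le q ρ hv _ _)
  · have : metLink P k l m ∩ pathEvent P p = ∅ := by
      rw [eq_empty_iff_forall_notMem]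
      rintro c ⟨⟨hc, -⟩, hp⟩
      rw [hw c hp] at hc
      exact h hc
    simp [this]

/-- A geometric series that starts at the first index with `x < δ * k`; the bound is uniform in `x`
and `F`. -/
lemma sum_exp_le {v δ : ℝ} (hv : 0 < v) (hδ : 0 < δ) (x : ℝ) (F : Finset ℕ) :
    ∑ k ∈ F, (if x < δ * k then Real.exp (-(v * (δ * k - x))) else 0) ≤
      (1 - Real.exp (-(v * δ)))⁻¹ := by
  have hr1 : Real.exp (-(v * δ)) < 1 := Real.exp_lt_one_iff.mpr (by nlinarith)
  have hr0 := (Real.exp_pos (-(v * δ))).le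
  rw [← Finset.sum_filter]
  set F' := F.filter fun k : ℕ => x < δ * k with hF'
  rcases F'.eq_empty_or_nonempty with he | hne
  · rw [he, Finset.sum_empty]
    exact inv_nonneg.2 (by linarith)
  set k₀ := F'.min' hne
  have hk₀ : x < δ * k₀ := (Finset.mem_filter.1 (F'.min'_mem hne)).2
  have hle : ∀ k ∈ F', k₀ ≤ k := fun k hk => F'.min'_le k hk
  calc ∑ k ∈ F', Real.exp (-(v * (δ * k - x)))
      ≤ ∑ k ∈ F', Real.exp (-(v * δ)) ^ (k - k₀) := by
        refine Finset.sum_le_sum fun k hk => ?_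
        rw [← Real.exp_nat_mul, Real.exp_le_exp, Nat.cast_sub (hle k hk)]
        nlinarith
    _ = ∑ j ∈ F'.image (· - k₀), Real.exp (-(v * δ)) ^ j := by
        rw [Finset.sum_image]
        intro a ha b hb hab
        have h1 := hle a ha
        have h2 := hle b hb
        simp only at hab
        omega
    _ ≤ ∑' j, Real.exp (-(v * δ)) ^ j :=
        (summable_geometric_of_lt_one hr0 hr1).sum_le_tsum _ fun _ _ => pow_nonneg hr0 _
    _ = _ := tsum_geometric_of_lt_one hr0 hr1

/-- The bound on the sum over the records `k` of the probabilities of `metLink k l m`. -/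
noncomputable def metConst (v : ℝ) (ρ : ℝ≥0) (l : ℕ) : ℝ :=
  ρ * devConst v * Real.exp (-(v * (1 - v) * l)) * (1 - Real.exp (-(v * (1 - v))))⁻¹

/-- A trajectory met at level `x` reaches beyond record `k` with probability exponentially small in
`(1 - v) k - x`. The sum over `k` is thus bounded whatever the number of records, which is what
makes the averaging work. -/
lemma sum_measure_metLink_le (hv : 0 < P.v) (hv1 : P.v < 1) (l m : ℕ) (F : Finset ℕ) :
    ∑ k ∈ F, cfgLaw q ρ (metLink P k l m) ≤ ENNReal.ofReal (metConst P.v ρ l) := by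
  set C : ℝ := ρ * devConst P.v * Real.exp (-(P.v * (1 - P.v) * l)) with hC
  have hC0 : 0 ≤ C := mul_nonneg (mul_nonneg ρ.2 (devConst_nonneg _)) (Real.exp_pos _).le
  have h1 : ∀ k ∈ F, cfgLaw q ρ (metLink P k l m) ≤
      ∑' p : Fin (m + 1) → ℤ × ℤ, cfgLaw q ρ (metLink P k l m ∩ pathEvent P p) := by
    intro k _
    have : metLink P k l m = ⋃ p : Fin (m + 1) → ℤ × ℤ, metLink P k l m ∩ pathEvent P p := by
      rw [← inter_iUnion, iUnion_pathEvent, inter_univ]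
    conv_lhs => rw [this]
    exact measure_iUnion_le _
  refine (Finset.sum_le_sum h1).trans ?_
  rw [← Summable.tsum_finsetSum fun _ _ => ENNReal.summable]
  have h2 : ∀ p : Fin (m + 1) → ℤ × ℤ, ∑ k ∈ F, cfgLaw q ρ (metLink P k l m ∩ pathEvent P p) ≤
      ENNReal.ofReal (metConst P.v ρ l) * cfgLaw q ρ (pathEvent P p) := by
    intro p
    refine (Finset.sum_le_sum fun k _ => measure_metLink_inter_le hv k l m p).trans ?_
    rw [← Finset.sum_mul]
    gcongr
    set x := lev P.v (p (Fin.last _))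
    have h3 : ∀ k : ℕ, (if x < (1 - P.v) * k then ENNReal.ofReal (ρ * devConst P.v *
          Real.exp (-(P.v * ((1 - P.v) * (k + l) - x)))) else 0) =
        ENNReal.ofReal (C * if x < (1 - P.v) * k then
          Real.exp (-(P.v * ((1 - P.v) * k - x))) else 0) := by
      intro k
      split_ifs
      · rw [hC, mul_assoc _ (Real.exp _), ← Real.exp_add]
        congr 3
        ring
      · simp
    rw [Finset.sum_congr rfl fun k _ => h3 k, ← ENNReal.ofReal_sum_of_nonneg, ← Finset.mul_sum]
    · exact ENNReal.ofReal_le_ofReal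
        (mul_le_mul_of_nonneg_left (sum_exp_le hv (by linarith) x F) hC0)
    · intro k _
      refine mul_nonneg hC0 ?_
      split_ifs
      · exact (Real.exp_pos _).le
      · exact le_rfl
  refine (ENNReal.tsum_le_tsum h2).trans ?_
  rw [ENNReal.tsum_mul_left]
  have h4 : ∑' p : Fin (m + 1) → ℤ × ℤ, cfgLaw q ρ (pathEvent P p) = 1 := by
    rw [← measure_iUnion disjoint_pathEvent measurableSet_pathEvent, iUnion_pathEvent, measure_univ]
  rw [h4, mul_one]

lemma compl_freeRec_subset (k l n : ℕ) :
    (freeRec P k l)ᶜ ⊆ {c | lev P.v (c.walk P 0 n) < (1 - P.v) * k} ∪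
      (unmetLink P k l ∪ ⋃ m ∈ Finset.range n, metLink P k l m) := by
  classical
  intro c hc
  by_cases h : lev P.v (c.walk P 0 n) < (1 - P.v) * k
  · exact Or.inl h
  obtain ⟨t, htn, ht⟩ := exists_rec (not_lt.1 h)
  have hlink : (c.paths ∩ linking P.v (c.walk P 0 t) l).Nonempty := by
    rw [nonempty_iff_ne_empty]
    exact fun he => hc ⟨t, ht, he⟩
  obtain ⟨w, hw, hwl⟩ := hlink
  by_cases hmet : w ∈ hits (c.visited P t)
  · have hex : ∃ m < t, w (c.walk P 0 m).2 = (c.walk P 0 m).1 := by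
      obtain ⟨s, m, hm, hs⟩ := hmet
      refine ⟨m, hm, ?_⟩
      rw [← hs]
    -- The first meeting, so that the trajectory is new at time `m`.
    set m := Nat.find hex
    obtain ⟨hmt, hm⟩ := Nat.find_spec hex
    -- A link reaches the cone `l` diagonal steps beyond the record, so its level there is at least
    -- `(1 - v) (k + l)`; the walk at time `m` is still below record `k`.
    have hlt := ht.2 m hmt
    refine Or.inr (Or.inr (mem_iUnion₂.2 ⟨m, Finset.mem_range.2 (by omega), hlt, w, hw, ⟨hm, ?_⟩, ?_⟩))
    · obtain ⟨s, -, hs2, hs3⟩ := hwl.2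
      simp only [Prod.fst_add, Prod.snd_add, walk_snd, Prod.snd_zero, zero_add] at hs2 hs3
      refine ⟨(s - m).toNat, ?_⟩
      have hsm : (c.walk P 0 m).2 + ((s - m).toNat : ℤ) = s := by
        rw [walk_snd, Prod.snd_zero, Int.toNat_of_nonneg (by omega)]
        ring
      rw [hsm]
      have h1 := ht.1
      simp only [lev, walk_snd, Prod.snd_zero, zero_add] at h1 ⊢
      push_cast at hs3 h1 ⊢
      linarith
    · rintro ⟨s, i, hi, hs⟩
      refine Nat.find_min hex hi ⟨hi.trans hmt, ?_⟩
      rw [← hs]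
  · exact Or.inr (Or.inl ⟨t, ht, w, hw, hwl, hmet⟩)

/-- Arbitrarily far records are free of linking trajectories with a probability close to one. -/
lemma exists_measure_compl_freeRec_le (hv : 0 < P.v) (hv1 : P.v < 1)
    (hslow : Tendsto (fun L : ℕ => cfgLaw q ρ {c | c.Slow P L}) atTop (𝓝 0)) {ε : ℝ≥0∞}
    (hε : 0 < ε) :
    ∃ l : ℕ, ∀ K₀ : ℕ, ∃ k > K₀, cfgLaw q ρ (freeRec P k l)ᶜ ≤ ε := by
  -- A walk that is not slow with parameter `K` has level at least `2 v C K - K ≥ 3 K` at time `C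
  -- K`, so it has passed all the records up to `2 K`.
  obtain ⟨C, hC⟩ : ∃ C : ℕ, 2 ≤ P.v * C := by
    obtain ⟨C, hC⟩ := exists_nat_ge (2 / P.v)
    exact ⟨C, by rwa [div_le_iff₀' hv] at hC⟩
  have hexp : ∀ {a : ℝ}, 0 < a → Tendsto (fun l : ℕ => Real.exp (-(a * l))) atTop (𝓝 0) := by
    intro a ha
    refine Real.tendsto_exp_atBot.comp (tendsto_neg_atTop_atBot.comp ?_)
    exact tendsto_natCast_atTop_atTop.const_mul_atTop ha
  have hδ : 0 < P.v * (1 - P.v) := mul_pos hv (by linarith)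
  have h1 : Tendsto (fun l : ℕ => ENNReal.ofReal (crossConst P.v ρ *
      Real.exp (-(P.v / 3 * (1 - P.v) * l)))) atTop (𝓝 0) := by
    have := (hexp (a := P.v / 3 * (1 - P.v)) (by linarith)).const_mul (crossConst P.v ρ)
    simpa using ENNReal.tendsto_ofReal this
  have h2 : Tendsto (fun l : ℕ => C * ENNReal.ofReal (metConst P.v ρ l)) atTop (𝓝 0) := by
    have h3 : Tendsto (fun l : ℕ => metConst P.v ρ l) atTop (𝓝 0) := by
      have := ((hexp hδ).const_mul (ρ * devConst P.v)).mul_const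
        (1 - Real.exp (-(P.v * (1 - P.v))))⁻¹
      simpa [metConst] using this
    have := ENNReal.Tendsto.const_mul (ENNReal.tendsto_ofReal h3)
      (Or.inr (ENNReal.natCast_ne_top C))
    simpa using this
  have hε2 : 0 < ε / 2 := ENNReal.half_pos hε.ne'
  have h12 := h1.add h2
  rw [add_zero] at h12
  -- There are `C K` times for `K` records, so the averaged cost of met links is `C * metConst`; it
  -- does not depend on `K`, and `l` can be fixed first.
  obtain ⟨l, hl⟩ := (h12.eventually (gt_mem_nhds hε2)).exists
  refine ⟨l, fun K₀ => ?_⟩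
  obtain ⟨K, hK, hKK⟩ := ((hslow.eventually (gt_mem_nhds hε2)).and
    (eventually_gt_atTop K₀)).exists
  have hlink : intensity q ρ (linking P.v 0 l) ≤ ENNReal.ofReal (crossConst P.v ρ *
      Real.exp (-(P.v / 3 * (1 - P.v) * l))) := by
    have := intensity_cross_le q ρ hv hv1.le l
    rwa [linking, zero_add]
  have hsub : ∀ k ∈ Finset.Ioc K (2 * K), cfgLaw q ρ (freeRec P k l)ᶜ ≤
      cfgLaw q ρ {c | c.Slow P K} + (intensity q ρ (linking P.v 0 l) +
        ∑ m ∈ Finset.range (C * K), cfgLaw q ρ (metLink P k l m)) := by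
    intro k hk
    refine (measure_mono (compl_freeRec_subset k l (C * K))).trans
      ((measure_union_le _ _).trans (add_le_add (measure_mono fun c hc => ?_)
        ((measure_union_le _ _).trans (add_le_add (measure_unmetLink_le k l)
          (measure_biUnion_finset_le _ _)))))
    refine ⟨C * K, ?_⟩
    have hk2 : (k : ℝ) ≤ 2 * K := by exact_mod_cast (Finset.mem_Ioc.1 hk).2
    have hk0 : (0 : ℝ) ≤ k := by positivity
    have hK0 : (0 : ℝ) ≤ K := by positivity
    have hc' : lev P.v (c.walk P 0 (C * K)) < (1 - P.v) * k := hc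
    simp only [lev, walk_snd, Prod.snd_zero, zero_add] at hc'
    push_cast at hc' ⊢
    nlinarith [mul_le_mul_of_nonneg_right hC hK0]
  have hsum : ∑ k ∈ Finset.Ioc K (2 * K), cfgLaw q ρ (freeRec P k l)ᶜ ≤
      ∑ k ∈ Finset.Ioc K (2 * K), ε := by
    refine (Finset.sum_le_sum hsub).trans ?_
    rw [Finset.sum_add_distrib, Finset.sum_add_distrib, Finset.sum_comm]
    have h4 : ∑ m ∈ Finset.range (C * K), ∑ k ∈ Finset.Ioc K (2 * K),
        cfgLaw q ρ (metLink P k l m) ≤ (C * K : ℕ) * ENNReal.ofReal (metConst P.v ρ l) := by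
      refine (Finset.sum_le_sum fun m _ => sum_measure_metLink_le hv hv1 l m _).trans ?_
      simp
    have hcard : (Finset.Ioc K (2 * K)).card = K := by simp; omega
    simp only [Finset.sum_const, hcard, nsmul_eq_mul]
    calc _ ≤ (K : ℝ≥0∞) * (ε / 2) + (K * ENNReal.ofReal (crossConst P.v ρ *
          Real.exp (-(P.v / 3 * (1 - P.v) * l))) +
            (C * K : ℕ) * ENNReal.ofReal (metConst P.v ρ l)) := by gcongr
      _ = (K : ℝ≥0∞) * (ε / 2 + (ENNReal.ofReal (crossConst P.v ρ *
          Real.exp (-(P.v / 3 * (1 - P.v) * l))) +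
            C * ENNReal.ofReal (metConst P.v ρ l))) := by
          push_cast
          ring
      _ ≤ K * (ε / 2 + ε / 2) := by gcongr
      _ = K * ε := by rw [ENNReal.add_halves]
  -- Some record in the window does no worse than the average.
  obtain ⟨k, hk, hkε⟩ := ENNReal.exists_le_of_sum_le ⟨2 * K, Finset.mem_Ioc.2 ⟨by omega, le_rfl⟩⟩ hsum
  exact ⟨k, hKK.trans (Finset.mem_Ioc.1 hk).1, hkε⟩

end RWDRE

namespace RWDRE

open Filter Topology

variable {P : Params} {q : Ioo (0 : ℝ) 1} {ρ : ℝ≥0}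

/-! ### Local events -/

/-- The space-time box of radius `M`. -/
def box (M : ℕ) : Set (ℤ × ℤ) := {z | |z.1| ≤ M ∧ |z.2| ≤ M}

lemma box_mono {M M' : ℕ} (h : M ≤ M') : box M ⊆ box M' := fun z hz =>
  ⟨hz.1.trans (by exact_mod_cast h), hz.2.trans (by exact_mod_cast h)⟩

lemma exists_mem_box (z : ℤ × ℤ) : ∃ M, z ∈ box M :=
  ⟨max z.1.natAbs z.2.natAbs, by simp [box]⟩

/-- The σ-algebra of the events that depend only on what happens in the box of radius `M`. -/
@[reducible] noncomputable def localSigma (M : ℕ) : MeasurableSpace Cfg :=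
  MeasurableSpace.comap (Cfg.restr (hits (box M)) (box M)) inferInstance

lemma localSigma_le (M : ℕ) : localSigma M ≤ (inferInstance : MeasurableSpace Cfg) :=
  (measurable_restr (measurableSet_hits _) _).comap_le

lemma restr_mem_iff {M : ℕ} {t : Set Cfg} (ht : MeasurableSet[localSigma M] t) {B : Set (ℤ → ℤ)}
    {D : Set (ℤ × ℤ)} (hB : hits (box M) ⊆ B) (hD : box M ⊆ D) (c : Cfg) :
    c.restr B D ∈ t ↔ c ∈ t := by
  obtain ⟨t', -, rfl⟩ := ht
  rw [mem_preimage, mem_preimage, restr_restr, inter_eq_self_of_subset_right hB,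
    inter_eq_self_of_subset_left hD]

lemma localSigma_mono {M M' : ℕ} (h : M ≤ M') : localSigma M ≤ localSigma M' := by
  rintro t ⟨t', ht', rfl⟩
  refine ⟨Cfg.restr (hits (box M)) (box M) ⁻¹' t',
    measurable_restr (measurableSet_hits _) _ ht', ?_⟩
  ext c
  exact restr_mem_iff ⟨t', ht', rfl⟩ (hits_mono (box_mono h)) (box_mono h) c

/-- Every trajectory meets some box, at time `0` for instance, so a void event is the intersection
of its local versions. -/
lemma iSup_localSigma : (inferInstance : MeasurableSpace Cfg) = ⨆ M, localSigma M := by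
  refine le_antisymm (MeasurableSpace.generateFrom_le ?_) (iSup_le localSigma_le)
  rintro _ ⟨A, B, hA, hB, rfl⟩
  have h1 : basicEvent A B =
      (⋂ M, Cfg.restr (hits (box M)) (box M) ⁻¹' {c | c.paths ∩ A = ∅}) ∩ Cfg.mark ⁻¹' B := by
    ext c
    refine and_congr_left fun _ => ?_
    simp only [mem_iInter, mem_preimage, mem_ofPred_eq, Cfg.restr, eq_empty_iff_forall_notMem,
      mem_inter_iff, not_and]
    refine ⟨fun h M w hw => h w hw.1, fun h w hw => ?_⟩
    obtain ⟨M, hM⟩ := exists_mem_box (w 0, 0)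
    exact h M w ⟨hw, 0, hM⟩
  have h2 : Measurable[⨆ M, localSigma M] Cfg.mark := by
    rw [@measurable_pi_iff]
    intro z
    obtain ⟨M, hM⟩ := exists_mem_box z
    have h3 : Measurable[localSigma M] fun c : Cfg => c.mark z := by
      have h4 : (fun c : Cfg => c.mark z) =
          (fun c : Cfg => c.mark z) ∘ Cfg.restr (hits (box M)) (box M) := by
        funext c
        simp [Cfg.restr, hM]
      rw [h4]
      exact ((measurable_pi_apply z).comp measurable_mark).comp (comap_measurable _)
    exact h3.mono (le_iSup localSigma M) le_rfl
  rw [h1]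
  refine MeasurableSet.inter (MeasurableSet.iInter fun M => ?_) (h2 hB)
  exact le_iSup localSigma M _ ⟨_, measurableSet_void hA, rfl⟩

/-- The local σ-algebras increase, so their union is an algebra; it generates everything and is
therefore dense in measure. -/
lemma exists_local_approx {C : Set Cfg} (hC : MeasurableSet C) {η : ℝ} (hη : 0 < η) :
    ∃ M, ∃ t, MeasurableSet[localSigma M] t ∧
      cfgLaw q ρ (symmDiff C t) < ENNReal.ofReal η := by
  have halg : IsSetAlgebra (⋃ M, {t | MeasurableSet[localSigma M] t}) := by
    refine ⟨mem_iUnion.2 ⟨0, @MeasurableSet.empty _ (localSigma 0)⟩, ?_, ?_⟩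
    · intro t ht
      obtain ⟨M, hM⟩ := mem_iUnion.1 ht
      exact mem_iUnion.2 ⟨M, @MeasurableSet.compl _ _ (localSigma M) hM⟩
    · intro s t hs ht
      obtain ⟨M, hM⟩ := mem_iUnion.1 hs
      obtain ⟨N, hN⟩ := mem_iUnion.1 ht
      exact mem_iUnion.2 ⟨max M N, @MeasurableSet.union _ (localSigma (max M N)) _ _
        (localSigma_mono (le_max_left _ _) _ hM) (localSigma_mono (le_max_right _ _) _ hN)⟩
  have hgen := iSup_localSigma.trans (MeasurableSpace.generateFrom_iUnion_measurableSet
    localSigma).symm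
  obtain ⟨t, ht, hlt⟩ := (Measure.MeasureDense.of_generateFrom_isSetAlgebra_finite
    (μ := cfgLaw q ρ) halg hgen).approx C hC (measure_ne_top _ _) η hη
  obtain ⟨M, hM⟩ := mem_iUnion.1 ht
  exact ⟨M, t, hM, hlt⟩

/-! ### Almost sure regeneration -/

/-- With `v ≤ 1 / 2`, levels in the box are at most `3 M / 2`, while record `k > 4 M` has level
above `2 M` and occurs after time `4 M`. -/
lemma box_subset_backCone (hv0 : 0 ≤ P.v) (hv1 : P.v ≤ 1 / 2) {c : Cfg} {k n M : ℕ}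
    (hk : 4 * M < k) (h : c.Rec P k n) : box M ⊆ backCone P.v (c.walk P 0 n) := by
  rintro z ⟨hz1, hz2⟩
  have hn : k ≤ n := le_of_rec (by linarith) h
  have h1 := h.1
  have hk' : 4 * (M : ℝ) < k := by exact_mod_cast hk
  have hn' : (k : ℝ) ≤ n := by exact_mod_cast hn
  have hM : (0 : ℝ) ≤ M := by positivity
  have hz1' : (z.1 : ℝ) ≤ M := by exact_mod_cast (abs_le.1 hz1).2
  have hz2' : -(M : ℝ) ≤ z.2 := by exact_mod_cast (abs_le.1 hz2).1
  have hz2'' := (abs_le.1 hz2).2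
  simp only [lev, walk_snd, Prod.snd_zero, zero_add, Int.cast_natCast] at h1
  have h2 : 2 * (M : ℝ) < (1 - P.v) * k := by nlinarith
  have h3 : 0 ≤ P.v * n := by positivity
  have h4 : -(M : ℝ) ≤ P.v * z.2 := by nlinarith
  refine ⟨?_, ?_, ?_⟩
  · have : (z.1 : ℝ) ≤ (c.walk P 0 n).1 := by linarith
    exact_mod_cast this
  · rw [walk_snd, Prod.snd_zero]
    omega
  · rw [walk_snd, Prod.snd_zero]
    push_cast
    linarith

/-- Almost surely, there is a regeneration time. -/
lemma ae_exists_regAt (hv : 0 < P.v) (hv1 : P.v ≤ 1 / 2) (h0 : 0 < P.pVac) (h1 : 0 < P.pOcc)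
    (hslow : Tendsto (fun L : ℕ => cfgLaw q ρ {c | c.Slow P L}) atTop (𝓝 0))
    (hreg : cfgLaw q ρ {c | c.Reg P 0} ≠ 0) : ∀ᵐ c ∂cfgLaw q ρ, ∃ n, c.RegAt P n := by
  have hm : MeasurableSet {c : Cfg | ∃ n, c.RegAt P n} := by
    rw [ofPred_exists]
    exact .iUnion measurableSet_regAt
  set μ := cfgLaw q ρ
  set C := {c : Cfg | ∃ n, c.RegAt P n}ᶜ with hC
  change μ C = 0
  by_contra hpos
  obtain ⟨l, hl⟩ := exists_measure_compl_freeRec_le hv (by linarith) hslow (ENNReal.half_pos hpos)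
  set κ := diagProb P l * μ {c | c.Reg P 0} with hκ
  have hκ0 : κ ≠ 0 := mul_ne_zero (diagProb_ne_zero h0 h1 l) hreg
  set r := (min κ 1).toReal
  have hrtop : min κ 1 ≠ ∞ := ne_top_of_le_ne_top ENNReal.one_ne_top (min_le_right _ _)
  have hr0 : 0 < r := ENNReal.toReal_pos (by simp [hκ0, min_eq_iff]) hrtop
  have hr1 : r ≤ 1 := by
    have := ENNReal.toReal_mono ENNReal.one_ne_top (min_le_right κ 1)
    simpa using this
  have hC0 : 0 < μ.real C := ENNReal.toReal_pos hpos (measure_ne_top _ _)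
  -- The estimates below give `r (μ C / 2 - η) ≤ η`, that is `r μ C / 2 ≤ (1 + r) η ≤ 2 η`, which
  -- fails for this `η`.
  set η := r * μ.real C / 8 with hη
  have hη0 : 0 < η := by positivity
  obtain ⟨M, t, ht, hlt⟩ := exists_local_approx (q := q) (ρ := ρ) hm.compl hη0
  -- The box comes from the approximation and the record is chosen after it; `l`, and with it the
  -- success probability, is already fixed.
  obtain ⟨k, hk, hkl⟩ := hl (4 * M)
  have hsymm : μ.real (symmDiff C t) ≤ η := ENNReal.toReal_le_of_le_ofReal hη0.le hlt.le
  have hatt := measure_attempt_ge (q := q) (ρ := ρ) hv.le (by linarith) (l := l)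
    (by omega : 1 ≤ k) (localSigma_le M t ht) fun c n hn =>
      have hb := box_subset_backCone hv.le hv1 hk hn
      restr_mem_iff ht (hits_mono hb) hb c
  have h2 : r * μ.real (t ∩ freeRec P k l) ≤ η := by
    refine le_trans ?_ hsymm
    rw [measureReal_def, ← ENNReal.toReal_mul, measureReal_def]
    refine ENNReal.toReal_mono (measure_ne_top _ _) ?_
    calc min κ 1 * μ (t ∩ freeRec P k l) ≤ κ * μ (t ∩ freeRec P k l) := by
          gcongr
          exact min_le_left _ _
      _ ≤ μ (t ∩ {c | ∃ n, c.RegAt P n}) := hatt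
      _ ≤ μ (symmDiff C t) := measure_mono fun c hc => Or.inr ⟨hc.1, fun h => h hc.2⟩
  have h3 : μ.real C ≤ μ.real (t ∩ freeRec P k l) + η + μ.real C / 2 := by
    have h4 : C ⊆ (t ∩ freeRec P k l) ∪ symmDiff C t ∪ (freeRec P k l)ᶜ := by
      intro c hc
      by_cases hcf : c ∈ freeRec P k l
      · by_cases hct : c ∈ t
        · exact Or.inl (Or.inl ⟨hct, hcf⟩)
        · exact Or.inl (Or.inr (Or.inl ⟨hc, hct⟩))
      · exact Or.inr hcf
    have h5 : μ.real (freeRec P k l)ᶜ ≤ μ.real C / 2 := by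
      have := ENNReal.toReal_mono (ENNReal.div_ne_top (measure_ne_top _ _) two_ne_zero) hkl
      rwa [ENNReal.toReal_div] at this
    calc μ.real C ≤ _ := measureReal_mono h4
      _ ≤ _ := measureReal_union_le _ _
      _ ≤ _ := add_le_add ((measureReal_union_le _ _).trans (by gcongr)) h5
  nlinarith

end RWDRE

namespace RWDRE

variable {P : Params}

/-! ### The sequence of blocks -/

instance : DiscreteMeasurableSpace Block := by
  refine ⟨fun s => ?_⟩
  change MeasurableSet[⨅ a, MeasurableSpace.map (Sigma.mk a) inferInstance] s
  rw [MeasurableSpace.measurableSet_iInf]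
  intro t
  exact (MeasurableSet.of_discrete : MeasurableSet (Sigma.mk t ⁻¹' s))

variable (P) in
/-- The configuration seen from the walk at the regeneration time. -/
noncomputable def Cfg.renew (c : Cfg) : Cfg := c.shift (c.walk P 0 (c.tau P))

variable (P) in
/-- The first block. -/
noncomputable def Cfg.blk (c : Cfg) : Block := block (fun n => (c.walk P 0 n).1) 0 (c.tau P)

lemma shift_shift (a b : ℤ × ℤ) (c : Cfg) : (c.shift a).shift b = c.shift (b + a) := by
  simp only [Cfg.shift, ← preimage_comp, add_assoc]
  congr 1
  congr 1
  funext w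
  simp only [Function.comp_apply, translate_translate]
  congr 1
  abel

/-- Successive shifts to regeneration points compose into one shift to the walk's position at the
sum of the durations, so the iterates see consecutive pieces of one walk. -/
lemma renew_iterate (c : Cfg) (n : ℕ) :
    (Cfg.renew P)^[n] c =
      c.shift (c.walk P 0 (∑ i ∈ Finset.range n, ((Cfg.renew P)^[i] c).tau P)) := by
  induction n with
  | zero =>
    simp only [Function.iterate_zero, id_eq, Finset.range_zero, Finset.sum_empty, walk_zero]
    cases c
    simp [Cfg.shift, funext translate_zero, Function.id_def.symm, preimage_id]
  | succ n ih =>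
    rw [Function.iterate_succ_apply', Finset.sum_range_succ, walk_add]
    set S := ∑ i ∈ Finset.range n, ((Cfg.renew P)^[i] c).tau P
    set t := ((Cfg.renew P)^[n] c).tau P with ht
    rw [Cfg.renew, ← ht, ih, shift_shift, walk_shift, zero_add]

lemma block_eq_blk (s : Sample) (n : ℕ) :
    block (walkX P.pVac P.pOcc s)
      (∑ i ∈ Finset.range n, ((Cfg.renew P)^[i] (toCfg s)).tau P)
      (((Cfg.renew P)^[n] (toCfg s)).tau P) = ((Cfg.renew P)^[n] (toCfg s)).blk P := by
  rw [Cfg.blk, block, block]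
  congr 1
  funext i
  have h := renew_iterate (P := P) (toCfg s) n
  set S := ∑ i ∈ Finset.range n, ((Cfg.renew P)^[i] (toCfg s)).tau P
  have h2 : ∀ j, ((Cfg.renew P)^[n] (toCfg s)).walk P 0 j =
      ((toCfg s).shift ((toCfg s).walk P 0 S)).walk P 0 j := fun j => by rw [h]
  simp only [walkX, walkY_eq, walk_add, h2]
  have h1 := congrArg Prod.fst
    (walk_shift (P := P) ((toCfg s).walk P 0 S) 0 (toCfg s) i)
  simp only [zero_add, Prod.fst_add] at h1
  simp only [walk_zero, Prod.fst_zero, sub_zero]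
  linarith

lemma blk_eq_iff {c : Cfg} {b : Block} :
    c.blk P = b ↔ c.tau P = b.1 ∧ ∀ i : Fin (b.1 + 1), (c.walk P 0 i).1 = b.2 i := by
  obtain ⟨t, x⟩ := b
  simp only [Cfg.blk, block, zero_add, walk_zero, Prod.fst_zero, sub_zero]
  constructor
  · intro h
    obtain ⟨rfl, h⟩ := Sigma.mk.inj_iff.1 h
    rw [heq_eq_eq] at h
    exact ⟨rfl, fun i => congrFun h i⟩
  · rintro ⟨rfl, h⟩
    congr 1
    funext i
    exact h i

lemma first_iff_blk {c : Cfg} (h : ∃ n, c.RegAt P n) {b : Block} :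
    c.First P b ↔ c.blk P = b := by
  rw [blk_eq_iff, Cfg.First, ← and_assoc]
  refine and_congr_left fun _ => ⟨fun h' => ?_, fun h' => ?_⟩
  · refine le_antisymm (Nat.sInf_le h'.1) ?_
    by_contra hlt
    exact h'.2 _ (not_le.1 hlt) (Nat.sInf_mem h)
  · rw [← h']
    exact ⟨Nat.sInf_mem h, fun m hm hr => absurd (Nat.sInf_le hr) (not_le.2 hm)⟩

lemma endPt_blk (c : Cfg) : endPt (c.blk P) = c.walk P 0 (c.tau P) :=
  (walk_of_eq (blk_eq_iff.1 rfl).2).symm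

/-- Regeneration is required from every space-time point because the renewed configurations are
random shifts; there are only countably many points, so almost surely this costs nothing. -/
lemma chain_iff (n : ℕ) (b : ℕ → Block) {c : Cfg} (h : ∀ a, ∃ n, (c.shift a).RegAt P n) :
    c.Chain P ((List.range n).map b) ↔ ∀ i < n, ((Cfg.renew P)^[i] c).blk P = b i := by
  induction n generalizing b c with
  | zero => simp [Cfg.Chain]
  | succ n ih =>
    have h0 : ∃ n, c.RegAt P n := by
      have := h 0
      have hz : c.shift 0 = c := by simpa [walk_zero] using (renew_iterate (P := P) c 0).symm
      rwa [hz] at this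
    rw [List.range_succ_eq_map, List.map_cons, List.map_map, Cfg.Chain, Nat.forall_lt_succ_left,
      first_iff_blk h0]
    refine and_congr_right fun hb => ?_
    have h1 : c.shift (endPt (b 0)) = c.renew P := by
      rw [← hb]
      simp only [endPt_blk, Cfg.renew]
    rw [h1, ih]
    · rfl
    · intro a
      rw [Cfg.renew, shift_shift]
      exact h _

lemma measurable_blk : Measurable fun c : Cfg => c.blk P := by
  refine measurable_to_countable' fun b => ?_
  have : (fun c : Cfg => c.blk P) ⁻¹' {b} = {c : Cfg | c.tau P = b.1} ∩
      ⋂ i : Fin (b.1 + 1), {c : Cfg | (c.walk P 0 i).1 = b.2 i} := by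
    ext c
    simp [blk_eq_iff]
  rw [this]
  refine (measurable_tau (measurableSet_singleton _)).inter (.iInter fun i => ?_)
  exact measurable_walk (P := P) 0 i (.of_discrete (s := {z | z.1 = b.2 i}))

lemma measurable_renew : Measurable (Cfg.renew P) := by
  have h1 : Measurable fun p : Cfg × (ℤ × ℤ) => p.1.shift p.2 :=
    measurable_from_prod_countable_left fun a => measurable_shift a
  have h2 : Measurable fun p : Cfg × ℕ => p.1.walk P 0 p.2 :=
    measurable_from_prod_countable_left fun n => measurable_walk 0 n
  exact h1.comp (measurable_id.prodMk (h2.comp (measurable_id.prodMk measurable_tau)))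

variable {q : Ioo (0 : ℝ) 1} {ρ : ℝ≥0}

variable (P q ρ) in
/-- The law of a block after the first one. -/
noncomputable def blockLaw : Measure Block :=
  (ProbabilityTheory.cond (cfgLaw q ρ) {c | c.Reg P 0}).map (Cfg.blk P)

/-- Conditioning on regeneration at `0` cancels the future factor, which identifies the weights in
the chain formula as the law of a block. -/
lemma blockLaw_singleton (hv : 0 ≤ P.v) (hreg : cfgLaw q ρ {c | c.Reg P 0} ≠ 0)
    (htau : ∀ᵐ c ∂(cfgLaw q ρ), ∃ n, c.RegAt P n) (b : Block) :
    blockLaw P q ρ {b} = pastProb P q ρ b True := by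
  rw [blockLaw, Measure.map_apply measurable_blk (measurableSet_singleton b),
    cond_apply (measurableSet_reg 0)]
  have : cfgLaw q ρ ({c | c.Reg P 0} ∩ Cfg.blk P ⁻¹' {b}) =
      cfgLaw q ρ {c | c.Reg P 0 ∧ c.First P b} := by
    refine measure_congr ?_
    filter_upwards [htau] with c hc
    exact propext (and_congr_right fun _ => (first_iff_blk hc).symm)
  rw [this, measure_reg_first q ρ hv, mul_comm (pastProb _ _ _ _ _), ← mul_assoc,
    ENNReal.inv_mul_cancel hreg (measure_ne_top _ _), one_mul]

lemma ae_forall_shift (htau : ∀ᵐ c ∂(cfgLaw q ρ), ∃ n, c.RegAt P n) :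
    ∀ᵐ c ∂(cfgLaw q ρ), ∀ a, ∃ n, (c.shift a).RegAt P n :=
  ae_all_iff.2 fun a => (measurePreserving_shift q ρ a).quasiMeasurePreserving.ae htau

variable (P q ρ) in
/-- The laws of the blocks. -/
noncomputable def blockLaws (n : ℕ) : Measure Block :=
  if n = 0 then (cfgLaw q ρ).map (Cfg.blk P) else blockLaw P q ρ

lemma measurable_blk_renew (n : ℕ) : Measurable fun c => ((Cfg.renew P)^[n] c).blk P :=
  measurable_blk.comp (measurable_renew.iterate n)

lemma measure_blocks (hv : 0 ≤ P.v) (hreg : cfgLaw q ρ {c | c.Reg P 0} ≠ 0)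
    (htau : ∀ᵐ c ∂(cfgLaw q ρ), ∃ n, c.RegAt P n) (n : ℕ) (b : ℕ → Block) :
    cfgLaw q ρ {c | ∀ i < n, ((Cfg.renew P)^[i] c).blk P = b i} =
      ∏ i ∈ Finset.range n, blockLaws P q ρ i {b i} := by
  have h1 : cfgLaw q ρ {c | ∀ i < n, ((Cfg.renew P)^[i] c).blk P = b i} =
      cfgLaw q ρ {c | c.Chain P ((List.range n).map b)} := by
    refine measure_congr ?_
    filter_upwards [ae_forall_shift htau] with c hc
    exact propext (chain_iff n b hc).symm
  rw [h1]
  cases n with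
  | zero => simp [Cfg.Chain]
  | succ n =>
    rw [List.range_succ_eq_map, List.map_cons, measure_chain_cons q ρ hv, Finset.prod_range_succ',
      mul_comm, List.map_map, List.map_map]
    congr 1
    · rw [Finset.prod_eq_multiset_prod, Finset.range_val, Multiset.range, Multiset.map_coe,
        Multiset.prod_coe]
      congr 1
      refine List.map_congr_left fun i _ => ?_
      simp [blockLaws, blockLaw_singleton hv hreg htau]
    · rw [blockLaws, if_pos rfl, Measure.map_apply measurable_blk (measurableSet_singleton _)]
      refine measure_congr ?_
      filter_upwards [htau] with c hc
      exact propext (first_iff_blk hc)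

lemma isProbabilityMeasure_blockLaws (hreg : cfgLaw q ρ {c | c.Reg P 0} ≠ 0) (n : ℕ) :
    IsProbabilityMeasure (blockLaws P q ρ n) := by
  have := cond_isProbabilityMeasure (μ := cfgLaw q ρ) hreg
  unfold blockLaws blockLaw
  split_ifs
  · exact Measure.isProbabilityMeasure_map measurable_blk.aemeasurable
  · exact Measure.isProbabilityMeasure_map measurable_blk.aemeasurable

lemma map_blocks_fin (hv : 0 ≤ P.v) (hreg : cfgLaw q ρ {c | c.Reg P 0} ≠ 0)
    (htau : ∀ᵐ c ∂(cfgLaw q ρ), ∃ n, c.RegAt P n) (n : ℕ) :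
    (cfgLaw q ρ).map (fun c (i : Fin n) => ((Cfg.renew P)^[i] c).blk P) =
      Measure.pi fun i : Fin n => blockLaws P q ρ i := by
  have := fun i => isProbabilityMeasure_blockLaws (P := P) hreg i
  refine Measure.ext_of_singleton fun b => ?_
  rw [Measure.pi_singleton, Measure.map_apply
    (measurable_pi_lambda _ fun i => measurable_blk_renew _) (measurableSet_singleton b)]
  have h := measure_blocks hv hreg htau n
    -- The filler block beyond `n` is never read.
    (fun i => if h : i < n then b ⟨i, h⟩ else ⟨0, fun _ => 0⟩)
  rw [Finset.prod_range] at h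
  simp only [Fin.is_lt, dite_true, Fin.eta] at h
  rw [← h]
  congr 1
  ext c
  simp only [mem_preimage, mem_singleton_iff, funext_iff, mem_ofPred_eq]
  constructor
  · intro h i hi
    simpa [hi] using h ⟨i, hi⟩
  · intro h i
    simpa using h i i.2

lemma map_blocks (hv : 0 ≤ P.v) (hreg : cfgLaw q ρ {c | c.Reg P 0} ≠ 0)
    (htau : ∀ᵐ c ∂(cfgLaw q ρ), ∃ n, c.RegAt P n)
    [∀ n, IsProbabilityMeasure (blockLaws P q ρ n)] :
    (cfgLaw q ρ).map (fun c n => ((Cfg.renew P)^[n] c).blk P) =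
      Measure.infinitePi (blockLaws P q ρ) := by
  classical
  refine Measure.eq_infinitePi _ fun s t ht => ?_
  obtain ⟨n, hn⟩ : ∃ n, s ⊆ Finset.range n := s.exists_nat_subset_range
  rw [Measure.map_apply (measurable_pi_lambda _ measurable_blk_renew)
    (.pi s.countable_toSet fun _ _ => ht _)]
  have h := congrArg (fun μ => μ (Set.univ.pi fun i : Fin n => if (i : ℕ) ∈ s then t i else univ))
    (map_blocks_fin hv hreg htau n)
  rw [Measure.pi_pi, Measure.map_apply
    (measurable_pi_lambda _ fun i => measurable_blk_renew _) .of_discrete] at h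
  convert h using 1
  · congr 1
    ext c
    simp only [mem_preimage, Set.mem_pi, Finset.mem_coe, mem_univ, true_imp_iff]
    constructor
    · intro h i
      split_ifs with hi
      · exact h i hi
      · trivial
    · intro h i hi
      have := h ⟨i, Finset.mem_range.1 (Finset.mem_of_subset hn hi)⟩
      simpa [hi] using this
  · rw [← Finset.prod_range (fun i => blockLaws P q ρ i (if i ∈ s then t i else univ)),
      ← Finset.prod_subset hn]
    · exact Finset.prod_congr rfl fun i hi => by simp [hi]
    · intro i _ hi
      simp [hi]

/-- The renewal structure, once regeneration is known to occur. -/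
theorem exists_regeneration (hv0 : 0 ≤ P.v) (hv1 : P.v < 1)
    (hreg : cfgLaw q ρ {c | c.Reg P 0} ≠ 0)
    (htau : ∀ᵐ c ∂(cfgLaw q ρ), ∃ n, c.RegAt P n) :
    ∃ (Ω : Type) (_ : MeasurableSpace Ω) (μ : Measure Ω) (π : Ω → Sample) (T : ℕ → Ω → ℕ),
      MeasurePreserving π μ (law q ρ) ∧
      (∀ k, Measurable (T k)) ∧
      (∀ᵐ ω ∂μ, (T 0 ω : ℕ∞) = regTime P.pVac P.pOcc P.v (π ω)) ∧
      let B : ℕ → Ω → Block := fun n ω =>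
        block (walkX P.pVac P.pOcc (π ω)) (∑ i ∈ Finset.range n, T i ω) (T n ω)
      iIndepFun (fun n => B (n + 1)) μ ∧
      IndepFun (B 0) (fun ω n => B (n + 1) ω) μ ∧
      ∀ n, IdentDistrib (B (n + 1))
        (fun s => block (walkX P.pVac P.pOcc s) 0 (regTime P.pVac P.pOcc P.v s).toNat)
        μ (coneLaw P.pVac P.pOcc q ρ P.v) := by
  have hprob := fun n => isProbabilityMeasure_blockLaws (P := P) hreg n
  -- The times are those of the iterated renewals of the sample itself, so no extra randomness is
  -- needed.
  refine ⟨Sample, inferInstance, law q ρ, id, fun n s => ((Cfg.renew P)^[n] (toCfg s)).tau P,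
    MeasurePreserving.id _, fun k => measurable_tau.comp
      ((measurable_renew.iterate k).comp measurable_toCfg), ?_, ?_⟩
  · filter_upwards [ae_of_ae_map measurable_toCfg.aemeasurable htau] with s hs
    rw [id, regTime_eq hv1, if_pos hs]
    rfl
  intro B
  have hB : ∀ n, B n = fun s => ((Cfg.renew P)^[n] (toCfg s)).blk P := fun n => by
    funext s
    exact block_eq_blk s n
  have hBm : ∀ n, Measurable (B n) := fun n => by
    rw [hB]
    exact (measurable_blk_renew n).comp measurable_toCfg
  have hmap : (law q ρ).map (fun s n => B n s) = Measure.infinitePi (blockLaws P q ρ) := by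
    rw [← map_blocks hv0 hreg htau, cfgLaw,
      Measure.map_map (measurable_pi_lambda _ measurable_blk_renew) measurable_toCfg]
    congr 1
    funext s n
    rw [hB]
    rfl
  have hlaw : ∀ n, (law q ρ).map (B n) = blockLaws P q ρ n := by
    intro n
    rw [← Measure.infinitePi_map_eval (blockLaws P q ρ) n, ← hmap,
      Measure.map_map (measurable_pi_apply n) (measurable_pi_lambda _ hBm)]
    rfl
  have hind : iIndepFun B (law q ρ) := by
    rw [iIndepFun_iff_map_fun_eq_infinitePi_map hBm, hmap]
    congr 1
    funext n
    exact (hlaw n).symm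
  refine ⟨hind.precomp (add_left_injective 1), ?_, fun n => ⟨(hBm _).aemeasurable, ?_, ?_⟩⟩
  -- The first block against the σ-algebra of all the later ones.
  · have h := indep_iSup_of_disjoint (fun n => (hBm n).comap_le) hind
      (S := {0}) (T := {n | n ≠ 0}) (by simp)
    rw [IndepFun_iff_Indep]
    refine indep_of_indep_of_le_left (indep_of_indep_of_le_right h ?_) ?_
    · rw [← measurable_iff_comap_le, @measurable_pi_iff]
      intro n
      exact (comap_measurable (B (n + 1))).mono
        (le_iSup₂_of_le (n + 1) (by simp) le_rfl) le_rfl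
    · simp
  · refine Measurable.aemeasurable ?_
    have : (fun s => block (walkX P.pVac P.pOcc s) 0 (regTime P.pVac P.pOcc P.v s).toNat) =
        fun s => (toCfg s).blk P := by
      funext s
      rw [regTime_toNat hv1]
      simpa using block_eq_blk (P := P) s 0
    rw [this]
    exact measurable_blk.comp measurable_toCfg
  · rw [hlaw, blockLaws, if_neg (Nat.succ_ne_zero n), blockLaw]
    have h1 : (fun s => block (walkX P.pVac P.pOcc s) 0 (regTime P.pVac P.pOcc P.v s).toNat) =
        Cfg.blk P ∘ toCfg := by
      funext s
      rw [regTime_toNat hv1]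
      simpa using block_eq_blk (P := P) s 0
    rw [h1, ← Measure.map_map measurable_blk measurable_toCfg]
    congr 1
    have h2 : regEvent P.pVac P.pOcc P.v 0 = toCfg ⁻¹' {c | c.Reg P 0} := by
      ext s
      exact mem_regEvent s 0
    have hm : MeasurableSet {c : Cfg | c.Reg P 0} := measurableSet_reg 0
    ext E hE
    rw [coneLaw, Measure.map_apply measurable_toCfg hE, h2, cond_apply hm,
      cond_apply (measurable_toCfg hm), ← preimage_inter, cfgLaw,
      Measure.map_apply measurable_toCfg hm, Measure.map_apply measurable_toCfg (hm.inter hE)]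

end RWDRE

/-- Here `T k` stands for `τ_{k+1}`, so that `∑ i ∈ Finset.range n, T i` is
`S_n = τ_1 + ⋯ + τ_n`; the block with index `0` is the first block, that is
`(τ, (X_s)_{0 ≤ s ≤ τ})`. -/
theorem theoremt
    (pVac pOcc : ℝ) (q : Set.Ioo (0 : ℝ) 1) (ρ : ℝ≥0) (vStar : ℝ)
    (hpVac : pVac ∈ Set.Icc (0 : ℝ) 1) (hpOcc : pOcc ∈ Set.Icc (0 : ℝ) 1)
    (hvVac : -1 < 2 * pVac - 1) (hvOcc : 0 < 2 * pOcc - 1) (hρ : 0 < ρ)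
    (hvStar : vStar ∈ Set.Ioo 0 (2 * pOcc - 1))
    (hball : Ballistic pVac pOcc q ρ vStar) :
    ∃ (Ω : Type) (_ : MeasurableSpace Ω) (P : Measure Ω) (π : Ω → Sample) (T : ℕ → Ω → ℕ),
      MeasurePreserving π P (law q ρ) ∧
      (∀ k, Measurable (T k)) ∧
      (∀ᵐ ω ∂P, (T 0 ω : ℕ∞) = regTime pVac pOcc (vStar / 3) (π ω)) ∧
      let B : ℕ → Ω → Block := fun n ω =>
        block (walkX pVac pOcc (π ω)) (∑ i ∈ Finset.range n, T i ω) (T n ω)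
      iIndepFun (fun n => B (n + 1)) P ∧
      IndepFun (B 0) (fun ω n => B (n + 1) ω) P ∧
      ∀ n, IdentDistrib (B (n + 1))
        (fun s => block (walkX pVac pOcc s) 0 (regTime pVac pOcc (vStar / 3) s).toNat)
        P (coneLaw pVac pOcc q ρ (vStar / 3)) := by
  obtain ⟨hv0, hv1⟩ := hvStar
  have hOcc1 := hpOcc.2
  set P : Params := ⟨pVac, pOcc, vStar / 3⟩ with hP
  have hv : 0 < P.v := by simp only [hP]; linarith
  -- `vStar < 2 * pOcc - 1 ≤ 1`, so the slope is even below `1 / 3`.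
  have hv2 : P.v ≤ 1 / 2 := by simp only [hP]; linarith
  have h0 : 0 < P.pVac := by simp only [hP]; linarith
  have h1 : 0 < P.pOcc := by simp only [hP]; linarith
  have hslow := tendsto_slow (P := P) (q := q) (ρ := ρ) <| by
    have : 3 * P.v = vStar := by simp only [hP]; ring
    rwa [this]
  have hreg := measure_reg_ne_zero (q := q) (ρ := ρ) hv hv2 h0 h1 hslow
  exact exists_regeneration (P := P) hv.le (by linarith) hreg
    (ae_exists_regAt hv hv2 h0 h1 hslow hreg)
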